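/- Plane graphs are considered up to equivalence, i.e. they are given by the cyclic orders of the edges around the vertices and by the outer face. A drawing of a plane graph is \emph{crossing-free} if it is a limit of planar straight-line drawings with these cyclic orders and this outer face. An \emph{area assignment} of a plane graph is a function $\mathcal A$ from its inner faces to $\mathbb R_{\ge 0}$; a plane graph is \emph{area-universal} if for each area assignment $\mathcal A$ it has a crossing-free drawing in which every inner face $f$ has area $\mathcal A(f)$. Let $T$ be a plane triangulation with a $P$-order $\mathcal P$, i.e. an ordering $v_1,\dots,v_n$ ($n\ge 4$) of its vertices together with sets $\mathrm{pred}(v_i)\subseteq N(v_i)\cap\{v_1,\dots,v_{i-1}\}$ such that $\mathrm{pred}(v_1)=\emptyset$, $\mathrm{pred}(v_2)=\{v_1\}$, $\mathrm{pred}(v_3)=\mathrm{pred}(v_4)=\{v_1,v_2\}$ and $|\mathrm{pred}(v_i)|=3$ for $i>4$. Orient each edge between $v_i$ and a vertex of $\mathrm{pred}(v_i)$ from $v_i$ to that vertex; let $e$ be the edge that remains unoriented and $f_a,f_b$ the two faces incident to $e$. Let $\mathcal A$ be an area assignment of $T$ whose values $\mathcal A(f)$, over the inner faces $f$, are algebraically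 independent over $\mathbb Q$, and put $\mathcal A(f_o):=-\sum_{f}\mathcal A(f)$ for the outer face $f_o$. A last face function $\mathfrak f\in\mathbb R(x_4)$ of $T$ with respect to $\mathcal P$ and $\mathcal A$ is obtained as follows: the vertices are placed at points $(x_i,y_i)$ whose coordinates are rational functions of the variable $x_4$, where $v_1=(0,0)$, $v_2=(1,0)$, the first coordinate of $v_3$ is a real constant, the first coordinate of $v_4$ is the variable $x_4$, and for each face $f\notin\{f_a,f_b\}$ with vertices $u,v,w$ (in counterclockwise order for inner faces, clockwise order for the outer face) the area equation $$\det\begin{pmatrix}x_u&y_u&1\\x_v&y_v&1\\x_w&y_w&1\end{pmatrix}=\mathcal A(f)$$ holds; then $\mathfrak f$ is the value of this determinant for the face $f_a$. Suppose that, for one such algebraically independent area assignment $\mathcal A$, $\mathfrak f=p/q$ with real polynomials $p$ and $q\ne0$ that have no common real root and for which $\max\{\deg p,\deg q\}$ is odd. Then every plane graph whose underlying planar graph is that of $T$ is area-universal. -/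

import Mathlib

open scoped NNReal Topology Polynomial

/-! ## Plane graphs, given combinatorially -/

/-- A rotation system of `G`: `rot d` is the dart following `d` in the counterclockwise cyclic
order of the darts (directed edges) that leave the vertex `d.fst`. -/
structure RotationSystem {V : Type*} (G : SimpleGraph V) where
  rot : Equiv.Perm G.Dart
  rot_fst : ∀ d, (rot d).fst = d.fst
  rot_cyclic : ∀ d d' : G.Dart, d.fst = d'.fst → rot.SameCycle d d'

namespace RotationSystem

variable {V : Type*} {G : SimpleGraph V}

/-- The walk along the boundary of the face to the left of a dart: arriving at the head of `d`,
continue with the dart that is clockwise next to the reversal of `d`. Thus inner faces are walked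
counterclockwise and the outer face is walked clockwise. -/
def facePerm (R : RotationSystem G) : Equiv.Perm G.Dart :=
  R.rot⁻¹ * (SimpleGraph.Dart.symm_involutive (G := G)).toPerm

/-- The faces: cycles of the boundary walk. -/
def Face (R : RotationSystem G) : Type _ :=
  Quotient (Equiv.Perm.SameCycle.setoid R.facePerm)

/-- The face to the left of a dart. -/
def face (R : RotationSystem G) (d : G.Dart) : R.Face :=
  Quotient.mk (Equiv.Perm.SameCycle.setoid R.facePerm) d

end RotationSystem

/-- A plane graph with underlying (connected) planar graph `G`, up to equivalence: the cyclic orders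
of the edges at the vertices, satisfying Euler's formula, together with the outer face. -/
structure PlaneGraph {V : Type*} (G : SimpleGraph V) extends RotationSystem G where
  connected : G.Connected
  euler : Nat.card V + Nat.card toRotationSystem.Face = Nat.card G.edgeSet + 2
  outer : toRotationSystem.Face

/-- Straight-line drawing without crossings: the vertices are distinct points, the relative interior
of an edge contains no vertex, and the relative interiors of distinct edges are disjoint. -/
def IsPlanarStraightLine {V : Type*} (G : SimpleGraph V) (p : V → ℂ) : Prop :=
  Function.Injective p ∧
  (∀ u v w, G.Adj u v → p w ∉ openSegment ℝ (p u) (p v)) ∧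
  (∀ u v u' v', G.Adj u v → G.Adj u' v' → s(u, v) ≠ s(u', v') →
    Disjoint (openSegment ℝ (p u) (p v)) (openSegment ℝ (p u') (p v')))

/-- The point set covered by a straight-line drawing. -/
def drawnSet {V : Type*} (G : SimpleGraph V) (p : V → ℂ) : Set ℂ :=
  Set.range p ∪ ⋃ d : G.Dart, segment ℝ (p d.fst) (p d.snd)

/-- The counterclockwise angle in `(0, 2π]` from the direction of `z` to the direction of `w`. -/
noncomputable def ccwAngle (z w : ℂ) : ℝ :=
  toIocMod Real.two_pi_pos 0 (Complex.arg (w / z))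

/-- The region of the drawing immediately to the left of the dart `d` is unbounded. -/
def LeftUnbounded {V : Type*} (G : SimpleGraph V) (p : V → ℂ) (d : G.Dart) : Prop :=
  ∀ᶠ ε : ℝ in 𝓝[>] 0, ¬ Bornology.IsBounded (connectedComponentIn (drawnSet G p)ᶜ
    ((p d.fst + p d.snd) / 2 + ε * Complex.I * (p d.snd - p d.fst)))

/-- `x`- and `y`-coordinates of three points `u v w`: the determinant that equals
twice the signed area of the triangle `u v w`. -/
def triDet {V R : Type*} [CommRing R] (x y : V → R) (u v w : V) : R :=
  Matrix.det !![x u, y u, 1; x v, y v, 1; x w, y w, 1]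

namespace PlaneGraph

variable {V : Type*} {G : SimpleGraph V}

/-- The inner faces. -/
def InnerFace (T : PlaneGraph G) : Type _ := {f : T.Face // f ≠ T.outer}

/-- All faces (including the outer face) are triangles. -/
def IsTriangulation (T : PlaneGraph G) : Prop :=
  ∀ d, T.facePerm (T.facePerm (T.facePerm d)) = d

/-- A planar straight-line drawing that is equivalent to `T`: the cyclic order of the edges at
every vertex and the outer face coincide. -/
def IsPlanarDrawing (T : PlaneGraph G) (p : V → ℂ) : Prop :=
  IsPlanarStraightLine G p ∧
  (∀ d d' : G.Dart, d'.fst = d.fst →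
    ccwAngle (p d.snd - p d.fst) (p (T.rot d).snd - p d.fst) ≤
      ccwAngle (p d.snd - p d.fst) (p d'.snd - p d.fst)) ∧
  (∀ d : G.Dart, T.face d = T.outer → LeftUnbounded G p d)

/-- A (possibly degenerate) crossing-free drawing of `T`: a limit of planar straight-line drawings
of `T`. -/
def IsCrossingFreeDrawing (T : PlaneGraph G) (p : V → ℂ) : Prop :=
  p ∈ closure {q : V → ℂ | T.IsPlanarDrawing q}

/-- The area enclosed by the boundary walk of a face (shoelace formula), counted positively for a
counterclockwise walk. -/
noncomputable def faceArea (T : PlaneGraph G) (p : V → ℂ) (f : T.Face) : ℝ :=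
  (∑ᶠ d ∈ {d : G.Dart | T.face d = f},
    ((p d.fst).re * (p d.snd).im - (p d.snd).re * (p d.fst).im)) / 2

/-- An area assignment prescribes a nonnegative area for each inner face. -/
abbrev AreaAssignment (T : PlaneGraph G) : Type _ := T.InnerFace → ℝ≥0

/-- `A` is realized by some crossing-free drawing of `T`. -/
def Realizable (T : PlaneGraph G) (A : T.AreaAssignment) : Prop :=
  ∃ p : V → ℂ, T.IsCrossingFreeDrawing p ∧ ∀ f : T.InnerFace, T.faceArea p f.1 = A f

def AreaUniversal (T : PlaneGraph G) : Prop :=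
  ∀ A : T.AreaAssignment, T.Realizable A

/-- The prescribed areas are algebraically independent over `ℚ`. -/
def AlgIndep (T : PlaneGraph G) (A : T.AreaAssignment) : Prop :=
  AlgebraicIndependent ℚ (fun f : T.InnerFace => (A f : ℝ))

open Classical in
/-- The right-hand sides of the area equations: the area assignment is extended to the outer face,
whose boundary is oriented clockwise, by minus the total area. -/
noncomputable def extendedArea (T : PlaneGraph G) (A : T.AreaAssignment) (f : T.Face) : ℝ :=
  if h : f = T.outer then -∑ᶠ g : T.InnerFace, (A g : ℝ) else (A ⟨f, h⟩ : ℝ)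

/-- In a triangulation, the determinant of the three vertices of the face to the left of `d`,
in their order along the boundary walk. -/
def faceDet {R : Type*} [CommRing R] (T : PlaneGraph G) (x y : V → R) (d : G.Dart) : R :=
  triDet x y d.fst d.snd (T.facePerm d).snd

end PlaneGraph

/-! ## `P`-orders and the last face function -/

/-- A `P`-order of `G`. The vertices `v₁, v₂, …, vₙ` are `v 0, v 1, …, v (n - 1)`, with
`n = m + 4`. -/
structure POrder {V : Type*} (G : SimpleGraph V) where
  m : ℕ
  v : Fin (m + 4) ≃ V
  pred : V → Set V
  pred_adj : ∀ u, ∀ w ∈ pred u, G.Adj u w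
  pred_lt : ∀ u, ∀ w ∈ pred u, v.symm w < v.symm u
  pred_one : pred (v 0) = ∅
  pred_two : pred (v 1) = {v 0}
  pred_three : pred (v 2) = {v 0, v 1}
  pred_four : pred (v 3) = {v 0, v 1}
  pred_card : ∀ i, 3 < i → (pred (v i)).ncard = 3

/-- The dart `e` belongs to an edge that gets no orientation when the edge between `u` and
each `w ∈ pred u` is oriented from `u` to `w`. (In a triangulation there is one such edge.) -/
def POrder.Unoriented {V : Type*} {G : SimpleGraph V} (P : POrder G) (e : G.Dart) : Prop :=
  e.snd ∉ P.pred e.fst ∧ e.fst ∉ P.pred e.snd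

namespace PlaneGraph

variable {V : Type*} {G : SimpleGraph V}

/-- `x, y` are the coordinates, as rational functions of the variable `x₄`, of the
one-parameter family of almost `A`-realizing vertex placements:
`v₁ = (0, 0)`, `v₂ = (1, 0)`, the first coordinate of `v₃` is a constant `x₃`, the first
coordinate of `v₄` is the variable, and the area equations of all faces hold, except for
the two faces incident to the edge of `e`. -/
structure IsAlmostRealizing (T : PlaneGraph G) (P : POrder G) (A : T.AreaAssignment)
    (e : G.Dart) (x₃ : ℝ) (x y : V → RatFunc ℝ) : Prop where
  x_one : x (P.v 0) = 0
  y_one : y (P.v 0) = 0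
  x_two : x (P.v 1) = 1
  y_two : y (P.v 1) = 0
  x_three : x (P.v 2) = RatFunc.C x₃
  x_four : x (P.v 3) = RatFunc.X
  area_eq : ∀ d : G.Dart, T.face d ≠ T.face e → T.face d ≠ T.face e.symm →
    T.faceDet x y d = RatFunc.C (T.extendedArea A (T.face d))

/-- `f` is the last face function of `T` for `P` and `A`: the area, as a rational function
of `x₄`, of a face incident to the unoriented edge, in the almost realizing vertex placements.
It is unique up to the choice of that face and of the constant `x₃`. -/
def IsLastFaceFunction (T : PlaneGraph G) (P : POrder G) (A : T.AreaAssignment)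
    (f : RatFunc ℝ) : Prop :=
  ∃ (e : G.Dart) (x₃ : ℝ) (x y : V → RatFunc ℝ), P.Unoriented e ∧
    T.IsAlmostRealizing P A e x₃ x y ∧ f = T.faceDet x y e

end PlaneGraph

/-- Two real polynomials are crr if they do not have common real roots. -/
def CRR (p q : ℝ[X]) : Prop := ∀ z : ℝ, ¬ (p.IsRoot z ∧ q.IsRoot z)

/-- The max-degree of `p / q`. -/
noncomputable def maxDegree (p q : ℝ[X]) : ℕ := max p.natDegree q.natDegree

/-! The area equations are polynomial, so the theorem is proved for generic areas by specializing
one known family of placements, and for all areas by a limit.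

Generic areas. Extend areas to all faces so that they sum to zero; then the outer face plays no
special role. Let `K` be the field generated by the areas of the faces other than `f_a`, `f_b`.
After a shear that makes the abscissa of `v₃` rational, all coordinates lie in `K(t)`, where `t` is
a real translate of `x₄` (`coord_mem`). Indeed each later vertex has three predecessors `u₁`, `u₂`,
`u₃` forming a path of oriented edges (`exists_path_pred`, a count with Euler's formula). The
triangles `u₁u₂v` and `u₂u₃v` need not be faces, but as cycles on a sphere they bound combinations
of faces in which `f_a`, `f_b` have coefficient zero (`exists_triDet_eq`), so their areas are known.
Cramer's rule then gives `v`, as genericity excludes collinear triples (`triDet_ne_zero`).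

Since `K` is a field of rational functions in independent areas, it also embeds into the reals by
another generic assignment `a'`. It remains to solve `P/Q = c` for the last face function `P/Q` in
lowest terms over `K` and `c = a'(f_a)`. Passing from `p/q` to `P/Q` cancels a factor without real
roots, so the max-degree stays odd. As `c` is transcendental over `K`, the polynomial `P - cQ` has
odd degree and hence a real root `z`, which is again transcendental, so no coordinate has a pole
there. The equation of `f_b` follows because the areas sum to zero (`exists_faceDet_eq`).

From areas to drawings. If all inner triangles are positively oriented, winding numbers show that
they do not overlap, and the placement is a planar drawing (`PositiveInner.isPlanarDrawing`).
Arbitrary areas are limits of generic ones; after an area-preserving affine map the drawings stay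
bounded, and a convergent subsequence gives a crossing-free drawing
(`RealizesGeneric.areaUniversal`).

Other embeddings. Any plane graph on the same graph is a triangulation by its edge count, and it
agrees with `T` up to reflection and outer face (`apex_eq_or_apex_eq`). Reflection negates all
signed areas, which preserves genericity. -/

namespace RotationSystem

/-! ### Rotation systems: invariant functions on darts. -/

variable {V : Type*} {G : SimpleGraph V} (R : RotationSystem G)

theorem rot_facePerm (d : G.Dart) : R.rot (R.facePerm d) = d.symm := by
  simp [facePerm, Function.Involutive.toPerm]

theorem facePerm_fst (d : G.Dart) : (R.facePerm d).fst = d.snd := by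
  have h := R.rot_fst (R.facePerm d)
  rw [rot_facePerm] at h
  exact h.symm

theorem facePerm_rot_symm (d : G.Dart) : R.facePerm (R.rot d).symm = d := by
  apply R.rot.injective
  rw [rot_facePerm, SimpleGraph.Dart.symm_symm]

theorem face_facePerm (d : G.Dart) : R.face (R.facePerm d) = R.face d :=
  Quotient.sound (s := Equiv.Perm.SameCycle.setoid R.facePerm)
    (Equiv.Perm.sameCycle_apply_left.mpr (Equiv.Perm.SameCycle.refl _ _))

theorem face_rot_symm (d : G.Dart) : R.face (R.rot d).symm = R.face d := by
  rw [← face_facePerm, facePerm_rot_symm]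

theorem face_eq_iff {d d' : G.Dart} : R.face d = R.face d' ↔ R.facePerm.SameCycle d d' :=
  ⟨fun h => Quotient.exact (s := Equiv.Perm.SameCycle.setoid R.facePerm) h,
    fun h => Quotient.sound (s := Equiv.Perm.SameCycle.setoid R.facePerm) h⟩

theorem face_surjective : Function.Surjective R.face :=
  Quotient.mk_surjective

instance [Finite V] : Finite G.Dart :=
  Finite.of_injective (fun d : G.Dart => d.toProd) SimpleGraph.Dart.toProd_injective

instance [Finite V] : Finite R.Face :=
  Finite.of_surjective _ R.face_surjective

/-- A function that is unchanged by `f` takes one value on each cycle of `f`. -/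
theorem _root_.Equiv.Perm.SameCycle.apply_eq {X Y : Type*} {f : Equiv.Perm X} {g : X → Y}
    (h : ∀ x, g (f x) = g x) {x y : X} (hxy : f.SameCycle x y) : g x = g y := by
  obtain ⟨n, rfl⟩ := hxy
  have key : ∀ (n : ℕ) (x : X), g ((f ^ n) x) = g x := by
    intro n
    induction n with
    | zero => simp
    | succ k ih => intro x; rw [pow_succ', Equiv.Perm.mul_apply, h, ih]
  cases n with
  | ofNat n => simpa using (key n x).symm
  | negSucc n =>
    have := key (n + 1) ((f ^ Int.negSucc n) x)
    rw [← this, zpow_negSucc]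
    simp

theorem apply_eq_of_fst_eq {Y : Type*} {c : G.Dart → Y} {v : V}
    (h : ∀ d : G.Dart, d.fst = v → c (R.rot d) = c d) {d d' : G.Dart}
    (hd : d.fst = v) (hd' : d'.fst = v) : c d = c d' := by
  classical
  -- With the value `none` away from `v`, invariance at `v` alone becomes invariance under the whole
  -- rotation.
  let g : G.Dart → Option Y := fun x => if x.fst = v then some (c x) else none
  have h1 : ∀ x, g (R.rot x) = g x := by
    intro x
    simp only [g, R.rot_fst]
    split_ifs with hx
    · rw [h x hx]
    · rfl
  have h2 := Equiv.Perm.SameCycle.apply_eq h1 (R.rot_cyclic d d' (hd.trans hd'.symm))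
  simpa [g, hd, hd'] using h2

end RotationSystem

/-! ### Boundaries, gradients and circulations on the sphere. -/

namespace PlaneGraph

variable {V : Type*} {G : SimpleGraph V} (T : PlaneGraph G)

/-- Face walk and reversal generate the rotation; with connectedness they act transitively on the
darts. -/
theorem apply_eq_of_facePerm_of_symm {Y : Type*} {c : G.Dart → Y}
    (h₁ : ∀ d, c (T.facePerm d) = c d) (h₂ : ∀ d, c d.symm = c d) (d d' : G.Dart) :
    c d = c d' := by
  have hrot : ∀ d, c (T.rot d) = c d := fun d => by
    rw [← h₂ (T.rot d), ← h₁, T.facePerm_rot_symm]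
  have hv : ∀ d d' : G.Dart, d.fst = d'.fst → c d = c d' := fun d d' h =>
    T.apply_eq_of_fst_eq (v := d'.fst) (fun d _ => hrot d) h rfl
  obtain ⟨w⟩ := T.connected.preconnected d.fst d'.fst
  have key : ∀ (u v : V) (w : G.Walk u v) (d d' : G.Dart), d.fst = u → d'.fst = v →
      c d = c d' := by
    intro u v w
    induction w with
    | nil => intro d d' h h'; exact hv d d' (h.trans h'.symm)
    | cons hadj p ih =>
      intro d d' h h'
      rw [hv d ⟨(_, _), hadj⟩ h, ← h₂]
      exact ih _ d' rfl h'
  exact key _ _ w d d' rfl rfl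

theorem face_apply_eq {Y : Type*} {c : T.Face → Y} (h : ∀ d, c (T.face d.symm) = c (T.face d))
    (f f' : T.Face) : c f = c f' := by
  obtain ⟨d, rfl⟩ := T.face_surjective f
  obtain ⟨d', rfl⟩ := T.face_surjective f'
  exact T.apply_eq_of_facePerm_of_symm (c := fun d => c (T.face d))
    (fun d => by rw [T.face_facePerm]) h d d'

theorem sum_face_mul_sub [Fintype G.Dart] {K : Type*} [CommRing K] (c : T.Face → K) (h : V → K) :
    ∑ d : G.Dart, c (T.face d) * (h d.snd - h d.fst) = 0 := by
  have : ∑ d : G.Dart, c (T.face d) * h d.fst = ∑ d : G.Dart, c (T.face d) * h d.snd := by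
    rw [← Equiv.sum_comp T.facePerm]
    simp only [T.face_facePerm, T.facePerm_fst]
  simp only [mul_sub, Finset.sum_sub_distrib, this, sub_self]

theorem sum_dart_symm [Fintype G.Dart] {K : Type*} [AddCommMonoid K] (g : G.Dart → K) :
    ∑ d : G.Dart, g d.symm = ∑ d : G.Dart, g d :=
  Equiv.sum_comp (SimpleGraph.Dart.symm_involutive (G := G)).toPerm g

/-- Boundaries of faces are closed walks, along which a gradient sums to zero. -/
theorem sum_boundary_mul_sub [Fintype G.Dart] {K : Type*} [CommRing K] (c : T.Face → K)
    (h : V → K) :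
    ∑ d : G.Dart, (c (T.face d) - c (T.face d.symm)) * (h d.snd - h d.fst) = 0 := by
  have h2 := T.sum_face_mul_sub c h
  have h3 : ∑ d : G.Dart, c (T.face d.symm) * (h d.snd - h d.fst) =
      -∑ d : G.Dart, c (T.face d) * (h d.snd - h d.fst) := by
    rw [← sum_dart_symm, ← Finset.sum_neg_distrib]
    refine Finset.sum_congr rfl fun d _ => ?_
    rw [SimpleGraph.Dart.symm_symm]
    simp only [SimpleGraph.Dart.symm, Prod.fst_swap, Prod.snd_swap]
    ring
  simp only [sub_mul, Finset.sum_sub_distrib, h3, h2, neg_zero, sub_zero]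

theorem sum_mul_sub_of_div_eq_zero [Fintype V] [Fintype G.Dart] [DecidableEq V] {K : Type*}
    [CommRing K] {z : G.Dart → K} (hz : ∀ d, z d.symm = -z d)
    (hdiv : ∀ v, ∑ d : G.Dart with d.fst = v, z d = 0) (h : V → K) :
    ∑ d : G.Dart, z d * (h d.snd - h d.fst) = 0 := by
  have h1 : ∑ d : G.Dart, z d * h d.fst = 0 := by
    rw [← Finset.sum_fiberwise (s := Finset.univ) (g := fun d : G.Dart => d.fst)]
    refine Finset.sum_eq_zero fun v _ => ?_
    rw [Finset.sum_congr rfl (g := fun d => z d * h v), ← Finset.sum_mul, hdiv, zero_mul]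
    intro d hd
    rw [(Finset.mem_filter.mp hd).2]
  have h2 : ∑ d : G.Dart, z d * h d.snd = -∑ d : G.Dart, z d * h d.fst := by
    rw [← sum_dart_symm, ← Finset.sum_neg_distrib]
    refine Finset.sum_congr rfl fun d _ => ?_
    rw [hz]
    simp only [SimpleGraph.Dart.symm, Prod.snd_swap]
    ring
  simp only [mul_sub, Finset.sum_sub_distrib, h1, h2, neg_zero, sub_zero]

/-- The sphere has no first homology: a circulation is the boundary of a combination of faces. -/
theorem exists_eq_boundary [Fintype V] [Fintype G.Dart] [DecidableEq V] {z : G.Dart → ℚ}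
    (hz : ∀ d, z d.symm = -z d) (hdiv : ∀ v, ∑ d : G.Dart with d.fst = v, z d = 0) :
    ∃ c : T.Face → ℚ, ∀ d, z d = c (T.face d) - c (T.face d.symm) := by
  classical
  have : Fintype T.Face := Fintype.ofFinite _
  have : Fintype G.edgeSet := Fintype.ofFinite _
  let S : Submodule ℚ (G.Dart → ℚ) :=
    { carrier := {z | ∀ d, z d.symm = -z d}
      add_mem' := fun {a b} ha hb d => by
        simp only [Set.mem_ofPred_eq] at ha hb
        simp only [Pi.add_apply, ha, hb]; ring
      zero_mem' := fun d => by simp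
      smul_mem' := fun r a ha d => by
        simp only [Set.mem_ofPred_eq] at ha
        simp [ha] }
  -- Boundary plus gradient. The two parts are orthogonal, so the kernel consists of pairs of
  -- constants and has dimension at most 2. By Euler's formula the rank is then the number of edges,
  -- so every antisymmetric function is a boundary plus a gradient.
  let Ψ : ((T.Face → ℚ) × (V → ℚ)) →ₗ[ℚ] (G.Dart → ℚ) :=
    { toFun := fun p d => (p.1 (T.face d) - p.1 (T.face d.symm)) + (p.2 d.snd - p.2 d.fst)
      map_add' := fun p q => by
        funext d; simp only [Prod.fst_add, Prod.snd_add, Pi.add_apply]; ring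
      map_smul' := fun r p => by
        funext d
        simp only [Prod.smul_fst, Prod.smul_snd, Pi.smul_apply, smul_eq_mul, RingHom.id_apply]
        ring }
  have hΨS : LinearMap.range Ψ ≤ S := by
    rintro _ ⟨p, rfl⟩ d
    simp only [Ψ, LinearMap.coe_mk, AddHom.coe_mk, SimpleGraph.Dart.symm_symm]
    simp only [SimpleGraph.Dart.symm, Prod.fst_swap, Prod.snd_swap]
    ring
  have hS : Module.finrank ℚ S ≤ Nat.card G.edgeSet := by
    have hsurj : ∀ e : G.edgeSet, ∃ d : G.Dart, d.edge = e := by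
      rintro ⟨e, he⟩
      induction e with
      | h u v => exact ⟨⟨(u, v), he⟩, rfl⟩
    choose r hr using hsurj
    let Θ : S →ₗ[ℚ] (G.edgeSet → ℚ) :=
      { toFun := fun z e => z.1 (r e)
        map_add' := fun _ _ => rfl
        map_smul' := fun _ _ => rfl }
    have hΘ : Function.Injective Θ := by
      rw [← LinearMap.ker_eq_bot, LinearMap.ker_eq_bot']
      intro z hz0
      ext d
      have h0 : z.1 (r ⟨d.edge, d.edge_mem⟩) = 0 := congrFun hz0 _
      have h1 := hr ⟨d.edge, d.edge_mem⟩
      rcases SimpleGraph.dart_edge_eq_iff _ _ |>.mp h1 with h | h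
      · rw [h] at h0; simpa using h0
      · rw [h, z.2] at h0; simpa using h0
    have := LinearMap.finrank_le_finrank_of_injective hΘ
    simpa [Nat.card_eq_fintype_card] using this
  have hker : ∀ p, Ψ p = 0 → (∀ f f', p.1 f = p.1 f') ∧ (∀ v v', p.2 v = p.2 v') := by
    intro p hp
    have hp' : ∀ d : G.Dart, p.1 (T.face d) - p.1 (T.face d.symm) = -(p.2 d.snd - p.2 d.fst) :=
      fun d => eq_neg_of_add_eq_zero_left (congrFun hp d)
    have h0 : ∑ d : G.Dart, (p.2 d.snd - p.2 d.fst) * (p.2 d.snd - p.2 d.fst) = 0 := by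
      have := T.sum_boundary_mul_sub p.1 p.2
      simp only [hp', neg_mul, Finset.sum_neg_distrib, neg_eq_zero] at this
      exact this
    have h1 : ∀ d : G.Dart, p.2 d.snd - p.2 d.fst = 0 := by
      intro d
      have := (Finset.sum_eq_zero_iff_of_nonneg (fun d _ => mul_self_nonneg _)).mp h0 d
        (Finset.mem_univ d)
      exact mul_self_eq_zero.mp this
    refine ⟨T.face_apply_eq fun d => ?_, fun v v' => ?_⟩
    · have := hp' d
      rw [h1] at this; linarith
    · obtain ⟨w⟩ := T.connected.preconnected v v'
      induction w with
      | nil => rfl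
      | cons hadj p ih =>
        rw [← ih]
        have := h1 ⟨(_, _), hadj⟩
        simp only at this
        linarith
  have hfk : Module.finrank ℚ (LinearMap.ker Ψ) ≤ 2 := by
    obtain ⟨f₀⟩ : Nonempty T.Face := ⟨T.outer⟩
    obtain ⟨v₀⟩ : Nonempty V := T.connected.nonempty
    let Λ : LinearMap.ker Ψ →ₗ[ℚ] (ℚ × ℚ) :=
      { toFun := fun p => (p.1.1 f₀, p.1.2 v₀)
        map_add' := fun _ _ => rfl
        map_smul' := fun _ _ => rfl }
    have hΛ : Function.Injective Λ := by
      rw [← LinearMap.ker_eq_bot, LinearMap.ker_eq_bot']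
      rintro ⟨⟨c, h⟩, hp⟩ h0
      have hk := hker _ hp
      have h1 : c f₀ = 0 := congrArg Prod.fst h0
      have h2 : h v₀ = 0 := congrArg Prod.snd h0
      ext x
      · exact (hk.1 x f₀).trans h1
      · exact (hk.2 x v₀).trans h2
    have := LinearMap.finrank_le_finrank_of_injective hΛ
    simpa using this
  have hrn := LinearMap.finrank_range_add_finrank_ker Ψ
  rw [Module.finrank_prod, Module.finrank_pi, Module.finrank_pi, ← Nat.card_eq_fintype_card,
    ← Nat.card_eq_fintype_card] at hrn
  have heuler := T.euler
  have hrange : LinearMap.range Ψ = S :=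
    Submodule.eq_of_le_of_finrank_le hΨS (by
      change _ = _ + _ at heuler
      omega)
  have hzS : z ∈ S := hz
  rw [← hrange] at hzS
  obtain ⟨⟨c, h⟩, hp⟩ := hzS
  have hp' : ∀ d : G.Dart, z d = (c (T.face d) - c (T.face d.symm)) + (h d.snd - h d.fst) :=
    fun d => (congrFun hp d).symm
  -- The circulation and the boundary are both orthogonal to gradients, hence so is their
  -- difference, itself a gradient; a sum of rational squares vanishes.
  have h0 : ∑ d : G.Dart, (h d.snd - h d.fst) * (h d.snd - h d.fst) = 0 := by
    have e1 := T.sum_boundary_mul_sub c h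
    have e2 := sum_mul_sub_of_div_eq_zero hz hdiv h
    simp only [hp', add_mul, Finset.sum_add_distrib] at e2
    linarith
  refine ⟨c, fun d => ?_⟩
  have := (Finset.sum_eq_zero_iff_of_nonneg (fun d _ => mul_self_nonneg _)).mp h0 d
    (Finset.mem_univ d)
  rw [hp', mul_self_eq_zero.mp this, add_zero]

end PlaneGraph

/-! ### Regions of a subgraph and an edge count that forces triangles. -/

namespace PlaneGraph

variable {V : Type*} {G : SimpleGraph V}

theorem sum_boundary_fst (T : PlaneGraph G) [Fintype G.Dart] [DecidableEq V] {K : Type*} [AddCommGroup K]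
    (c : T.Face → K) (v : V) :
    ∑ d : G.Dart with d.fst = v, (c (T.face d) - c (T.face d.symm)) = 0 := by
  rw [Finset.sum_sub_distrib, sub_eq_zero]
  refine Finset.sum_equiv T.rot (fun d => ?_) (fun d _ => ?_)
  · simp [T.rot_fst]
  · rw [T.face_rot_symm]

/-- The number of regions into which the edges of `D` divide the sphere is at least
`#D - #U + 2`. -/
theorem card_le_card_quotient (T : PlaneGraph G) [Fintype V] [Fintype G.Dart] [DecidableEq V] [DecidableEq G.Dart]
    {D : Finset G.Dart} (hD : ∀ d ∈ D, d.symm ∉ D) {U : Finset V} (hUne : U.Nonempty)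
    (hU : ∀ d ∈ D, d.fst ∈ U ∧ d.snd ∈ U) (s : Setoid T.Face) [Fintype (Quotient s)]
    (hs : ∀ c : T.Face → ℚ, (∀ d, d ∉ D → d.symm ∉ D → c (T.face d) = c (T.face d.symm)) →
      ∀ f g, s f g → c f = c g) :
    D.card + 2 ≤ Fintype.card (Quotient s) + U.card := by
  classical
  obtain ⟨u₀, hu₀⟩ := hUne
  let ext : ({d // d ∈ D} → ℚ) → G.Dart → ℚ := fun g d =>
    (if h : d ∈ D then g ⟨d, h⟩ else 0) - (if h : d.symm ∈ D then g ⟨d.symm, h⟩ else 0)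
  have ext_add : ∀ g h d, ext (g + h) d = ext g d + ext h d := by
    intro g h d
    simp only [ext]
    split_ifs <;> (try simp only [Pi.add_apply]) <;> ring
  have ext_smul : ∀ (r : ℚ) g d, ext (r • g) d = r * ext g d := by
    intro r g d
    simp only [ext]
    split_ifs <;> (try simp only [Pi.smul_apply, smul_eq_mul]) <;> ring
  have ext_symm : ∀ g d, ext g d.symm = -ext g d := by
    intro g d
    simp only [ext, SimpleGraph.Dart.symm_symm]
    ring
  have ext_mem : ∀ g d (h : d ∈ D), ext g d = g ⟨d, h⟩ := by
    intro g d h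
    simp only [ext, dif_pos h, dif_neg (hD d h), sub_zero]
  have ext_zero : ∀ g d, d ∉ D → d.symm ∉ D → ext g d = 0 := by
    intro g d h h'
    simp only [ext, dif_neg h, dif_neg h', sub_zero]
  -- The divergence at `u₀` is left out: the total divergence of an antisymmetric function is zero.
  -- This gains one dimension for the kernel.
  let δ : ({d // d ∈ D} → ℚ) →ₗ[ℚ] ({u // u ∈ U.erase u₀} → ℚ) :=
    { toFun := fun g u => ∑ d : G.Dart with d.fst = u.1, ext g d
      map_add' := fun g h => by
        funext u; simp only [ext_add, Finset.sum_add_distrib, Pi.add_apply]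
      map_smul' := fun r g => by
        funext u
        simp only [ext_smul, ← Finset.mul_sum, Pi.smul_apply, smul_eq_mul, RingHom.id_apply] }
  let Φ : (Quotient s → ℚ) →ₗ[ℚ] ({d // d ∈ D} → ℚ) :=
    { toFun := fun c d => c ⟦T.face d.1⟧ - c ⟦T.face d.1.symm⟧
      map_add' := fun g h => by funext u; simp only [Pi.add_apply]; ring
      map_smul' := fun r g => by
        funext u; simp only [Pi.smul_apply, smul_eq_mul, RingHom.id_apply]; ring }
  -- A circulation supported on `D` is the boundary of a face function that does not change across
  -- the other edges, so it descends to the regions. Constants lie in the kernel of `Φ`, which gives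
  -- the second unit of the bound.
  have hle : LinearMap.ker δ ≤ LinearMap.range Φ := by
    intro g hg
    have hg1 : ∀ u ∈ U, u ≠ u₀ → ∑ d : G.Dart with d.fst = u, ext g d = 0 := fun u hu hne =>
      congrFun (LinearMap.mem_ker.mp hg) ⟨u, Finset.mem_erase.mpr ⟨hne, hu⟩⟩
    have hg2 : ∀ u, u ∉ U → ∑ d : G.Dart with d.fst = u, ext g d = 0 := by
      intro u hu
      refine Finset.sum_eq_zero fun d hd => ext_zero g d (fun h => hu ?_) (fun h => hu ?_)
      · rw [← (Finset.mem_filter.mp hd).2]; exact (hU d h).1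
      · rw [← (Finset.mem_filter.mp hd).2]; exact (hU _ h).2
    have hg3 : ∀ u, u ≠ u₀ → ∑ d : G.Dart with d.fst = u, ext g d = 0 := fun u hne => by
      by_cases h : u ∈ U
      · exact hg1 u h hne
      · exact hg2 u h
    have htot : ∑ d : G.Dart, ext g d = 0 := by
      have := sum_dart_symm (ext g)
      simp only [ext_symm, Finset.sum_neg_distrib] at this
      linarith
    have hg4 : ∀ u, ∑ d : G.Dart with d.fst = u, ext g d = 0 := by
      intro u
      by_cases hne : u = u₀
      · subst hne
        rw [← Finset.sum_fiberwise (s := Finset.univ) (g := fun d : G.Dart => d.fst),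
          Finset.sum_eq_single u (fun v _ hv => hg3 v hv) (by simp)] at htot
        exact htot
      · exact hg3 u hne
    obtain ⟨c, hc⟩ := T.exists_eq_boundary (ext_symm g) hg4
    have hcs := hs c fun d h h' => by
      have := hc d
      rw [ext_zero g d h h'] at this
      linarith
    refine ⟨Quotient.lift c hcs, funext fun d => ?_⟩
    change c (T.face d.1) - c (T.face d.1.symm) = g d
    rw [← hc, ext_mem g d.1 d.2]
  have h1 := LinearMap.finrank_range_add_finrank_ker Φ
  have h2 := LinearMap.finrank_range_add_finrank_ker δ
  have h3 := Submodule.finrank_mono hle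
  have h4 : Module.finrank ℚ (LinearMap.range δ) ≤ U.card - 1 := by
    refine (Submodule.finrank_le _).trans ?_
    rw [Module.finrank_pi, Fintype.card_coe, Finset.card_erase_of_mem hu₀]
  have h5 : 1 ≤ Module.finrank ℚ (LinearMap.ker Φ) := by
    have h0 : (fun _ => 1 : Quotient s → ℚ) ∈ LinearMap.ker Φ := by
      rw [LinearMap.mem_ker]
      funext d
      exact sub_self _
    have hne : (⟨_, h0⟩ : LinearMap.ker Φ) ≠ 0 := by
      intro h
      have := congrFun (congrArg Subtype.val h) ⟦T.outer⟧
      simp at this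
    exact Module.finrank_pos_iff_exists_ne_zero.mpr ⟨_, hne⟩
  rw [Module.finrank_pi] at h1 h2
  rw [Fintype.card_coe] at h2
  have := Finset.card_pos.mpr ⟨u₀, hu₀⟩
  omega

/-- In a plane graph with one edge less than a triangulation on the vertex set `U`, each edge lies
in a triangle. -/
theorem exists_triangle_of_card_le (T : PlaneGraph G) [Fintype V] [Fintype G.Dart] [DecidableEq V]
    [DecidableEq G.Dart] {D : Finset G.Dart} (hD : ∀ d ∈ D, d.symm ∉ D) {U : Finset V}
    (hU : ∀ d ∈ D, d.fst ∈ U ∧ d.snd ∈ U) (hU4 : 4 ≤ U.card) (hcard : 3 * U.card ≤ D.card + 7)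
    {e : G.Dart} (he : e ∈ D) :
    ∃ d₁ d₂ : G.Dart, (d₁ ∈ D ∨ d₁.symm ∈ D) ∧ (d₂ ∈ D ∨ d₂.symm ∈ D) ∧
      d₁.fst = e.snd ∧ d₁.snd = d₂.fst ∧ d₂.snd = e.fst := by
  classical
  let r : T.Face → T.Face → Prop := fun f g =>
    ∃ d, d ∉ D ∧ d.symm ∉ D ∧ f = T.face d ∧ g = T.face d.symm
  let s : Setoid T.Face := Relation.EqvGen.setoid r
  have : Fintype (Quotient s) := Fintype.ofFinite _
  let q : G.Dart → Quotient s := fun d => ⟦T.face d⟧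
  have hq : ∀ d, d ∉ D → d.symm ∉ D → q d = q d.symm := fun d h h' =>
    Quotient.sound (Relation.EqvGen.rel _ _ ⟨d, h, h', rfl, rfl⟩)
  have hQ : D.card + 2 ≤ Fintype.card (Quotient s) + U.card := by
    refine T.card_le_card_quotient hD (Finset.card_pos.mp (by omega)) hU s ?_
    intro c hc f g hfg
    induction hfg with
    | rel f g h =>
      obtain ⟨d, h, h', rfl, rfl⟩ := h
      exact hc d h h'
    | refl => rfl
    | symm _ _ _ ih => exact ih.symm
    | trans _ _ _ _ _ ih ih' => exact ih.trans ih'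
  let E : Finset G.Dart := Finset.univ.filter fun d => d ∈ D ∨ d.symm ∈ D
  have hE : E.card = 2 * D.card := by
    have hEq : E = D ∪ D.map (SimpleGraph.Dart.symm_involutive (G := G)).toPerm.toEmbedding := by
      ext d
      simp only [E, Finset.mem_filter, Finset.mem_univ, true_and, Finset.mem_union,
        Finset.mem_map, Equiv.coe_toEmbedding, Function.Involutive.coe_toPerm]
      refine or_congr_right ⟨fun h => ⟨_, h, SimpleGraph.Dart.symm_symm d⟩, ?_⟩
      rintro ⟨d', h, rfl⟩
      rwa [SimpleGraph.Dart.symm_symm]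
    rw [hEq, Finset.card_union_of_disjoint, Finset.card_map, two_mul]
    rw [Finset.disjoint_left]
    intro d hd hd'
    obtain ⟨d', h, rfl⟩ := Finset.mem_map.mp hd'
    exact hD _ h hd
  let B : Quotient s → Finset G.Dart := fun R =>
    Finset.univ.filter fun d => q d = R ∧ q d.symm ≠ R
  have hBE : ∀ R, ∀ d ∈ B R, d ∈ E := by
    intro R d hd
    obtain ⟨h1, h2⟩ := (Finset.mem_filter.mp hd).2
    refine Finset.mem_filter.mpr ⟨Finset.mem_univ _, ?_⟩
    by_contra! hcon
    exact h2 (by rw [← hq d hcon.1 hcon.2, h1])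
  have hBsymm : ∀ R, ∀ d ∈ B R, d.symm ∉ B R := by
    intro R d hd hd'
    exact (Finset.mem_filter.mp hd).2.2 (Finset.mem_filter.mp hd').2.1
  let B' : Quotient s → Finset G.Dart := fun R => (B R).filter fun d => d ≠ e ∧ d ≠ e.symm
  -- If every region had three boundary darts besides those of `e`, then `3 (#D - #U + 2) ≤ 2 #D -
  -- 2`, against `hcard`.
  obtain ⟨R, hR⟩ : ∃ R, (B' R).card ≤ 2 := by
    by_contra! hcon
    have h1 : ∑ R, (B' R).card ≤ (E \ {e, e.symm}).card := by
      rw [← Finset.card_biUnion]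
      · refine Finset.card_le_card fun d hd => ?_
        obtain ⟨R, -, hd⟩ := Finset.mem_biUnion.mp hd
        obtain ⟨hd, hd'⟩ := Finset.mem_filter.mp hd
        simp only [Finset.mem_sdiff, Finset.mem_insert, Finset.mem_singleton, not_or]
        exact ⟨hBE R d hd, hd'⟩
      · intro R _ R' _ hne
        rw [Function.onFun, Finset.disjoint_left]
        intro d hd hd'
        have h := (Finset.mem_filter.mp (Finset.mem_filter.mp hd).1).2.1
        have h' := (Finset.mem_filter.mp (Finset.mem_filter.mp hd').1).2.1
        exact hne (h.symm.trans h')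
    have h2 : ∑ _R : Quotient s, 3 ≤ ∑ R, (B' R).card := Finset.sum_le_sum fun R _ => hcon R
    have h3 : ({e, e.symm} : Finset G.Dart) ⊆ E := by
      intro d hd
      rcases Finset.mem_insert.mp hd with rfl | hd
      · simp [E, he]
      · rw [Finset.mem_singleton.mp hd]; simp [E, he]
    rw [Finset.card_sdiff_of_subset h3, Finset.card_pair (SimpleGraph.Dart.symm_ne e).symm, hE]
      at h1
    simp only [Finset.sum_const, Finset.card_univ, smul_eq_mul] at h2
    omega
  -- The boundary of a region is a circulation, so a vertex that is entered is also left.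
  have hnext : ∀ d ∈ B R, ∃ d' ∈ B R, d'.fst = d.snd := by
    intro d hd
    by_contra! hcon
    have hsum := T.sum_boundary_fst (fun f => if (⟦f⟧ : Quotient s) = R then (1 : ℤ) else 0) d.snd
    refine absurd hsum (ne_of_lt ?_)
    have hle : ∀ d' ∈ Finset.univ.filter (fun d' : G.Dart => d'.fst = d.snd),
        ((if q d' = R then (1 : ℤ) else 0) - (if q d'.symm = R then (1 : ℤ) else 0)) ≤ 0 := by
      intro d' hd'
      have h := hcon d'
      have h'' := (Finset.mem_filter.mp hd').2
      by_cases h1 : q d' = R <;> by_cases h2 : q d'.symm = R <;> simp only [h1, h2, if_true,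
        if_false] <;> norm_num
      exact h (Finset.mem_filter.mpr ⟨Finset.mem_univ _, h1, h2⟩) h''
    refine Finset.sum_neg' hle ⟨d.symm, by simp [SimpleGraph.Dart.symm], ?_⟩
    obtain ⟨h1, h2⟩ := (Finset.mem_filter.mp hd).2
    have h1' : (⟦T.face d⟧ : Quotient s) = R := h1
    have h2' : (⟦T.face d.symm⟧ : Quotient s) ≠ R := h2
    simp [SimpleGraph.Dart.symm_symm, h1', h2']
  obtain ⟨d₀, hd₀⟩ : (B R).Nonempty := by
    rw [Finset.nonempty_iff_ne_empty]
    intro hempty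
    have hiff : ∀ d, q d = R → q d.symm = R := by
      intro d h
      by_contra h'
      have : d ∈ B R := Finset.mem_filter.mpr ⟨Finset.mem_univ _, h, h'⟩
      rw [hempty] at this
      simp at this
    have hconst := T.face_apply_eq (c := fun f => (⟦f⟧ : Quotient s) = R) fun d =>
      propext ⟨fun h => by have := hiff d.symm h; rwa [SimpleGraph.Dart.symm_symm] at this, hiff d⟩
    have hsub : Fintype.card (Quotient s) ≤ 1 := by
      refine Fintype.card_le_one_iff.mpr fun a b => ?_
      obtain ⟨f, rfl⟩ := Quotient.exists_rep R
      obtain ⟨a, rfl⟩ := Quotient.exists_rep a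
      obtain ⟨b, rfl⟩ := Quotient.exists_rep b
      exact ((hconst a f).mpr rfl).trans ((hconst b f).mpr rfl).symm
    omega
  obtain ⟨d₁, hd₁, h01⟩ := hnext d₀ hd₀
  obtain ⟨d₂, hd₂, h12⟩ := hnext d₁ hd₁
  obtain ⟨d₃, hd₃, h23⟩ := hnext d₂ hd₂
  have hback : ∀ a b : G.Dart, a ∈ B R → b ∈ B R → b.fst = a.snd → b.snd ≠ a.fst := by
    intro a b ha hb h h'
    refine hBsymm R a ha ?_
    have : b = a.symm := SimpleGraph.Dart.ext _ _ (Prod.ext h h')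
    rwa [← this]
  have hb01 := hback d₀ d₁ hd₀ hd₁ h01
  have hb12 := hback d₁ d₂ hd₁ hd₂ h12
  have hn : ∀ d : G.Dart, d.fst ≠ d.snd := fun d => d.fst_ne_snd
  have h3 : ({d₀, d₁, d₂} : Finset G.Dart).card = 3 := by
    refine Finset.card_eq_three.mpr ⟨d₀, d₁, d₂, ?_, ?_, ?_, rfl⟩
    · rintro rfl; exact hn _ h01
    · rintro rfl; exact hb01 h12.symm
    · rintro rfl; exact hn _ h12
  have hsub : ({d₀, d₁, d₂} : Finset G.Dart) ⊆ B R := by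
    intro d hd
    simp only [Finset.mem_insert, Finset.mem_singleton] at hd
    rcases hd with rfl | rfl | rfl <;> assumption
  -- Of `e` and `e.symm` at most one borders `R` from inside. A path of three darts without
  -- backtracking therefore exhausts `B R` and closes up.
  have hBcard : (B R).card ≤ 3 := by
    have h := Finset.card_filter_add_card_filter_not (s := B R) (fun d => d ≠ e ∧ d ≠ e.symm)
    have h' : ((B R).filter fun d => ¬(d ≠ e ∧ d ≠ e.symm)).card ≤ 1 := by
      refine Finset.card_le_one.mpr fun a ha b hb => ?_
      obtain ⟨ha, ha'⟩ := Finset.mem_filter.mp ha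
      obtain ⟨hb, hb'⟩ := Finset.mem_filter.mp hb
      have hne := hBsymm R a ha
      by_contra hab
      have : b = a.symm := by
        have h1 : a = e ∨ a = e.symm := by tauto
        have h2 : b = e ∨ b = e.symm := by tauto
        rcases h1 with rfl | rfl <;> rcases h2 with rfl | rfl <;> simp_all
      rw [this] at hb
      exact hne hb
    change _ ≤ 2 at hR
    simp only [B'] at hR
    omega
  have hBeq : ({d₀, d₁, d₂} : Finset G.Dart) = B R :=
    Finset.eq_of_subset_of_card_le hsub (by omega)
  have hclose : d₂.snd = d₀.fst := by
    rw [← hBeq] at hd₃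
    simp only [Finset.mem_insert, Finset.mem_singleton] at hd₃
    rcases hd₃ with rfl | rfl | rfl
    · exact h23.symm
    · exact absurd h23.symm hb12
    · exact absurd h23 (hn _)
  have hmem : ∃ d ∈ B R, d = e ∨ d = e.symm := by
    by_contra! hcon
    have : B' R = B R := Finset.filter_true_of_mem hcon
    rw [this, ← hBeq, h3] at hR
    omega
  have key : ∀ a b c : G.Dart, a ∈ B R → b ∈ B R → c ∈ B R → b.fst = a.snd → c.fst = b.snd →
      c.snd = a.fst → a = e ∨ a = e.symm → ∃ d₁ d₂ : G.Dart, (d₁ ∈ D ∨ d₁.symm ∈ D) ∧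
      (d₂ ∈ D ∨ d₂.symm ∈ D) ∧ d₁.fst = e.snd ∧ d₁.snd = d₂.fst ∧ d₂.snd = e.fst := by
    intro a b c _ hb hc hab hbc hca h
    have hb' := (Finset.mem_filter.mp (hBE R b hb)).2
    have hc' := (Finset.mem_filter.mp (hBE R c hc)).2
    rcases h with rfl | rfl
    · exact ⟨b, c, hb', hc', hab, hbc.symm, hca⟩
    · refine ⟨c.symm, b.symm, ?_, ?_, hca, hbc, hab⟩
      · rw [SimpleGraph.Dart.symm_symm]; exact hc'.symm
      · rw [SimpleGraph.Dart.symm_symm]; exact hb'.symm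
  obtain ⟨d, hd, hde⟩ := hmem
  rw [← hBeq] at hd
  simp only [Finset.mem_insert, Finset.mem_singleton] at hd
  rcases hd with rfl | rfl | rfl
  · exact key _ _ _ hd₀ hd₁ hd₂ h01 h12 hclose hde
  · exact key _ _ _ hd₁ hd₂ hd₀ h12 hclose.symm h01.symm hde
  · exact key _ _ _ hd₂ hd₀ hd₁ hclose.symm h01 h12.symm hde

end PlaneGraph

/-! ### The predecessors of a vertex in a `P`-order. -/

namespace POrder

variable {V : Type*} {G : SimpleGraph V} (P : POrder G)

/-- Adjacency along an edge that is oriented by the `P`-order. -/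
def OrientedAdj (u w : V) : Prop := w ∈ P.pred u ∨ u ∈ P.pred w

variable {P}

theorem OrientedAdj.symm {u w : V} (h : P.OrientedAdj u w) : P.OrientedAdj w u := Or.symm h

theorem OrientedAdj.adj {u w : V} (h : P.OrientedAdj u w) : G.Adj u w :=
  h.elim (P.pred_adj u w) fun h => (P.pred_adj w u h).symm

theorem Unoriented.not_orientedAdj {e : G.Dart} (h : P.Unoriented e) :
    ¬P.OrientedAdj e.fst e.snd := fun h' => h'.elim h.1 h.2

variable (P)

theorem card_add_ncard_pred_le [Finite V] (i : ℕ) (hi : i + 1 < P.m + 4) :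
    {d : G.Dart | d.snd ∈ P.pred d.fst ∧ (P.v.symm d.fst : ℕ) ≤ i}.ncard +
      (P.pred (P.v ⟨i + 1, hi⟩)).ncard ≤
      {d : G.Dart | d.snd ∈ P.pred d.fst ∧ (P.v.symm d.fst : ℕ) ≤ i + 1}.ncard := by
  have h1 : (P.pred (P.v ⟨i + 1, hi⟩)).ncard ≤
      {d : G.Dart | d.snd ∈ P.pred d.fst ∧ d.fst = P.v ⟨i + 1, hi⟩}.ncard := by
    refine le_trans (Set.ncard_le_ncard ?_ (Set.toFinite _))
      (Set.ncard_image_le (f := fun d : G.Dart => d.snd) (Set.toFinite _))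
    intro w hw
    exact ⟨⟨(_, w), P.pred_adj _ _ hw⟩, ⟨hw, rfl⟩, rfl⟩
  refine le_trans (Nat.add_le_add_left h1 _) ?_
  rw [← Set.ncard_union_eq _ (Set.toFinite _) (Set.toFinite _)]
  · refine Set.ncard_le_ncard ?_ (Set.toFinite _)
    rintro d (⟨h, h'⟩ | ⟨h, h'⟩)
    · exact ⟨h, by omega⟩
    · refine ⟨h, ?_⟩
      rw [h']; simp
  · rw [Set.disjoint_left]
    rintro d ⟨-, h⟩ ⟨-, h'⟩
    rw [h'] at h
    simp at h

/-- The first four vertices carry `1 + 2 + 2 = 5` oriented edges and each further vertex adds three.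
This is one edge short of the `3k - 6` of a triangulation on `k = i + 1` vertices. -/
theorem three_mul_le_ncard [Finite V] (i : ℕ) (hi : 3 ≤ i) (him : i < P.m + 4) :
    3 * (i + 1) ≤
      {d : G.Dart | d.snd ∈ P.pred d.fst ∧ (P.v.symm d.fst : ℕ) ≤ i}.ncard + 7 := by
  induction i, hi using Nat.le_induction with
  | base =>
    have h0 := P.card_add_ncard_pred_le 0 (by omega)
    have h1 := P.card_add_ncard_pred_le 1 (by omega)
    have h2 := P.card_add_ncard_pred_le 2 (by omega)
    have hne : P.v 0 ≠ P.v 1 := by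
      intro h
      have := congrArg Fin.val (P.v.injective h)
      simp at this
    rw [show (⟨0 + 1, by omega⟩ : Fin (P.m + 4)) = 1 from rfl, P.pred_two,
      Set.ncard_singleton] at h0
    rw [show (⟨1 + 1, by omega⟩ : Fin (P.m + 4)) = 2 from rfl, P.pred_three,
      Set.ncard_pair hne] at h1
    rw [show (⟨2 + 1, by omega⟩ : Fin (P.m + 4)) = 3 from rfl, P.pred_four,
      Set.ncard_pair hne] at h2
    simp only [Nat.zero_add, Nat.reduceAdd] at h0 h1 h2
    omega
  | succ i hi ih =>
    have h := P.card_add_ncard_pred_le i him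
    have h3 := P.pred_card ⟨i + 1, him⟩ (by
      rw [Fin.lt_def]
      change 3 % (P.m + 4) < i + 1
      rw [Nat.mod_eq_of_lt (by omega)]
      omega)
    have := ih (by omega)
    omega

variable {P}

/-- The edge from `v i` to `u` lies in a triangle of oriented edges among the vertices up to `v i`.
Since `v i` is the last of them, the third corner is also one of its predecessors. -/
theorem exists_orientedAdj_of_mem_pred [Finite V] (T : PlaneGraph G) {i : Fin (P.m + 4)}
    (hi : 3 < i) {u : V} (hu : u ∈ P.pred (P.v i)) :
    ∃ w ∈ P.pred (P.v i), P.OrientedAdj u w := by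
  classical
  have : Fintype V := Fintype.ofFinite V
  have : Fintype G.Dart := Fintype.ofFinite _
  have hi3 : 3 < (i : ℕ) := by
    have h : 3 % (P.m + 4) < (i : ℕ) := Fin.lt_def.mp hi
    rwa [Nat.mod_eq_of_lt (by omega)] at h
  let D : Finset G.Dart := Finset.univ.filter fun d =>
    d.snd ∈ P.pred d.fst ∧ (P.v.symm d.fst : ℕ) ≤ i
  let U : Finset V := Finset.univ.filter fun u => P.v.symm u ≤ i
  have hUcard : U.card = i + 1 := by
    have : U = (Finset.Iic i).map P.v.toEmbedding := by
      ext u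
      simp [U]
    rw [this, Finset.card_map, Fin.card_Iic]
  have hDcard : 3 * (i + 1 : ℕ) ≤ D.card + 7 := by
    have := P.three_mul_le_ncard i hi3.le i.2
    rwa [← Set.ncard_coe_finset D, show (D : Set G.Dart) = {d : G.Dart | d.snd ∈ P.pred d.fst ∧
      (P.v.symm d.fst : ℕ) ≤ i} by ext; simp [D]]
  have hDlt : ∀ d ∈ D, P.v.symm d.snd < P.v.symm d.fst := fun d hd =>
    P.pred_lt _ _ (Finset.mem_filter.mp hd).2.1
  obtain ⟨d₁, d₂, h1, h2, h3, h4, h5⟩ := T.exists_triangle_of_card_le (D := D) (U := U)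
    (e := ⟨(P.v i, u), P.pred_adj _ _ hu⟩)
    (fun d hd hd' => lt_asymm (hDlt d hd) (hDlt _ hd'))
    (fun d hd => by
      have hle : P.v.symm d.fst ≤ i := (Finset.mem_filter.mp hd).2.2
      exact ⟨Finset.mem_filter.mpr ⟨Finset.mem_univ _, hle⟩,
        Finset.mem_filter.mpr ⟨Finset.mem_univ _, (hDlt d hd).le.trans hle⟩⟩)
    (by omega) (by omega) (Finset.mem_filter.mpr ⟨Finset.mem_univ _, hu, by simp⟩)
  simp only at h3 h5
  have h2' : d₂.fst ∈ P.pred (P.v i) := by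
    rcases h2 with h2 | h2
    · have hlt := hDlt _ h2
      have hle := (Finset.mem_filter.mp h2).2.2
      rw [h5, P.v.symm_apply_apply] at hlt
      exact absurd hle (not_le.mpr hlt)
    · rw [← h5]
      exact (Finset.mem_filter.mp h2).2.1
  refine ⟨d₂.fst, h2', ?_⟩
  rw [← h4, ← h3]
  exact h1.imp (fun h => (Finset.mem_filter.mp h).2.1) (fun h => (Finset.mem_filter.mp h).2.1)

/-- A graph on three vertices without isolated vertex contains a path through all of them. -/
theorem exists_path_pred [Finite V] (T : PlaneGraph G) {i : Fin (P.m + 4)} (hi : 3 < i) :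
    ∃ u₁ ∈ P.pred (P.v i), ∃ u₂ ∈ P.pred (P.v i), ∃ u₃ ∈ P.pred (P.v i),
      u₁ ≠ u₃ ∧ P.OrientedAdj u₁ u₂ ∧ P.OrientedAdj u₂ u₃ := by
  have h3 := P.pred_card i hi
  obtain ⟨a, ha⟩ : (P.pred (P.v i)).Nonempty := by
    rw [Set.nonempty_iff_ne_empty]
    intro h
    rw [h] at h3
    simp at h3
  obtain ⟨x, hx, hax⟩ := exists_orientedAdj_of_mem_pred T hi ha
  obtain ⟨c, hc, hc'⟩ := Set.exists_mem_notMem_of_ncard_lt_ncard (s := {a, x})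
    (t := P.pred (P.v i)) (lt_of_le_of_lt (Set.ncard_insert_le _ _) (by simp [h3]))
    (Set.toFinite _)
  simp only [Set.mem_insert_iff, Set.mem_singleton_iff, not_or] at hc'
  obtain ⟨y, hy, hcy⟩ := exists_orientedAdj_of_mem_pred T hi hc
  have hcard : ({a, x, c} : Set V) = P.pred (P.v i) := by
    refine Set.eq_of_subset_of_ncard_le ?_ ?_ (Set.toFinite _)
    · rintro z (rfl | rfl | rfl) <;> assumption
    · rw [h3, Set.ncard_eq_three.mpr ⟨a, x, c, hax.adj.ne, Ne.symm hc'.1, Ne.symm hc'.2, rfl⟩]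
  rw [← hcard] at hy
  rcases hy with rfl | rfl | rfl
  · exact ⟨x, hx, y, ha, c, hc, Ne.symm hc'.2, hax.symm, hcy.symm⟩
  · exact ⟨a, ha, y, hx, c, hc, Ne.symm hc'.1, hax, hcy.symm⟩
  · exact absurd rfl hcy.adj.ne

end POrder

/-! ### Triangles of the graph as circulations. -/

namespace PlaneGraph

variable {V : Type*} {G : SimpleGraph V}

open Classical in
/-- The indicator function of the dart from `a` to `b`. -/
noncomputable def dartIndicator (a b : V) (d : G.Dart) : ℚ :=
  if d.fst = a ∧ d.snd = b then 1 else 0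

theorem dartIndicator_symm (a b : V) (d : G.Dart) :
    dartIndicator a b d.symm = dartIndicator b a d := by
  rw [dartIndicator, dartIndicator]
  by_cases h : d.fst = b ∧ d.snd = a
  · rw [if_pos h, if_pos (show d.symm.fst = a ∧ d.symm.snd = b from ⟨h.2, h.1⟩)]
  · rw [if_neg h, if_neg (show ¬(d.symm.fst = a ∧ d.symm.snd = b) from fun h' => h ⟨h'.2, h'.1⟩)]

theorem sum_dartIndicator_mul [Fintype G.Dart] {K : Type*} [Field K] [CharZero K] {a b : V}
    (h : G.Adj a b) (g : V → V → K) :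
    ∑ d : G.Dart, (dartIndicator a b d : K) * g d.fst d.snd = g a b := by
  rw [Finset.sum_eq_single (⟨(a, b), h⟩ : G.Dart)]
  · simp [dartIndicator]
  · intro d _ hd
    rw [dartIndicator, if_neg, Rat.cast_zero, zero_mul]
    exact fun hab => hd (SimpleGraph.Dart.ext _ _ (Prod.ext hab.1 hab.2))
  · simp

/-- The closed walk `u v w` as a function on darts. -/
noncomputable def triangleCycle (u v w : V) (d : G.Dart) : ℚ :=
  (dartIndicator u v d - dartIndicator v u d) + (dartIndicator v w d - dartIndicator w v d) +
    (dartIndicator w u d - dartIndicator u w d)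

theorem triangleCycle_symm (u v w : V) (d : G.Dart) :
    triangleCycle u v w d.symm = -triangleCycle u v w d := by
  simp only [triangleCycle, dartIndicator_symm]
  ring

theorem triangleCycle_eq_zero {u v w : V} {d : G.Dart}
    (h : ¬((d.fst = u ∨ d.fst = v ∨ d.fst = w) ∧ (d.snd = u ∨ d.snd = v ∨ d.snd = w))) :
    triangleCycle u v w d = 0 := by
  simp only [triangleCycle, dartIndicator]
  rw [if_neg, if_neg, if_neg, if_neg, if_neg, if_neg] <;> first | ring | tauto

theorem sum_triangleCycle_mul [Fintype G.Dart] {K : Type*} [Field K] [CharZero K] {u v w : V}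
    (huv : G.Adj u v) (hvw : G.Adj v w) (hwu : G.Adj w u) (g : V → V → K) :
    ∑ d : G.Dart, (triangleCycle u v w d : K) * g d.fst d.snd =
      (g u v - g v u) + (g v w - g w v) + (g w u - g u w) := by
  simp only [triangleCycle]
  push_cast
  simp only [add_mul, sub_mul, Finset.sum_add_distrib, Finset.sum_sub_distrib]
  rw [sum_dartIndicator_mul huv, sum_dartIndicator_mul hvw, sum_dartIndicator_mul hwu,
    sum_dartIndicator_mul huv.symm, sum_dartIndicator_mul hvw.symm,
    sum_dartIndicator_mul hwu.symm]

/-- The triangle may separate the graph; it still bounds, since the sphere has no first homology. -/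
theorem exists_boundary_eq_triangleCycle [Finite V] (T : PlaneGraph G) {u v w : V}
    (huv : G.Adj u v) (hvw : G.Adj v w) (hwu : G.Adj w u) :
    ∃ c : T.Face → ℚ, ∀ d, triangleCycle u v w d = c (T.face d) - c (T.face d.symm) := by
  classical
  have : Fintype V := Fintype.ofFinite V
  have : Fintype G.Dart := Fintype.ofFinite _
  refine T.exists_eq_boundary (triangleCycle_symm u v w) fun t => ?_
  have h := sum_triangleCycle_mul (K := ℚ) huv hvw hwu (fun a _ => if a = t then 1 else 0)
  rw [Finset.sum_filter]
  simp only [mul_ite, mul_one, mul_zero, Rat.cast_eq_id, id] at h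
  rw [h]
  ring

end PlaneGraph

/-! ### Triangulations and signed areas. -/

namespace PlaneGraph

variable {V : Type*} {G : SimpleGraph V}

theorem _root_.SimpleGraph.Dart.ext_fst_snd {d d' : G.Dart} (h : d.fst = d'.fst)
    (h' : d.snd = d'.snd) : d = d' :=
  SimpleGraph.Dart.ext _ _ (Prod.ext h h')

theorem card_dart [Finite V] : Nat.card G.Dart = 2 * Nat.card G.edgeSet := by
  classical
  have : Fintype V := Fintype.ofFinite V
  rw [Nat.card_eq_fintype_card, Nat.card_eq_fintype_card, G.dart_card_eq_twice_card_edges,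
    SimpleGraph.edgeFinset_card]

theorem exists_dart_fst (T : PlaneGraph G) [Nontrivial V] (v : V) : ∃ d : G.Dart, d.fst = v := by
  obtain ⟨w, hw⟩ := T.connected.preconnected.exists_adj_of_nontrivial v
  exact ⟨⟨(v, w), hw⟩, rfl⟩

/-- The third vertex of the triangle to the left of a dart. -/
def apex (T : PlaneGraph G) (d : G.Dart) : V := (T.facePerm d).snd

theorem facePerm_facePerm_fst (T : PlaneGraph G) (d : G.Dart) :
    (T.facePerm (T.facePerm d)).fst = T.apex d := T.facePerm_fst _

theorem adj_apex (T : PlaneGraph G) (d : G.Dart) : G.Adj d.snd (T.apex d) := by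
  have := (T.facePerm d).adj
  rwa [T.facePerm_fst] at this

namespace IsTriangulation

variable {T : PlaneGraph G}

theorem facePerm_facePerm_snd (hT : T.IsTriangulation) (d : G.Dart) :
    (T.facePerm (T.facePerm d)).snd = d.fst := by
  rw [← T.facePerm_fst, hT d]

theorem apex_facePerm (hT : T.IsTriangulation) (d : G.Dart) :
    T.apex (T.facePerm d) = d.fst := hT.facePerm_facePerm_snd d

theorem apex_adj (hT : T.IsTriangulation) (d : G.Dart) : G.Adj (T.apex d) d.fst := by
  have := (T.facePerm (T.facePerm d)).adj
  rwa [facePerm_facePerm_fst, hT.facePerm_facePerm_snd] at this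

theorem face_eq_iff (hT : T.IsTriangulation) {d d' : G.Dart} :
    T.face d' = T.face d ↔
      d' = d ∨ d' = T.facePerm d ∨ d' = T.facePerm (T.facePerm d) := by
  constructor
  · intro h
    have h1 := RotationSystem.face_eq_iff T.toRotationSystem |>.mp h
    have h2 := Equiv.Perm.SameCycle.apply_eq
      (g := fun x => x = d ∨ x = T.facePerm d ∨ x = T.facePerm (T.facePerm d)) (fun x => ?_) h1
    · simpa using h2
    · refine propext ?_
      have hx : T.facePerm x = d ↔ x = T.facePerm (T.facePerm d) :=
        ⟨fun h => by rw [← h, hT], fun h => by rw [h, hT]⟩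
      simp only [hx, EmbeddingLike.apply_eq_iff_eq]
      tauto
  · rintro (rfl | rfl | rfl)
    · rfl
    · exact T.face_facePerm _
    · rw [T.face_facePerm, T.face_facePerm]

theorem sum_face (hT : T.IsTriangulation) [Fintype G.Dart] [Fintype T.Face] {K : Type*}
    [CommSemiring K] (g : T.Face → K) : ∑ d : G.Dart, g (T.face d) = 3 * ∑ f, g f := by
  classical
  rw [← Finset.sum_fiberwise (s := Finset.univ) (g := T.face), Finset.mul_sum]
  refine Finset.sum_congr rfl fun f _ => ?_
  obtain ⟨d, rfl⟩ := T.face_surjective f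
  have h : Finset.univ.filter (fun d' => T.face d' = T.face d) =
      {d, T.facePerm d, T.facePerm (T.facePerm d)} := by
    ext d'
    simp [hT.face_eq_iff]
  have hne1 : ∀ d, T.facePerm d ≠ d := fun d h => by
    have := T.facePerm_fst d
    rw [h] at this
    exact d.fst_ne_snd this
  have hne2 : d ≠ T.facePerm (T.facePerm d) := fun h => by
    have h3 := hT d
    rw [← h] at h3
    exact hne1 d h3
  have hcard : ({d, T.facePerm d, T.facePerm (T.facePerm d)} : Finset G.Dart).card = 3 :=
    Finset.card_eq_three.mpr ⟨_, _, _, (hne1 d).symm, hne2, (hne1 _).symm, rfl⟩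
  rw [Finset.sum_congr rfl (g := fun _ => g (T.face d)), Finset.sum_const, h, hcard,
    nsmul_eq_mul]
  · norm_num
  · intro d' hd'
    rw [(Finset.mem_filter.mp hd').2]

theorem three_mul_card_face (hT : T.IsTriangulation) [Finite V] :
    3 * Nat.card T.Face = 2 * Nat.card G.edgeSet := by
  have : Fintype G.Dart := Fintype.ofFinite _
  have : Fintype T.Face := Fintype.ofFinite _
  have h := hT.sum_face (fun _ => 1)
  rw [← card_dart, Nat.card_eq_fintype_card, Nat.card_eq_fintype_card]
  simpa using h.symm

theorem card_face (hT : T.IsTriangulation) [Finite V] :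
    Nat.card T.Face + 4 = 2 * Nat.card V := by
  have h := hT.three_mul_card_face
  have := T.euler
  change _ + Nat.card T.Face = _ at this
  omega

theorem apex_ne_fst (hT : T.IsTriangulation) (d : G.Dart) : T.apex d ≠ d.fst :=
  (hT.apex_adj d).ne

theorem face_symm_ne (hT : T.IsTriangulation) (d : G.Dart) : T.face d.symm ≠ T.face d := by
  rw [Ne, hT.face_eq_iff]
  rintro (h | h | h)
  · exact SimpleGraph.Dart.symm_ne d h
  · have := congrArg (fun d : G.Dart => d.snd) h
    exact hT.apex_ne_fst d this.symm
  · have := congrArg (fun d : G.Dart => d.snd) h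
    have h1 := congrArg (fun d : G.Dart => d.fst) h
    simp only [facePerm_facePerm_fst] at h1
    exact (T.adj_apex d).ne h1

/-- Signed areas of triangles are combinations of the signed areas of the faces; for a triangle
that does not contain an edge `e` the faces incident to `e` are not needed. -/
theorem exists_triDet_eq (hT : T.IsTriangulation) [Finite V] [Fintype G.Dart] {u v w : V}
    (huv : G.Adj u v) (hvw : G.Adj v w) (hwu : G.Adj w u) {e : G.Dart}
    (he : ¬((e.fst = u ∨ e.fst = v ∨ e.fst = w) ∧ (e.snd = u ∨ e.snd = v ∨ e.snd = w))) :
    ∃ c : T.Face → ℚ, c (T.face e) = 0 ∧ c (T.face e.symm) = 0 ∧ (∃ f, c f ≠ 0) ∧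
      ∀ {K : Type} [Field K] [CharZero K] (x y : V → K),
        3 * triDet x y u v w = ∑ d, (c (T.face d) : K) * T.faceDet x y d := by
  obtain ⟨c, hc⟩ := T.exists_boundary_eq_triangleCycle huv hvw hwu
  have hce := hc e
  rw [triangleCycle_eq_zero he] at hce
  -- The circulation vanishes on `e`, so `c` agrees on its two faces; subtracting this value kills
  -- both coefficients and leaves the boundary unchanged.
  refine ⟨fun f => c f - c (T.face e), sub_self _, by linarith, ?_, fun {K} _ _ x y => ?_⟩
  · by_contra! hcon
    have h := hc ⟨(u, v), huv⟩
    rw [show c (T.face ⟨(u, v), huv⟩) = c (T.face e) by linarith [hcon (T.face ⟨(u, v), huv⟩)],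
      show c (T.face (SimpleGraph.Dart.symm ⟨(u, v), huv⟩)) = c (T.face e) by
        linarith [hcon (T.face (SimpleGraph.Dart.symm ⟨(u, v), huv⟩))], sub_self] at h
    simp [triangleCycle, dartIndicator, huv.ne, huv.ne', hvw.ne, hwu.ne'] at h
  · set k := fun f => c f - c (T.face e) with hk
    let g : V → V → K := fun a b => x a * y b - x b * y a
    have h1 := sum_triangleCycle_mul (K := K) huv hvw hwu g
    have h2 : ∑ d : G.Dart, (triangleCycle u v w d : K) * g d.fst d.snd =
        2 * ∑ d : G.Dart, (k (T.face d) : K) * g d.fst d.snd := by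
      have : ∀ d : G.Dart, (triangleCycle u v w d : K) * g d.fst d.snd =
          (k (T.face d) : K) * g d.fst d.snd + (k (T.face d.symm) : K) * g d.symm.fst d.symm.snd := by
        intro d
        rw [hc]
        simp only [hk, g, SimpleGraph.Dart.symm, Prod.fst_swap, Prod.snd_swap]
        push_cast
        ring
      simp only [this, Finset.sum_add_distrib]
      rw [sum_dart_symm (fun d => (k (T.face d) : K) * g d.fst d.snd)]
      ring
    have hφ : ∀ F : G.Dart → K, ∑ d, F (T.facePerm d) = ∑ d, F d := Equiv.sum_comp T.facePerm
    -- A face determinant is the sum of `g` over three darts, and a sum over darts meets each face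
    -- three times; hence the factor 3.
    have h3 : ∑ d, (k (T.face d) : K) * T.faceDet x y d =
        3 * ∑ d : G.Dart, (k (T.face d) : K) * g d.fst d.snd := by
      have : ∀ d, (k (T.face d) : K) * T.faceDet x y d = (k (T.face d) : K) * g d.fst d.snd +
          (k (T.face (T.facePerm d)) : K) * g (T.facePerm d).fst (T.facePerm d).snd +
          (k (T.face (T.facePerm (T.facePerm d))) : K) *
            g (T.facePerm (T.facePerm d)).fst (T.facePerm (T.facePerm d)).snd := by
        intro d
        simp only [T.face_facePerm, T.facePerm_fst, hT.facePerm_facePerm_snd]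
        simp only [faceDet, triDet, Matrix.det_fin_three, g]
        simp
        ring
      simp only [this, Finset.sum_add_distrib]
      rw [hφ (fun d => (k (T.face (T.facePerm d)) : K) *
        g (T.facePerm d).fst (T.facePerm d).snd), hφ (fun d => (k (T.face d) : K) *
        g d.fst d.snd)]
      ring
    rw [h3]
    have h4 : (2 : K) * triDet x y u v w = 2 * ∑ d : G.Dart, (k (T.face d) : K) * g d.fst d.snd := by
      rw [← h2, h1]
      simp only [triDet, Matrix.det_fin_three, g]
      simp
      ring
    rw [mul_left_cancel₀ two_ne_zero h4]

/-- Each edge is traversed once in either direction and its shoelace terms cancel. Hence one of the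
area equations follows from the others. -/
theorem sum_faceDet (hT : T.IsTriangulation) [Fintype G.Dart] {K : Type*} [Field K] [CharZero K]
    (x y : V → K) : ∑ d, T.faceDet x y d = 0 := by
  let g : V → V → K := fun a b => x a * y b - x b * y a
  have hφ : ∀ F : G.Dart → K, ∑ d, F (T.facePerm d) = ∑ d, F d := Equiv.sum_comp T.facePerm
  have : ∀ d, T.faceDet x y d = g d.fst d.snd + g (T.facePerm d).fst (T.facePerm d).snd +
      g (T.facePerm (T.facePerm d)).fst (T.facePerm (T.facePerm d)).snd := by
    intro d
    simp only [T.facePerm_fst, hT.facePerm_facePerm_snd]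
    simp only [faceDet, triDet, Matrix.det_fin_three, g]
    simp
    ring
  have h0 : ∑ d : G.Dart, g d.fst d.snd = 0 := by
    have h := sum_dart_symm (fun d : G.Dart => g d.fst d.snd)
    have h' : ∀ d : G.Dart, g d.symm.fst d.symm.snd = -g d.fst d.snd := by
      intro d
      simp only [g, SimpleGraph.Dart.symm, Prod.fst_swap, Prod.snd_swap]
      ring
    simp only [h', Finset.sum_neg_distrib] at h
    exact self_eq_neg.mp h.symm
  simp only [this, Finset.sum_add_distrib]
  rw [hφ (fun d => g (T.facePerm d).fst (T.facePerm d).snd), hφ (fun d => g d.fst d.snd), h0]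
  ring

theorem faceDet_eq_of_face_eq (hT : T.IsTriangulation) {K : Type*} [CommRing K] (x y : V → K)
    {d d' : G.Dart} (h : T.face d = T.face d') : T.faceDet x y d = T.faceDet x y d' := by
  refine Equiv.Perm.SameCycle.apply_eq (fun d => ?_)
    ((RotationSystem.face_eq_iff T.toRotationSystem).mp h)
  simp only [faceDet, T.facePerm_fst, hT.facePerm_facePerm_snd]
  simp only [triDet, Matrix.det_fin_three]
  simp
  ring

end IsTriangulation
end PlaneGraph

/-! ### Uniqueness of the triangulation of a graph. -/

namespace PlaneGraph

variable {V : Type*} {G : SimpleGraph V}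

namespace IsTriangulation

variable {T : PlaneGraph G}

/-- If `X` is a union of components of the graph without the triangle to the left of `d`, then it
contains the apex on the other side of `d`. -/
theorem apex_symm_mem (hT : T.IsTriangulation) [Finite V] (d : G.Dart) {X : Set V}
    (hX : X.Nonempty) (hd : ∀ x ∈ X, x ≠ d.fst ∧ x ≠ d.snd ∧ x ≠ T.apex d)
    (hclosed : ∀ x ∈ X, ∀ y, G.Adj x y → y ≠ d.fst → y ≠ d.snd → y ≠ T.apex d → y ∈ X) :
    T.apex d.symm ∈ X := by
  classical
  have : Fintype G.Dart := Fintype.ofFinite _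
  have : Nontrivial V := ⟨d.fst, d.snd, d.fst_ne_snd⟩
  -- The face has a corner in `X`.
  let M : G.Dart → Prop := fun d' => d'.fst ∈ X ∨ d'.snd ∈ X ∨ T.apex d' ∈ X
  have hM : ∀ d', M (T.facePerm d') = M d' := by
    intro d'
    simp only [M, T.facePerm_fst, hT.apex_facePerm]
    exact propext (by change _ ∨ T.apex d' ∈ X ∨ _ ↔ _; tauto)
  let m : G.Dart → ℤ := fun d' => if M d' then 1 else 0
  have hm : ∀ d', m (T.facePerm d') = m d' := by
    intro d'
    simp only [m, hM]
  let c : T.Face → ℤ := Quotient.lift m fun _ _ h => Equiv.Perm.SameCycle.apply_eq hm h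
  have hc : ∀ d', c (T.face d') = m d' := fun _ => rfl
  -- Across an edge with an end off the triangle nothing changes: either that end is in `X` and is a
  -- corner of both faces, or none of its neighbours is in `X`.
  have hcs : ∀ d' : G.Dart, (d'.fst ≠ d.fst ∧ d'.fst ≠ d.snd ∧ d'.fst ≠ T.apex d) →
      m d' = m d'.symm := by
    intro d' h
    by_cases hx : d'.fst ∈ X
    · have h1 : M d' := Or.inl hx
      have h2 : M d'.symm := Or.inr (Or.inl hx)
      simp only [m, h1, h2]
    · have hnot : ∀ y, G.Adj y d'.fst → y ∉ X := fun y hy hyX =>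
        hx (hclosed y hyX _ hy h.1 h.2.1 h.2.2)
      have h1 : ¬M d' := by
        rintro (h1 | h1 | h1)
        · exact hx h1
        · exact hnot _ d'.adj.symm h1
        · exact hnot _ (hT.apex_adj d') h1
      have h2 : ¬M d'.symm := by
        rintro (h2 | h2 | h2)
        · exact hnot _ d'.adj.symm h2
        · exact hx h2
        · exact hnot _ (T.adj_apex d'.symm).symm h2
      simp only [m, h1, h2]
  have hcs' : ∀ d' : G.Dart, (d'.snd ≠ d.fst ∧ d'.snd ≠ d.snd ∧ d'.snd ≠ T.apex d) →
      m d' = m d'.symm := by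
    intro d' h
    have := hcs d'.symm h
    rw [SimpleGraph.Dart.symm_symm] at this
    exact this.symm
  have hd0 : m d = 0 := by
    refine if_neg ?_
    rintro (h | h | h)
    · exact (hd _ h).1 rfl
    · exact (hd _ h).2.1 rfl
    · exact (hd _ h).2.2 rfl
  by_contra hcon
  have hd1 : m d.symm = 0 := by
    refine if_neg ?_
    rintro (h | h | h)
    · exact (hd _ h).2.1 rfl
    · exact (hd _ h).1 rfl
    · exact hcon h
  -- going around a vertex of the triangle
  have hstep : ∀ d₁ : G.Dart, T.face d₁ = T.face d → m d₁ = m d₁.symm →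
      m (T.facePerm (T.facePerm d₁)) = m (T.facePerm (T.facePerm d₁)).symm := by
    intro d₁ hd₁ h
    have hsum := T.sum_boundary_fst c d₁.fst
    simp only [hc] at hsum
    set d₂ := T.facePerm (T.facePerm d₁) with hd₂
    have hmem : d₂.symm ∈ Finset.univ.filter (fun d' : G.Dart => d'.fst = d₁.fst) := by
      simp only [Finset.mem_filter, Finset.mem_univ, true_and]
      exact hT.facePerm_facePerm_snd d₁
    rw [Finset.sum_eq_single_of_mem _ hmem, SimpleGraph.Dart.symm_symm] at hsum
    · linarith
    · intro d' hd' hne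
      have hfst := (Finset.mem_filter.mp hd').2
      rw [sub_eq_zero]
      by_cases h1 : d'.snd = d₁.snd
      · rw [SimpleGraph.Dart.ext_fst_snd hfst h1, h]
      · have h2 : d'.snd ≠ T.apex d₁ := fun h2 => hne (SimpleGraph.Dart.ext_fst_snd
          (hfst.trans (hT.facePerm_facePerm_snd d₁).symm)
          (h2.trans (T.facePerm_facePerm_fst d₁).symm))
        have h3 : d'.snd ≠ d₁.fst := fun h3 => d'.fst_ne_snd (hfst.trans h3.symm)
        refine hcs' d' ?_
        rcases hT.face_eq_iff.mp hd₁ with rfl | rfl | rfl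
        · exact ⟨h3, h1, h2⟩
        · rw [hT.apex_facePerm] at h2
          rw [T.facePerm_fst] at h3
          exact ⟨h2, h3, h1⟩
        · rw [hT.apex_facePerm, T.facePerm_fst] at h2
          rw [facePerm_facePerm_fst] at h3
          rw [hT.facePerm_facePerm_snd] at h1
          exact ⟨h1, h2, h3⟩
  have e0 : m d = m d.symm := by rw [hd0, hd1]
  have e2 := hstep d rfl e0
  have e1 := hstep _ (by rw [T.face_facePerm, T.face_facePerm]) e2
  rw [hT] at e1
  -- So `m` is constant. It vanishes at `d` but not at a dart leaving a vertex of `X`.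
  have hall : ∀ d', m d'.symm = m d' := by
    intro d'
    by_cases h1 : d'.fst ≠ d.fst ∧ d'.fst ≠ d.snd ∧ d'.fst ≠ T.apex d
    · exact (hcs d' h1).symm
    by_cases h2 : d'.snd ≠ d.fst ∧ d'.snd ≠ d.snd ∧ d'.snd ≠ T.apex d
    · exact (hcs' d' h2).symm
    have h12 := T.facePerm_fst d
    have h23 := T.facePerm_facePerm_fst d
    have h33 := hT.facePerm_facePerm_snd d
    have hne := d'.fst_ne_snd
    have key : ∀ d₁ : G.Dart, m d₁ = m d₁.symm → (d' = d₁ ∨ d' = d₁.symm) → m d'.symm = m d' := by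
      rintro d₁ h (rfl | rfl)
      · exact h.symm
      · rw [SimpleGraph.Dart.symm_symm, h]
    have hor : (d' = d ∨ d' = d.symm) ∨ (d' = T.facePerm d ∨ d' = (T.facePerm d).symm) ∨
        (d' = T.facePerm (T.facePerm d) ∨ d' = (T.facePerm (T.facePerm d)).symm) := by
      have ext_iff : ∀ a b : G.Dart, a = b ↔ a.fst = b.fst ∧ a.snd = b.snd := fun a b =>
        ⟨fun h => h ▸ ⟨rfl, rfl⟩, fun h => SimpleGraph.Dart.ext_fst_snd h.1 h.2⟩
      have s1 : ∀ a : G.Dart, a.symm.fst = a.snd := fun _ => rfl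
      have s2 : ∀ a : G.Dart, a.symm.snd = a.fst := fun _ => rfl
      have h22 : (T.facePerm d).snd = T.apex d := rfl
      simp only [ext_iff, s1, s2, h12, h23, h33, h22]
      by_cases a1 : d'.fst = d.fst
      · have b1 : d'.snd ≠ d.fst := fun h => hne (a1.trans h.symm)
        tauto
      by_cases a2 : d'.fst = d.snd
      · have b1 : d'.snd ≠ d.snd := fun h => hne (a2.trans h.symm)
        tauto
      have a3 : d'.fst = T.apex d := by tauto
      have b1 : d'.snd ≠ T.apex d := fun h => hne (a3.trans h.symm)
      tauto
    rcases hor with h | h | h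
    · exact key _ e0 h
    · exact key _ e1 h
    · exact key _ e2 h
  obtain ⟨x, hx⟩ := hX
  obtain ⟨d', rfl⟩ := T.exists_dart_fst x
  have h1 := T.apply_eq_of_facePerm_of_symm hm hall d' d
  rw [hd0] at h1
  have h2 : M d' := Or.inl hx
  simp [m, h2] at h1

/-- Removing the vertices of a face does not disconnect a triangulation. -/
theorem exists_forall_apply_eq (hT : T.IsTriangulation) [Finite V] (d : G.Dart) {Y : Type*}
    [Nonempty Y] {g : V → Y}
    (hg : ∀ x y, G.Adj x y → x ≠ d.fst → x ≠ d.snd → x ≠ T.apex d →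
      y ≠ d.fst → y ≠ d.snd → y ≠ T.apex d → g x = g y) :
    ∃ k, ∀ x, x ≠ d.fst → x ≠ d.snd → x ≠ T.apex d → g x = k := by
  by_cases h : ∃ x, x ≠ d.fst ∧ x ≠ d.snd ∧ x ≠ T.apex d
  · obtain ⟨x, hx⟩ := h
    refine ⟨g x, fun y h1 h2 h3 => ?_⟩
    by_contra hne
    -- The level set of `g x` and its complement cannot both contain the apex across `d`.
    have e1 := hT.apex_symm_mem d
      (X := {z | (z ≠ d.fst ∧ z ≠ d.snd ∧ z ≠ T.apex d) ∧ g z = g x}) ⟨x, hx, rfl⟩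
      (fun z hz => hz.1) (fun z hz w hzw a b c =>
        ⟨⟨a, b, c⟩, (hg z w hzw hz.1.1 hz.1.2.1 hz.1.2.2 a b c).symm.trans hz.2⟩)
    have e2 := hT.apex_symm_mem d
      (X := {z | (z ≠ d.fst ∧ z ≠ d.snd ∧ z ≠ T.apex d) ∧ g z ≠ g x}) ⟨y, ⟨h1, h2, h3⟩, hne⟩
      (fun z hz => hz.1) (fun z hz w hzw a b c =>
        ⟨⟨a, b, c⟩, fun h => hz.2 ((hg z w hzw hz.1.1 hz.1.2.1 hz.1.2.2 a b c).trans h)⟩)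
    exact e2.2 e1.2
  · push Not at h
    obtain ⟨k⟩ := ‹Nonempty Y›
    exact ⟨k, fun x h1 h2 h3 => absurd (h x h1 h2) h3⟩

/-- A facial triangle of `T` does not separate the graph. Let `c` be a face function of `T'` with
this triangle as boundary: it is constant on the faces having a corner off the triangle. As it jumps
across `d`, one of the two faces of `T'` at `d` has no such corner and is the triangle itself. -/
theorem apex_eq_or (hT : T.IsTriangulation) [Finite V] {T' : PlaneGraph G}
    (hT' : T'.IsTriangulation) (d : G.Dart) :
    T'.apex d = T.apex d ∨ T'.apex d.symm = T.apex d := by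
  have : Nontrivial V := ⟨d.fst, d.snd, d.fst_ne_snd⟩
  obtain ⟨c, hc⟩ := T'.exists_boundary_eq_triangleCycle d.adj (T.adj_apex d) (hT.apex_adj d)
  have hrot : ∀ x, x ≠ d.fst → x ≠ d.snd → x ≠ T.apex d → ∀ d' : G.Dart, d'.fst = x →
      c (T'.face (T'.rot d')) = c (T'.face d') := by
    intro x h1 h2 h3 d' hd'
    have h := hc (T'.rot d')
    rw [T'.face_rot_symm, triangleCycle_eq_zero] at h
    · linarith
    · rw [T'.rot_fst, hd']
      tauto
  choose D hD using T'.exists_dart_fst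
  have hg : ∀ x, x ≠ d.fst → x ≠ d.snd → x ≠ T.apex d → ∀ d' : G.Dart, d'.fst = x →
      c (T'.face d') = c (T'.face (D x)) := fun x h1 h2 h3 d' hd' =>
    T'.apply_eq_of_fst_eq (c := fun d => c (T'.face d)) (hrot x h1 h2 h3) hd' (hD x)
  obtain ⟨k, hk⟩ := hT.exists_forall_apply_eq d (g := fun x => c (T'.face (D x))) (by
    intro x y hxy x1 x2 x3 y1 y2 y3
    have e1 := hg x x1 x2 x3 ⟨(x, y), hxy⟩ rfl
    have e2 := hg y y1 y2 y3 (SimpleGraph.Dart.symm ⟨(x, y), hxy⟩) rfl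
    have e3 := hc ⟨(x, y), hxy⟩
    rw [triangleCycle_eq_zero] at e3
    · change c (T'.face (D x)) = c (T'.face (D y))
      linarith
    · tauto)
  have hk' : ∀ d', T'.apex d' ≠ d.fst → T'.apex d' ≠ d.snd → T'.apex d' ≠ T.apex d →
      c (T'.face d') = k := by
    intro d' h1 h2 h3
    rw [← hk _ h1 h2 h3, ← T'.face_facePerm d', ← T'.face_facePerm (T'.facePerm d')]
    exact hg _ h1 h2 h3 _ (T'.facePerm_facePerm_fst d')
  by_contra! hcon
  have a1 := hk' d (hT'.apex_ne_fst d) (T'.adj_apex d).ne' hcon.1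
  have a2 := hk' d.symm (T'.adj_apex d.symm).ne' (hT'.apex_ne_fst d.symm) hcon.2
  have h := hc d
  rw [a1, a2, sub_self] at h
  have n1 := d.fst_ne_snd
  have n2 := (T.adj_apex d).ne
  have n3 := (hT.apex_adj d).ne
  simp [triangleCycle, dartIndicator, n1, n1.symm, n2, n3.symm] at h

/-- Otherwise the two faces at `d` share all three edges and are the whole sphere, whereas a
triangulation has `2 |V| - 4 ≥ 4` faces. -/
theorem apex_symm_ne (hT : T.IsTriangulation) [Finite V] (hV : 4 ≤ Nat.card V) (d : G.Dart) :
    T.apex d.symm ≠ T.apex d := by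
  classical
  intro heq
  have hP := T.apply_eq_of_facePerm_of_symm
    (c := fun d' => T.face d' = T.face d ∨ T.face d' = T.face d.symm)
    (fun d' => by simp only [T.face_facePerm]) (fun d' => ?_)
  · have hsub : (Set.univ : Set T.Face) ⊆ {T.face d, T.face d.symm} := by
      intro f _
      obtain ⟨d', rfl⟩ := T.face_surjective f
      have := (hP d' d).mpr (Or.inl rfl)
      simpa using this
    have h1 := Set.ncard_le_ncard hsub (Set.toFinite _)
    have h2 := Set.ncard_insert_le (T.face d) {T.face d.symm}
    rw [Set.ncard_singleton] at h2
    rw [Set.ncard_univ] at h1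
    have := hT.card_face
    omega
  · have e1 : (T.facePerm d).symm = T.facePerm (T.facePerm d.symm) :=
      SimpleGraph.Dart.ext_fst_snd ((T.facePerm_facePerm_fst _).trans heq).symm
        ((T.facePerm_fst d).trans (hT.facePerm_facePerm_snd d.symm).symm)
    have e2 : (T.facePerm (T.facePerm d)).symm = T.facePerm d.symm :=
      SimpleGraph.Dart.ext_fst_snd ((hT.facePerm_facePerm_snd d).trans (T.facePerm_fst d.symm).symm)
        ((T.facePerm_facePerm_fst d).trans heq.symm)
    have key : ∀ d', (T.face d' = T.face d ∨ T.face d' = T.face d.symm) →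
        (T.face d'.symm = T.face d ∨ T.face d'.symm = T.face d.symm) := by
      intro d' h
      rw [hT.face_eq_iff, hT.face_eq_iff] at h
      rcases h with (rfl | rfl | rfl) | (rfl | rfl | rfl)
      · exact Or.inr rfl
      · rw [e1, T.face_facePerm, T.face_facePerm]; exact Or.inr rfl
      · rw [e2, T.face_facePerm]; exact Or.inr rfl
      · rw [SimpleGraph.Dart.symm_symm]; exact Or.inl rfl
      · rw [← e2, SimpleGraph.Dart.symm_symm, T.face_facePerm, T.face_facePerm]; exact Or.inl rfl
      · rw [← e1, SimpleGraph.Dart.symm_symm, T.face_facePerm]; exact Or.inl rfl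
    exact propext ⟨fun h => by simpa using key _ h, key d'⟩

/-- Two triangulations of the sphere with the same graph coincide up to reflection. -/
theorem apex_eq_or_apex_eq (hT : T.IsTriangulation) [Finite V] (hV : 4 ≤ Nat.card V)
    {T' : PlaneGraph G} (hT' : T'.IsTriangulation) :
    (∀ d, T'.apex d = T.apex d) ∨ ∀ d, T'.apex d = T.apex d.symm := by
  have hdich : ∀ d, (T'.apex d = T.apex d ∧ T'.apex d.symm = T.apex d.symm) ∨
      (T'.apex d = T.apex d.symm ∧ T'.apex d.symm = T.apex d) := by
    intro d
    have h1 := hT.apex_eq_or hT' d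
    have h2 := hT.apex_eq_or hT' d.symm
    rw [SimpleGraph.Dart.symm_symm] at h2
    have h3 := hT.apex_symm_ne hV d
    rcases h1 with h1 | h1 <;> rcases h2 with h2 | h2
    · exact Or.inl ⟨h1, h2⟩
    · exact absurd (h2.symm.trans h1) h3
    · exact absurd (h2.symm.trans h1) h3
    · exact Or.inr ⟨h2, h1⟩
  -- Agreement of the two triangulations at a dart spreads along faces and across edges, so it holds
  -- everywhere or nowhere.
  let S : G.Dart → Prop := fun d => T'.apex d = T.apex d
  have hS1 : ∀ d, S d → S (T.facePerm d) := by
    intro d hd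
    have e : T'.facePerm d = T.facePerm d :=
      SimpleGraph.Dart.ext_fst_snd ((T'.facePerm_fst d).trans (T.facePerm_fst d).symm) hd
    change T'.apex (T.facePerm d) = _
    rw [← e, hT'.apex_facePerm, e, hT.apex_facePerm]
  have hS2 : ∀ d, S d → S d.symm := by
    intro d hd
    rcases hdich d with h | h
    · exact h.2
    · exact absurd (h.1.symm.trans hd) (hT.apex_symm_ne hV d)
  have hall := T.apply_eq_of_facePerm_of_symm (c := S)
    (fun d => propext ⟨fun h => by
      have := hS1 _ (hS1 _ h); rwa [hT] at this, hS1 d⟩)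
    (fun d => propext ⟨fun h => by
      have := hS2 _ h; rwa [SimpleGraph.Dart.symm_symm] at this, hS2 d⟩)
  by_cases h : ∃ d, S d
  · obtain ⟨d, hd⟩ := h
    exact Or.inl fun d' => (hall d d').mp hd
  · push Not at h
    exact Or.inr fun d => ((hdich d).resolve_left fun h' => h d h'.1).1

end IsTriangulation

/-- A plane graph on at least four vertices with as many edges as a triangulation is a
triangulation. -/
theorem IsTriangulation.of_isTriangulation {T T' : PlaneGraph G} (hT : T.IsTriangulation)
    [Finite V] (hV : 4 ≤ Nat.card V) : T'.IsTriangulation := by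
  classical
  have : Fintype G.Dart := Fintype.ofFinite _
  have : Fintype T'.Face := Fintype.ofFinite _
  have hcard : Fintype.card G.Dart = 3 * Fintype.card T'.Face := by
    have h1 := hT.three_mul_card_face
    have h2 := T.euler
    have h3 := T'.euler
    have h4 := card_dart (G := G)
    change _ + Nat.card T.Face = _ at h2
    change _ + Nat.card T'.Face = _ at h3
    rw [Nat.card_eq_fintype_card] at h4
    rw [Nat.card_eq_fintype_card (α := T'.Face)] at h3
    omega
  have hne1 : ∀ d, T'.facePerm d ≠ d := fun d h => by
    have := T'.facePerm_fst d
    rw [h] at this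
    exact d.fst_ne_snd this
  -- A face of length two runs along one edge in both directions, and then the graph is that edge.
  have hne2 : ∀ d, T'.facePerm (T'.facePerm d) ≠ d := by
    intro d h
    have e1 : T'.facePerm d = d.symm := SimpleGraph.Dart.ext_fst_snd (T'.facePerm_fst d) (by
      rw [← T'.facePerm_fst, h]; rfl)
    have e2 : T'.facePerm d.symm = d := by rw [← e1, h]
    have hP := T'.apply_eq_of_facePerm_of_symm (c := fun d' => d' = d ∨ d' = d.symm)
      (fun d' => propext ⟨?_, ?_⟩) (fun d' => propext ⟨?_, ?_⟩)
    · have h1 : Fintype.card G.Dart ≤ 2 := by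
        rw [← Finset.card_univ]
        refine le_trans (Finset.card_le_card (t := {d, d.symm}) fun d' _ => ?_) Finset.card_le_two
        simpa using (hP d' d).mpr (Or.inl rfl)
      have h2 := hT.three_mul_card_face
      have h3 := hT.card_face
      have h4 := card_dart (G := G)
      rw [Nat.card_eq_fintype_card] at h4
      omega
    · rintro (h' | h')
      · right; apply T'.facePerm.injective; rw [h', e2]
      · left; apply T'.facePerm.injective; rw [h', e1]
    · rintro (rfl | rfl)
      · exact Or.inr e1
      · exact Or.inl e2
    · rintro (h' | h')
      · right; rw [← h', SimpleGraph.Dart.symm_symm]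
      · left; rw [← SimpleGraph.Dart.symm_symm d', h', SimpleGraph.Dart.symm_symm]
    · rintro (rfl | rfl)
      · exact Or.inr rfl
      · left; rw [SimpleGraph.Dart.symm_symm]
  let F : T'.Face → Finset G.Dart := fun f => Finset.univ.filter fun d => T'.face d = f
  have hsub : ∀ d, ({d, T'.facePerm d, T'.facePerm (T'.facePerm d)} : Finset G.Dart) ⊆
      F (T'.face d) := by
    intro d d' hd'
    simp only [Finset.mem_insert, Finset.mem_singleton] at hd'
    rcases hd' with rfl | rfl | rfl <;> simp [F, T'.face_facePerm]
  have hcard3 : ∀ d, ({d, T'.facePerm d, T'.facePerm (T'.facePerm d)} : Finset G.Dart).card = 3 :=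
    fun d => Finset.card_eq_three.mpr ⟨_, _, _, (hne1 d).symm, (hne2 d).symm, (hne1 _).symm, rfl⟩
  have hge : ∀ f, 3 ≤ (F f).card := by
    intro f
    obtain ⟨d, rfl⟩ := T'.face_surjective f
    rw [← hcard3 d]
    exact Finset.card_le_card (hsub d)
  -- Every face has at least three darts and the average is three, so all faces are triangles.
  have hsum : ∑ f, (F f).card = ∑ _f : T'.Face, 3 := by
    have h := Finset.card_eq_sum_card_fiberwise (f := T'.face) (s := Finset.univ)
      (t := Finset.univ) (fun _ _ => Finset.mem_coe.mpr (Finset.mem_univ _))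
    rw [Finset.card_univ, hcard] at h
    rw [← h]
    simp [mul_comm]
  have heq : ∀ f, (F f).card = 3 := fun f =>
    ((Finset.sum_eq_sum_iff_of_le fun f _ => hge f).mp hsum.symm f (Finset.mem_univ f)).symm
  intro d
  have hF := Finset.eq_of_subset_of_card_le (hsub d) (by rw [heq, hcard3])
  have hmem : T'.facePerm (T'.facePerm (T'.facePerm d)) ∈ F (T'.face d) := by
    simp [F, T'.face_facePerm]
  rw [← hF] at hmem
  simp only [Finset.mem_insert, Finset.mem_singleton] at hmem
  rcases hmem with h | h | h
  · exact h
  · exact absurd (T'.facePerm.injective h) (hne2 d)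
  · exact absurd h (hne1 _)

end PlaneGraph

/-! ### Algebraic independence, transcendence and specialization. -/

theorem Subalgebra.isAlgebraic_of_eq_top {K A : Type*} [Field K] [CommRing A] [Nontrivial A]
    [Algebra K A] {S : Subalgebra K A} (h : S = ⊤) : Algebra.IsAlgebraic S A :=
  ⟨fun z => isAlgebraic_algebraMap (⟨z, h ▸ Algebra.mem_top⟩ : S)⟩

/-- A family that generates an algebra containing as many algebraically independent elements is
algebraically independent. -/
theorem AlgebraicIndependent.of_mem_adjoin {K M : Type*} [Field K] [Field M] [Algebra K M]
    {ι κ : Type*} [Finite ι] {t : ι → M} {s : κ → M} (hs : AlgebraicIndependent K s)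
    (hsub : ∀ j, s j ∈ Algebra.adjoin K (Set.range t)) (hcard : Nat.card ι ≤ Nat.card κ)
    [Finite κ] : AlgebraicIndependent K t := by
  have main : ∀ (N : ℕ) (t s : Fin N → M), AlgebraicIndependent K s →
      (∀ j, s j ∈ Algebra.adjoin K (Set.range t)) → AlgebraicIndependent K t := by
    intro N t s hs hsub
    let A := Algebra.adjoin K (Set.range t)
    let t' : Fin N → A := fun i => ⟨t i, Algebra.subset_adjoin ⟨i, rfl⟩⟩
    let s' : Fin N → A := fun j => ⟨s j, hsub j⟩
    have hs' : AlgebraicIndependent K s' :=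
      (AlgHom.algebraicIndependent_iff A.val Subtype.val_injective).mp hs
    have htop : Algebra.adjoin K (Set.range t') = ⊤ := by
      have : Set.range t' = Subtype.val ⁻¹' Set.range t := by
        ext ⟨z, hz⟩
        simp [t']
      rw [this]
      exact Algebra.adjoin_adjoin_coe_preimage
    have halg : Algebra.IsAlgebraic (Algebra.adjoin K (Set.range t')) A :=
      Subalgebra.isAlgebraic_of_eq_top htop
    -- The transcendence degree is at least `N`, so `N` generators form a transcendence basis.
    have hle := hs'.lift_cardinalMk_le_trdeg
    have hb := Algebra.IsAlgebraic.isTranscendenceBasis_of_lift_le_trdeg_of_finite K t' hle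
    exact (AlgHom.algebraicIndependent_iff (x := t') A.val Subtype.val_injective).mpr hb.1
  let E := Finite.equivFin ι
  let F := Finite.equivFin κ
  have h := main _ (t ∘ E.symm) (s ∘ F.symm ∘ Fin.castLE hcard)
    (hs.comp _ (F.symm.injective.comp (Fin.castLE_injective hcard)))
    (fun j => by rw [Set.range_comp, E.symm.range_eq_univ, Set.image_univ]; exact hsub _)
  simpa [Function.comp_def] using h.comp E E.injective

theorem MvPolynomial.eval₂_aeval_optionEquivLeft {M J : Type*} [Field M] [Algebra ℚ M] (s : J → M)
    (c : M) (p : MvPolynomial (Option J) ℚ) :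
    (MvPolynomial.optionEquivLeft ℚ J p).eval₂ (MvPolynomial.aeval s : _ →ₐ[ℚ] M).toRingHom c =
      MvPolynomial.aeval (fun o : Option J => o.elim c s) p := by
  induction p using MvPolynomial.induction_on with
  | C r => simp
  | add p q hp hq => simp only [map_add, Polynomial.eval₂_add, hp, hq]
  | mul_X p o hp =>
    rw [map_mul, map_mul, Polynomial.eval₂_mul, hp]
    cases o <;> simp

/-- Constant polynomials `p` account for the independence of `s` itself. -/
theorem algebraicIndependent_option_iff {M J : Type*} [Field M] [Algebra ℚ M] {s : J → M} {c : M} :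
    AlgebraicIndependent ℚ (fun o : Option J => o.elim c s) ↔
      ∀ p : (MvPolynomial J ℚ)[X],
        p.eval₂ (MvPolynomial.aeval s : _ →ₐ[ℚ] M).toRingHom c = 0 → p = 0 := by
  rw [algebraicIndependent_iff]
  constructor
  · intro h p hp
    have := h ((MvPolynomial.optionEquivLeft ℚ J).symm p) (by
      rw [← MvPolynomial.eval₂_aeval_optionEquivLeft, AlgEquiv.apply_symm_apply, hp])
    simpa using this
  · intro h p hp
    have := h (MvPolynomial.optionEquivLeft ℚ J p) (by
      rw [MvPolynomial.eval₂_aeval_optionEquivLeft, hp])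
    simpa using this

/-- The field of rational functions in algebraically independent elements, and the transcendence of
a further independent element over it. -/
theorem exists_ringHom_of_algebraicIndependent_option {M J : Type*} [Field M] [Algebra ℚ M]
    {s : J → M} {c : M} (h : AlgebraicIndependent ℚ (fun o : Option J => o.elim c s)) :
    ∃ τ : FractionRing (MvPolynomial J ℚ) →+* M,
      (∀ j, τ (algebraMap (MvPolynomial J ℚ) _ (MvPolynomial.X j)) = s j) ∧
      ∀ p : (FractionRing (MvPolynomial J ℚ))[X], p.eval₂ τ c = 0 → p = 0 := by
  have hs : AlgebraicIndependent ℚ s := h.comp some (Option.some_injective J)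
  have hinj : Function.Injective (MvPolynomial.aeval s : _ →ₐ[ℚ] M).toRingHom := hs
  obtain ⟨τ, hτ⟩ : ∃ τ : FractionRing (MvPolynomial J ℚ) →+* M, ∀ p : MvPolynomial J ℚ,
      τ (algebraMap (MvPolynomial J ℚ) _ p) = MvPolynomial.aeval s p :=
    ⟨IsFractionRing.lift hinj, fun p => IsFractionRing.lift_algebraMap hinj p⟩
  refine ⟨τ, fun j => (hτ _).trans (MvPolynomial.aeval_X s j), fun p hp => ?_⟩
  rw [algebraicIndependent_option_iff] at h
  let : Algebra (MvPolynomial J ℚ) M := (MvPolynomial.aeval s : _ →ₐ[ℚ] M).toRingHom.toAlgebra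
  let : Algebra (FractionRing (MvPolynomial J ℚ)) M := τ.toAlgebra
  have : IsScalarTower (MvPolynomial J ℚ) (FractionRing (MvPolynomial J ℚ)) M :=
    IsScalarTower.of_algebraMap_eq fun p => (hτ p).symm
  by_contra hne
  have halg : IsAlgebraic (FractionRing (MvPolynomial J ℚ)) c := ⟨p, hne, hp⟩
  rw [← IsFractionRing.isAlgebraic_iff (MvPolynomial J ℚ)] at halg
  obtain ⟨q, hq, hq0⟩ := halg
  exact hq (h q hq0)

theorem Polynomial.exists_isRoot_of_odd_natDegree {p : ℝ[X]} (hp : Odd p.natDegree) :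
    ∃ z, p.IsRoot z := by
  have main : ∀ p : ℝ[X], Odd p.natDegree → 0 < p.leadingCoeff → ∃ z, p.IsRoot z := by
    intro p hp hlc
    have hdeg : 0 < p.degree := Polynomial.natDegree_pos_iff_degree_pos.mp hp.pos
    have h1 := p.tendsto_atTop_of_leadingCoeff_nonneg hdeg hlc.le
    have hq : (p.comp (-X)).natDegree = p.natDegree := by
      rw [Polynomial.natDegree_comp, Polynomial.natDegree_neg, Polynomial.natDegree_X, mul_one]
    have h2 := (p.comp (-X)).tendsto_atBot_of_leadingCoeff_nonpos
      (Polynomial.natDegree_pos_iff_degree_pos.mp (hq ▸ hp.pos)) (by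
        rw [Polynomial.leadingCoeff_comp (by simp), Polynomial.leadingCoeff_neg,
          Polynomial.leadingCoeff_X, hp.neg_one_pow]
        linarith)
    obtain ⟨a, ha⟩ := (h1.eventually_ge_atTop 0).exists
    obtain ⟨b, hb⟩ := (h2.eventually_le_atBot 0).exists
    rw [Polynomial.eval_comp] at hb
    obtain ⟨z, hz⟩ := mem_range_of_exists_le_of_exists_ge p.continuous ⟨_, hb⟩ ⟨_, ha⟩
    exact ⟨z, hz⟩
  have hne : p.leadingCoeff ≠ 0 := by
    rw [Ne, Polynomial.leadingCoeff_eq_zero]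
    rintro rfl
    simp at hp
  rcases lt_or_gt_of_ne hne with h | h
  · obtain ⟨z, hz⟩ := main (-p) (by rwa [Polynomial.natDegree_neg])
      (by rw [Polynomial.leadingCoeff_neg]; linarith)
    exact ⟨z, by simpa using hz⟩
  · exact main p hp h

/-- If `P / Q` has odd max-degree and `c` is transcendental, then `P / Q` takes the value `c` at
a transcendental point. -/
theorem exists_transcendental_eval₂_eq {K : Type*} [Field K] (τ : K →+* ℝ) {P Q : K[X]}
    (hcop : IsCoprime P Q) (hodd : Odd (max P.natDegree Q.natDegree)) {c : ℝ}
    (hc : ∀ R : K[X], R.eval₂ τ c = 0 → R = 0) :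
    ∃ z : ℝ, (∀ R : K[X], R.eval₂ τ z = 0 → R = 0) ∧ Q.eval₂ τ z ≠ 0 ∧
      P.eval₂ τ z = c * Q.eval₂ τ z := by
  set n := max P.natDegree Q.natDegree with hn
  let N : ℝ[X] := P.map τ - Polynomial.C c * Q.map τ
  have hNle : N.natDegree ≤ n := by
    refine (Polynomial.natDegree_sub_le _ _).trans (max_le ?_ ?_)
    · exact Polynomial.natDegree_map_le.trans (le_max_left _ _)
    · exact (Polynomial.natDegree_C_mul_le _ _).trans
        (Polynomial.natDegree_map_le.trans (le_max_right _ _))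
  -- Top coefficients cannot cancel: that would be a polynomial equation over `K` of degree at most
  -- one for `c`. So `N` has odd degree `n`.
  have hNn : N.coeff n ≠ 0 := by
    intro h
    have hR := hc (Polynomial.C (P.coeff n) - Polynomial.C (Q.coeff n) * Polynomial.X) (by
      simp only [N, Polynomial.coeff_sub, Polynomial.coeff_map, Polynomial.coeff_C_mul] at h
      simp only [Polynomial.eval₂_sub, Polynomial.eval₂_mul, Polynomial.eval₂_C,
        Polynomial.eval₂_X]
      linarith)
    have h0 : P.coeff n = 0 := by simpa using congrArg (fun p => Polynomial.coeff p 0) hR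
    have h1 : Q.coeff n = 0 := by simpa using congrArg (fun p => Polynomial.coeff p 1) hR
    rcases max_choice P.natDegree Q.natDegree with h2 | h2
    · rw [hn, h2, Polynomial.coeff_natDegree, Polynomial.leadingCoeff_eq_zero] at h0
      rw [hn, h2, h0] at hodd
      simp at hodd
    · rw [hn, h2, Polynomial.coeff_natDegree, Polynomial.leadingCoeff_eq_zero] at h1
      rw [hn, h2, h1] at hodd
      simp at hodd
  obtain ⟨z, hz⟩ := Polynomial.exists_isRoot_of_odd_natDegree (p := N)
    (by rwa [Polynomial.natDegree_eq_of_le_of_coeff_ne_zero hNle hNn])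
  have hz' : P.eval₂ τ z = c * Q.eval₂ τ z := by
    simp only [N, Polynomial.IsRoot, Polynomial.eval_sub, Polynomial.eval_mul, Polynomial.eval_C,
      Polynomial.eval_map] at hz
    linarith
  have hQz : Q.eval₂ τ z ≠ 0 := by
    intro h
    rw [h, mul_zero] at hz'
    obtain ⟨a, b, hab⟩ := hcop
    have := congrArg (Polynomial.eval₂ τ z) hab
    simp [Polynomial.eval₂_add, Polynomial.eval₂_mul, h, hz'] at this
  refine ⟨z, fun R hR => ?_, hQz, hz'⟩
  by_contra hne
  let : Algebra K ℝ := τ.toAlgebra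
  have hzi : z ∈ integralClosure K ℝ :=
    IsAlgebraic.isIntegral ⟨R, hne, hR⟩
  have hev : ∀ F : K[X], IsAlgebraic K (F.eval₂ τ z) := fun F => by
    have h : Polynomial.aeval z F ∈ integralClosure K ℝ :=
      Algebra.adjoin_le (Set.singleton_subset_iff.mpr hzi)
        (Polynomial.aeval_mem_adjoin_singleton K z)
    exact IsIntegral.isAlgebraic h
  -- If `z` were algebraic over `K`, so would be `c = P(z) / Q(z)`.
  have hcalg : IsAlgebraic K c := by
    rw [show c = P.eval₂ τ z * (Q.eval₂ τ z)⁻¹ by rw [hz']; field_simp]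
    exact (hev P).mul (hev Q).inv
  obtain ⟨F, hF, hF0⟩ := hcalg
  exact hF (hc F hF0)

/-- The extension of a field homomorphism to rational functions. -/
theorem RatFunc.exists_ringHom {K M : Type*} [Field K] [Field M] (τ : K →+* M) (z : M)
    (hz : ∀ R : K[X], R.eval₂ τ z = 0 → R = 0) :
    ∃ θ : RatFunc K →+* M, ∀ p : K[X], θ (algebraMap K[X] (RatFunc K) p) = p.eval₂ τ z := by
  have hle : nonZeroDivisors K[X] ≤
      (nonZeroDivisors M).comap (Polynomial.eval₂RingHom τ z) := by
    intro p hp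
    rw [Submonoid.mem_comap, mem_nonZeroDivisors_iff_ne_zero]
    exact fun h => nonZeroDivisors.ne_zero hp (hz p h)
  exact ⟨RatFunc.liftRingHom _ hle, fun p => RatFunc.liftRingHom_algebraMap _ hle p⟩

/-! ### Generic areas and noncollinearity. -/

section

variable {V : Type*}

theorem triDet_eq {R : Type*} [CommRing R] (x y : V → R) (u v w : V) :
    triDet x y u v w = (x v - x u) * (y w - y u) - (x w - x u) * (y v - y u) := by
  simp only [triDet, Matrix.det_fin_three]
  simp
  ring

theorem map_triDet {R S : Type*} [CommRing R] [CommRing S] (φ : R →+* S) (x y : V → R)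
    (u v w : V) :
    φ (triDet x y u v w) = triDet (fun v => φ (x v)) (fun v => φ (y v)) u v w := by
  simp only [triDet_eq, map_sub, map_mul]

theorem map_faceDet {G : SimpleGraph V} (T : PlaneGraph G) {R S : Type*} [CommRing R] [CommRing S]
    (φ : R →+* S) (x y : V → R) (d : G.Dart) :
    φ (T.faceDet x y d) = T.faceDet (fun v => φ (x v)) (fun v => φ (y v)) d :=
  map_triDet φ x y _ _ _

theorem Nat.card_subtype_ne_add_one {F : Type*} [Finite F] (f₀ : F) :
    Nat.card {f // f ≠ f₀} + 1 = Nat.card F := by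
  classical
  rw [← Finite.card_option, Nat.card_congr (Equiv.optionSubtypeNe f₀)]

theorem bijective_option_elim_ne {F : Type*} {fa fb : F} (hab : fa ≠ fb) :
    Function.Bijective (fun o : Option {f // f ≠ fa ∧ f ≠ fb} =>
      (o.elim ⟨fa, hab⟩ fun j => ⟨j.1, j.2.2⟩ : {f // f ≠ fb})) := by
  constructor
  · rintro (_ | ⟨f, hf⟩) (_ | ⟨g, hg⟩) h
    · rfl
    · exact absurd (congrArg Subtype.val h).symm hg.1
    · exact absurd (congrArg Subtype.val h) hf.1
    · have : f = g := congrArg Subtype.val h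
      subst this
      rfl
  · rintro ⟨f, hf⟩
    by_cases h : f = fa
    · subst h; exact ⟨none, rfl⟩
    · exact ⟨some ⟨f, h, hf⟩, rfl⟩

/-- Numbers with sum zero that are algebraically independent apart from this relation. -/
structure IsGenericZeroSum {F : Type*} (a : F → ℝ) : Prop where
  sum_eq_zero : ∑ᶠ f, a f = 0
  algebraicIndependent : ∀ f₀, AlgebraicIndependent ℚ (fun f : {f // f ≠ f₀} => a f.1)

/-- The omitted value is minus the sum of the others, so it does not matter which face is omitted.
-/
theorem IsGenericZeroSum.of_algebraicIndependent {F : Type*} [Finite F] {a : F → ℝ}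
    (hsum : ∑ᶠ f, a f = 0) {f₁ : F}
    (h : AlgebraicIndependent ℚ (fun f : {f // f ≠ f₁} => a f.1)) : IsGenericZeroSum a := by
  classical
  have : Fintype F := Fintype.ofFinite F
  refine ⟨hsum, fun f₀ => h.of_mem_adjoin (fun j => ?_) ?_⟩
  · have hmem : ∀ f, f ≠ f₀ → a f ∈ Algebra.adjoin ℚ
        (Set.range fun f : {f // f ≠ f₀} => a f.1) := fun f hf =>
      Algebra.subset_adjoin ⟨⟨f, hf⟩, rfl⟩
    by_cases hj : j.1 = f₀
    · rw [finsum_eq_sum_of_fintype, ← Finset.add_sum_erase _ _ (Finset.mem_univ f₀)] at hsum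
      rw [hj, eq_neg_of_add_eq_zero_left hsum]
      exact neg_mem (sum_mem fun f hf => hmem f (Finset.ne_of_mem_erase hf))
    · exact hmem _ hj
  · have h1 := Nat.card_subtype_ne_add_one f₀
    have h2 := Nat.card_subtype_ne_add_one f₁
    omega

theorem IsGenericZeroSum.option {F : Type*} {a : F → ℝ} (h : IsGenericZeroSum a) {fa fb : F}
    (hab : fa ≠ fb) : AlgebraicIndependent ℚ
      (fun o : Option {f // f ≠ fa ∧ f ≠ fb} => o.elim (a fa) fun j => a j.1) := by
  have h1 := (h.algebraicIndependent fb).comp _ (bijective_option_elim_ne hab).injective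
  convert h1 using 1
  funext o
  cases o <;> rfl

theorem algebraicIndependent_option_ratFunc {J : Type*} {a : J → ℝ}
    (ha : AlgebraicIndependent ℚ a) (s : ℝ) :
    AlgebraicIndependent ℚ (fun o : Option J =>
      o.elim (RatFunc.X + RatFunc.C s) fun j => RatFunc.C (a j)) := by
  rw [algebraicIndependent_option_iff]
  intro p hp
  have hom : (MvPolynomial.aeval fun j => RatFunc.C (a j) :
      MvPolynomial J ℚ →ₐ[ℚ] RatFunc ℝ).toRingHom =
      (algebraMap ℝ[X] (RatFunc ℝ)).comp (Polynomial.C.comp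
        (MvPolynomial.aeval a : MvPolynomial J ℚ →ₐ[ℚ] ℝ).toRingHom) := by
    refine MvPolynomial.ringHom_ext (fun r => ?_) (fun j => ?_)
    · simp
    · simp
  have hX : (RatFunc.X + RatFunc.C s : RatFunc ℝ) =
      algebraMap ℝ[X] (RatFunc ℝ) (Polynomial.X + Polynomial.C s) := by simp
  rw [hom, hX, ← Polynomial.hom_eval₂, map_eq_zero_iff _ (RatFunc.algebraMap_injective ℝ),
    ← Polynomial.eval₂_map] at hp
  have hp' : (p.map (MvPolynomial.aeval a : MvPolynomial J ℚ →ₐ[ℚ] ℝ).toRingHom).comp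
      (Polynomial.X + Polynomial.C s) = 0 := hp
  rw [Polynomial.comp_X_add_C_eq_zero_iff] at hp'
  exact (Polynomial.map_eq_zero_iff ha).mp hp'

/-- A Vandermonde determinant. The parabola `y = x² - x` passes through the prescribed positions
`(0, 0)` and `(1, 0)`, and no three of its points are collinear. -/
theorem triDet_parabola {K : Type*} [CommRing K] (n : V → K) (u v w : V) :
    triDet n (fun v => n v ^ 2 - n v) u v w = (n v - n u) * (n w - n u) * (n w - n v) := by
  rw [triDet_eq]
  ring

end

namespace PlaneGraph

variable {V : Type*} {G : SimpleGraph V} {T : PlaneGraph G}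

theorem _root_.POrder.card_eq (P : POrder G) : Nat.card V = P.m + 4 := by
  rw [← Nat.card_congr P.v, Nat.card_eq_fintype_card, Fintype.card_fin]

/-- In a normalized family of almost realizing placements no three vertices are always
collinear. -/
theorem IsTriangulation.triDet_ne_zero (hT : T.IsTriangulation) [Finite V] (P : POrder G)
    {fa fb : T.Face} (hab : fa ≠ fb) {a : T.Face → ℝ}
    (ha : AlgebraicIndependent ℚ (fun j : {f // f ≠ fa ∧ f ≠ fb} => a j.1))
    {x y : V → RatFunc ℝ} {s : ℝ} (hx0 : x (P.v 0) = 0) (hy0 : y (P.v 0) = 0)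
    (hx1 : x (P.v 1) = 1) (hy1 : y (P.v 1) = 0) (hx2 : x (P.v 2) = 2)
    (hx3 : x (P.v 3) = RatFunc.X + RatFunc.C s)
    (harea : ∀ d, T.face d ≠ fa → T.face d ≠ fb →
      T.faceDet x y d = RatFunc.C (a (T.face d)))
    {u v w : V} (huv : u ≠ v) (huw : u ≠ w) (hvw : v ≠ w) : triDet x y u v w ≠ 0 := by
  classical
  let coord : V × Bool → RatFunc ℝ := fun p => if p.2 then y p.1 else x p.1
  let n : V → ℚ := fun v => ((P.v.symm v : ℕ) : ℚ)
  let par : V × Bool → ℚ := fun p => if p.2 then n p.1 ^ 2 - n p.1 else n p.1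
  -- Five coordinates are normalized, in agreement with the parabola; `2 |V| - 5` remain free.
  let fixed : Finset (V × Bool) :=
    {(P.v 0, false), (P.v 0, true), (P.v 1, false), (P.v 1, true), (P.v 2, false)}
  have hn0 : n (P.v 0) = 0 := by simp [n]
  have hn1 : n (P.v 1) = 1 := by
    simp only [n, Equiv.symm_apply_apply]
    exact_mod_cast (Nat.mod_eq_of_lt (by omega) : 1 % (P.m + 4) = 1)
  have hn2 : n (P.v 2) = 2 := by
    simp only [n, Equiv.symm_apply_apply]
    exact_mod_cast (Nat.mod_eq_of_lt (by omega) : 2 % (P.m + 4) = 2)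
  have hfixed : ∀ p ∈ fixed, coord p = ((par p : ℚ) : RatFunc ℝ) := by
    intro p hp
    simp only [fixed, Finset.mem_insert, Finset.mem_singleton] at hp
    rcases hp with rfl | rfl | rfl | rfl | rfl <;>
      simp [coord, par, hx0, hy0, hx1, hy1, hx2, hn0, hn1, hn2]
  let J := {p : V × Bool // p ∉ fixed}
  let t : J → RatFunc ℝ := fun p => coord p.1
  have hcoordmem : ∀ p, coord p ∈ Algebra.adjoin ℚ (Set.range t) := by
    intro p
    by_cases hp : p ∈ fixed
    · rw [hfixed p hp]
      have := (Algebra.adjoin ℚ (Set.range t)).algebraMap_mem (par p)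
      rwa [eq_ratCast] at this
    · exact Algebra.subset_adjoin ⟨⟨p, hp⟩, rfl⟩
  have hxmem : ∀ v, x v ∈ Algebra.adjoin ℚ (Set.range t) := fun v => hcoordmem (v, false)
  have hymem : ∀ v, y v ∈ Algebra.adjoin ℚ (Set.range t) := fun v => hcoordmem (v, true)
  -- The free coordinates generate the `2 |V| - 6` areas and the abscissa of the fourth vertex.
  -- These are as many independent elements as there are coordinates.
  have ht : AlgebraicIndependent ℚ t := by
    refine (algebraicIndependent_option_ratFunc ha s).of_mem_adjoin (fun o => ?_) ?_
    · rcases o with _ | ⟨f, hfa, hfb⟩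
      · have := hxmem (P.v 3)
        rwa [hx3] at this
      · obtain ⟨d, rfl⟩ := T.face_surjective f
        change RatFunc.C (a (T.face d)) ∈ _
        rw [← harea d hfa hfb, faceDet, triDet_eq]
        exact sub_mem (mul_mem (sub_mem (hxmem _) (hxmem _)) (sub_mem (hymem _) (hymem _)))
          (mul_mem (sub_mem (hxmem _) (hxmem _)) (sub_mem (hymem _) (hymem _)))
    · have h1 := Nat.card_congr (Equiv.ofBijective _ (bijective_option_elim_ne hab))
      have h2 := Nat.card_subtype_ne_add_one fb
      have h3 := hT.card_face
      have h4 : Nat.card J = 2 * Nat.card V - 5 := by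
        have : Fintype V := Fintype.ofFinite V
        rw [Nat.card_eq_fintype_card, Fintype.card_subtype_compl, Fintype.card_prod,
          Fintype.card_bool, Nat.card_eq_fintype_card, mul_comm]
        congr 1
        rw [Fintype.card_coe]
        have n01 : P.v 0 ≠ P.v 1 := fun h => by rw [h, hn1] at hn0; norm_num at hn0
        have n02 : P.v 0 ≠ P.v 2 := fun h => by rw [h, hn2] at hn0; norm_num at hn0
        have n12 : P.v 1 ≠ P.v 2 := fun h => by rw [h, hn2] at hn1; norm_num at hn1
        simp [fixed, n01, n02, n12]
      rw [h1]
      omega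
  let g : V × Bool → MvPolynomial J ℚ := fun p =>
    if h : p ∈ fixed then MvPolynomial.C (par p) else MvPolynomial.X ⟨p, h⟩
  have hg1 : ∀ p, MvPolynomial.aeval t (g p) = coord p := by
    intro p
    by_cases h : p ∈ fixed
    · simp only [g, dif_pos h, hfixed p h]
      simp
    · simp only [g, dif_neg h, MvPolynomial.aeval_X, t]
  have hg2 : ∀ p, MvPolynomial.eval (fun p : J => par p.1) (g p) = par p := by
    intro p
    by_cases h : p ∈ fixed
    · simp only [g, dif_pos h, MvPolynomial.eval_C]
    · simp only [g, dif_neg h, MvPolynomial.eval_X]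
  let D := triDet (fun v => g (v, false)) (fun v => g (v, true)) u v w
  have hD1 : MvPolynomial.aeval t D = triDet x y u v w := by
    have := map_triDet (MvPolynomial.aeval t : MvPolynomial J ℚ →ₐ[ℚ] _).toRingHom
      (fun v => g (v, false)) (fun v => g (v, true)) u v w
    refine this.trans ?_
    have e1 : (fun v => (MvPolynomial.aeval t : MvPolynomial J ℚ →ₐ[ℚ] _).toRingHom
      (g (v, false))) = x := funext fun v => hg1 (v, false)
    have e2 : (fun v => (MvPolynomial.aeval t : MvPolynomial J ℚ →ₐ[ℚ] _).toRingHom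
      (g (v, true))) = y := funext fun v => hg1 (v, true)
    rw [e1, e2]
  have hninj : ∀ {u v}, u ≠ v → n v - n u ≠ 0 := by
    intro u v huv h
    refine huv (P.v.symm.injective (Fin.ext ?_))
    have : ((P.v.symm u : ℕ) : ℚ) = (P.v.symm v : ℕ) := (sub_eq_zero.mp h).symm
    exact_mod_cast this
  -- Evaluate the determinant polynomial at the placement on the parabola.
  have hD2 : D ≠ 0 := by
    intro h
    have h1 := map_triDet (MvPolynomial.eval (fun p : J => par p.1))
      (fun v => g (v, false)) (fun v => g (v, true)) u v w
    have e0 : triDet (fun v => g (v, false)) (fun v => g (v, true)) u v w = 0 := h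
    simp only [hg2, e0, map_zero] at h1
    have h2 := triDet_parabola n u v w
    have h3 : triDet n (fun v => n v ^ 2 - n v) u v w = 0 := h1.symm
    rw [h3] at h2
    exact mul_ne_zero (mul_ne_zero (hninj huv) (hninj huw)) (hninj hvw) h2.symm
  rw [← hD1]
  intro h
  exact hD2 (ht (by rw [h, map_zero]))

end PlaneGraph

/-! ### Descent of the coordinates and the last face. -/

namespace PlaneGraph

variable {V : Type*} {G : SimpleGraph V} {T : PlaneGraph G}

theorem _root_.POrder.Unoriented.not_mem_triangle {P : POrder G} {e : G.Dart}
    (he : P.Unoriented e) {u v w : V} (huv : P.OrientedAdj u v) (hvw : P.OrientedAdj v w)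
    (hwu : P.OrientedAdj w u) :
    ¬((e.fst = u ∨ e.fst = v ∨ e.fst = w) ∧ (e.snd = u ∨ e.snd = v ∨ e.snd = w)) := by
  have hne := e.fst_ne_snd
  have hno := he.not_orientedAdj
  rintro ⟨h1, h2⟩
  rcases h1 with h1 | h1 | h1 <;> rcases h2 with h2 | h2 | h2 <;> rw [h1, h2] at hne hno
  · exact hne rfl
  · exact hno huv
  · exact hno hwu.symm
  · exact hno huv.symm
  · exact hne rfl
  · exact hno hvw
  · exact hno hwu
  · exact hno hvw.symm
  · exact hne rfl

theorem _root_.POrder.orientedAdj_two_one (P : POrder G) : P.OrientedAdj (P.v 0) (P.v 1) :=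
  Or.inr (by rw [P.pred_two]; rfl)

theorem _root_.POrder.orientedAdj_three (P : POrder G) {i : Fin (P.m + 4)} (hi : i = 2 ∨ i = 3)
    {j : Fin (P.m + 4)} (hj : j = 0 ∨ j = 1) : P.OrientedAdj (P.v i) (P.v j) := by
  refine Or.inl ?_
  rcases hi with rfl | rfl <;> rcases hj with rfl | rfl <;> simp [P.pred_three, P.pred_four]

/-- The area is a rational combination of face areas in which the two faces at `e` do not occur,
although the triangle itself need not be a face. -/
theorem IsTriangulation.triDet_mem (hT : T.IsTriangulation) [Finite V] {P : POrder G}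
    {e : G.Dart} (he : P.Unoriented e) {K : Type} [Field K] [CharZero K] {S : Subfield K}
    {x y : V → K} (hS : ∀ d, T.face d ≠ T.face e → T.face d ≠ T.face e.symm →
      T.faceDet x y d ∈ S)
    {u v w : V} (huv : P.OrientedAdj u v) (hvw : P.OrientedAdj v w) (hwu : P.OrientedAdj w u) :
    triDet x y u v w ∈ S := by
  have : Fintype G.Dart := Fintype.ofFinite _
  obtain ⟨c, hc1, hc2, -, hc⟩ := hT.exists_triDet_eq huv.adj hvw.adj hwu.adj
    (he.not_mem_triangle huv hvw hwu)
  have h := hc x y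
  have h3 : (3 : K) ∈ S := ofNat_mem S 3
  have hmem : 3 * triDet x y u v w ∈ S := by
    rw [h]
    refine sum_mem fun d _ => ?_
    by_cases h1 : T.face d = T.face e
    · rw [h1, hc1, Rat.cast_zero, zero_mul]; exact zero_mem S
    by_cases h2 : T.face d = T.face e.symm
    · rw [h2, hc2, Rat.cast_zero, zero_mul]; exact zero_mem S
    exact mul_mem (SubfieldClass.ratCast_mem S _) (hS d h1 h2)
  have := mul_mem (inv_mem h3) hmem
  rwa [inv_mul_cancel_left₀ (by norm_num)] at this

/-- Cramer's rule: a point is determined by the areas of two triangles. -/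
theorem mem_of_triDet_mem {K : Type*} [Field K] {S : Subfield K} {x y : V → K} {u₁ u₂ u₃ v : V}
    (hx₁ : x u₁ ∈ S) (hy₁ : y u₁ ∈ S) (hx₂ : x u₂ ∈ S) (hy₂ : y u₂ ∈ S) (hx₃ : x u₃ ∈ S)
    (hy₃ : y u₃ ∈ S) (h₁ : triDet x y u₁ u₂ v ∈ S) (h₂ : triDet x y u₂ u₃ v ∈ S)
    (hD : triDet x y u₁ u₂ u₃ ≠ 0) : x v ∈ S ∧ y v ∈ S := by
  have hDS : triDet x y u₁ u₂ u₃ ∈ S := by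
    rw [triDet_eq]
    exact sub_mem (mul_mem (sub_mem hx₂ hx₁) (sub_mem hy₃ hy₁))
      (mul_mem (sub_mem hx₃ hx₁) (sub_mem hy₂ hy₁))
  have key : ∀ z : V → K, z u₁ ∈ S → z u₂ ∈ S → z u₃ ∈ S →
      z v * triDet x y u₁ u₂ u₃ = z u₂ * triDet x y u₁ u₂ u₃ +
        triDet x y u₁ u₂ v * (z u₃ - z u₂) - triDet x y u₂ u₃ v * (z u₂ - z u₁) → z v ∈ S := by
    intro z h1 h2 h3 h
    rw [← eq_div_iff hD] at h
    rw [h]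
    exact div_mem (sub_mem (add_mem (mul_mem h2 hDS) (mul_mem h₁ (sub_mem h3 h2)))
      (mul_mem h₂ (sub_mem h2 h1))) hDS
  refine ⟨key x hx₁ hx₂ hx₃ ?_, key y hy₁ hy₂ hy₃ ?_⟩ <;> simp only [triDet_eq] <;> ring

/-- Induction along the `P`-order: the heights of the third and fourth vertex are areas over the
base of length 1, and a later vertex is found from two triangles over its path of predecessors. -/
theorem IsTriangulation.coord_mem (hT : T.IsTriangulation) [Finite V] {P : POrder G}
    {e : G.Dart} (he : P.Unoriented e) {K : Type} [Field K] [CharZero K] {S : Subfield K}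
    {x y : V → K} (hS : ∀ d, T.face d ≠ T.face e → T.face d ≠ T.face e.symm →
      T.faceDet x y d ∈ S)
    (hx0 : x (P.v 0) = 0) (hy0 : y (P.v 0) = 0) (hx1 : x (P.v 1) = 1) (hy1 : y (P.v 1) = 0)
    (hx2 : x (P.v 2) ∈ S) (hx3 : x (P.v 3) ∈ S)
    (hD : ∀ u v w, u ≠ v → u ≠ w → v ≠ w → triDet x y u v w ≠ 0) (v : V) :
    x v ∈ S ∧ y v ∈ S := by
  have hy : ∀ i : Fin (P.m + 4), i = 2 ∨ i = 3 → y (P.v i) ∈ S := by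
    intro i hi
    have h := hT.triDet_mem he hS P.orientedAdj_two_one
      (P.orientedAdj_three hi (Or.inr rfl)).symm (P.orientedAdj_three hi (Or.inl rfl))
    rw [triDet_eq, hx0, hy0, hx1, hy1] at h
    simpa using h
  obtain ⟨i, rfl⟩ := P.v.surjective v
  induction i using WellFoundedLT.induction with
  | ind i ih =>
    by_cases hi : 3 < i
    · obtain ⟨u₁, h₁, u₂, h₂, u₃, h₃, hne, h12, h23⟩ := P.exists_path_pred T hi
      have hmem : ∀ u ∈ P.pred (P.v i), x u ∈ S ∧ y u ∈ S := by
        intro u hu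
        have hlt := P.pred_lt _ u hu
        rw [P.v.symm_apply_apply] at hlt
        have := ih _ hlt
        rwa [P.v.apply_symm_apply] at this
      exact mem_of_triDet_mem (hmem _ h₁).1 (hmem _ h₁).2 (hmem _ h₂).1 (hmem _ h₂).2
        (hmem _ h₃).1 (hmem _ h₃).2
        (hT.triDet_mem he hS h12 (Or.inr h₂) (Or.inl h₁))
        (hT.triDet_mem he hS h23 (Or.inr h₃) (Or.inl h₂))
        (hD _ _ _ h12.adj.ne hne h23.adj.ne)
    · have hval : ∀ k : ℕ, k < 4 → k % (P.m + 4) = k := fun k hk =>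
        Nat.mod_eq_of_lt (by omega)
      have hi' : (i : ℕ) ≤ 3 % (P.m + 4) := not_lt.mp hi
      rw [hval 3 (by omega)] at hi'
      have hcases : i = 0 ∨ i = 1 ∨ i = 2 ∨ i = 3 := by
        have h0 : i = 0 ↔ (i : ℕ) = 0 % (P.m + 4) := Fin.ext_iff
        have h1 : i = 1 ↔ (i : ℕ) = 1 % (P.m + 4) := Fin.ext_iff
        have h2 : i = 2 ↔ (i : ℕ) = 2 % (P.m + 4) := Fin.ext_iff
        have h3 : i = 3 ↔ (i : ℕ) = 3 % (P.m + 4) := Fin.ext_iff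
        rw [h0, h1, h2, h3, hval 0 (by omega), hval 1 (by omega), hval 2 (by omega),
          hval 3 (by omega)]
        omega
      rcases hcases with rfl | rfl | rfl | rfl
      · rw [hx0, hy0]; exact ⟨zero_mem S, zero_mem S⟩
      · rw [hx1, hy1]; exact ⟨one_mem S, zero_mem S⟩
      · exact ⟨hx2, hy 2 (Or.inl rfl)⟩
      · exact ⟨hx3, hy 3 (Or.inr rfl)⟩

/-- The heights of the third and fourth vertex are real constants; the one of the third vertex does
not vanish. -/
theorem IsTriangulation.triDet_eq_C (hT : T.IsTriangulation) [Finite V] {P : POrder G}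
    {e : G.Dart} (he : P.Unoriented e) {a : T.Face → ℝ} (ha : IsGenericZeroSum a)
    {x y : V → RatFunc ℝ} (harea : ∀ d, T.face d ≠ T.face e → T.face d ≠ T.face e.symm →
      T.faceDet x y d = RatFunc.C (a (T.face d)))
    {u v w : V} (huv : P.OrientedAdj u v) (hvw : P.OrientedAdj v w) (hwu : P.OrientedAdj w u) :
    ∃ κ : ℝ, κ ≠ 0 ∧ triDet x y u v w = RatFunc.C κ := by
  classical
  have : Fintype G.Dart := Fintype.ofFinite _
  have : Fintype T.Face := Fintype.ofFinite _
  obtain ⟨c, hc1, hc2, ⟨f, hf⟩, hc⟩ := hT.exists_triDet_eq huv.adj hvw.adj hwu.adj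
    (he.not_mem_triangle huv hvw hwu)
  refine ⟨∑ f, (c f : ℝ) * a f, ?_, ?_⟩
  -- The areas are linearly independent over `ℚ` and some coefficient is nonzero.
  · intro h0
    have hlin := (ha.algebraicIndependent (T.face e)).linearIndependent
    rw [Fintype.linearIndependent_iff] at hlin
    have hne : f ≠ T.face e := fun h => hf (h ▸ hc1)
    refine hf (hlin (fun f => c f.1) ?_ ⟨f, hne⟩)
    rw [← Finset.add_sum_erase _ _ (Finset.mem_univ (T.face e)), hc1, Rat.cast_zero, zero_mul,
      zero_add] at h0
    rw [← h0, ← Finset.sum_subtype (Finset.univ.erase (T.face e)) (fun f => by simp)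
      (fun f => c f • a f)]
    exact Finset.sum_congr rfl fun f _ => Rat.smul_def _ _
  · have h := hc x y
    have h2 : ∀ d, ((c (T.face d) : ℚ) : RatFunc ℝ) * T.faceDet x y d =
        RatFunc.C ((c (T.face d) : ℝ) * a (T.face d)) := by
      intro d
      by_cases h1 : T.face d = T.face e
      · rw [h1, hc1]; simp
      by_cases h2 : T.face d = T.face e.symm
      · rw [h2, hc2]; simp
      rw [harea d h1 h2, map_mul, map_ratCast]
    simp only [h2] at h
    rw [← map_sum, hT.sum_face (fun f => (c f : ℝ) * a f), map_mul, map_ofNat] at h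
    exact mul_left_cancel₀ (by norm_num) h

theorem _root_.RatFunc.eval₂_C_comp {K : Type*} [Field K] (τ : K →+* ℝ) (s : ℝ) (R : K[X]) :
    R.eval₂ ((RatFunc.C : ℝ →+* RatFunc ℝ).comp τ) (RatFunc.X + RatFunc.C s) =
      algebraMap ℝ[X] (RatFunc ℝ) ((R.map τ).comp (Polynomial.X + Polynomial.C s)) := by
  have h1 : (RatFunc.X + RatFunc.C s : RatFunc ℝ) =
      algebraMap ℝ[X] (RatFunc ℝ) (Polynomial.X + Polynomial.C s) := by simp
  have h2 : (RatFunc.C : ℝ →+* RatFunc ℝ).comp τ =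
      (algebraMap ℝ[X] (RatFunc ℝ)).comp (Polynomial.C.comp τ) := by
    ext; simp
  rw [h1, h2, ← Polynomial.hom_eval₂, ← Polynomial.eval₂_map]
  rfl

/-- Cancelling common factors and a real translation do not change the parity of the max-degree. -/
theorem odd_max_natDegree {K : Type*} [Field K] (τ : K →+* ℝ) (s : ℝ) {P Q : K[X]}
    (hcop : IsCoprime P Q) (hQ : Q ≠ 0) {p q : ℝ[X]} (hq : q ≠ 0) (hcrr : CRR p q)
    (hodd : Odd (maxDegree p q))
    (h : algebraMap ℝ[X] (RatFunc ℝ) p / algebraMap ℝ[X] (RatFunc ℝ) q =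
      algebraMap ℝ[X] (RatFunc ℝ) ((P.map τ).comp (Polynomial.X + Polynomial.C s)) /
      algebraMap ℝ[X] (RatFunc ℝ) ((Q.map τ).comp (Polynomial.X + Polynomial.C s))) :
    Odd (max P.natDegree Q.natDegree) := by
  set P₁ := (P.map τ).comp (Polynomial.X + Polynomial.C s) with hP₁
  set Q₁ := (Q.map τ).comp (Polynomial.X + Polynomial.C s) with hQ₁
  have hcop₁ : IsCoprime P₁ Q₁ := by
    have h1 := hcop.map (Polynomial.mapRingHom τ)
    exact h1.map (Polynomial.compRingHom (Polynomial.X + Polynomial.C s))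
  have hQ₁0 : Q₁ ≠ 0 := by
    rw [hQ₁, Ne, Polynomial.comp_X_add_C_eq_zero_iff, Polynomial.map_eq_zero]
    exact hQ
  have hdeg : ∀ R : K[X], ((R.map τ).comp (Polynomial.X + Polynomial.C s)).natDegree =
      R.natDegree := by
    intro R
    rw [Polynomial.natDegree_comp, Polynomial.natDegree_X_add_C, mul_one,
      Polynomial.natDegree_map]
  rw [div_eq_div_iff (RatFunc.algebraMap_ne_zero hq) (RatFunc.algebraMap_ne_zero hQ₁0),
    ← map_mul, ← map_mul] at h
  have h' := RatFunc.algebraMap_injective ℝ h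
  obtain ⟨g, hg⟩ : Q₁ ∣ q := hcop₁.symm.dvd_of_dvd_mul_left ⟨p, by rw [← h', mul_comm]⟩
  have hpg : p = P₁ * g := by
    rw [hg] at h'
    exact mul_right_cancel₀ hQ₁0 (by rw [h']; ring)
  have hg0 : g ≠ 0 := by
    rintro rfl
    rw [mul_zero] at hg
    exact hq hg
  -- A common factor of odd degree would have a real root, common to `p` and `q`.
  have hgeven : Even g.natDegree := by
    rw [← Nat.not_odd_iff_even]
    intro hodd
    obtain ⟨z, hz⟩ := Polynomial.exists_isRoot_of_odd_natDegree hodd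
    refine hcrr z ⟨?_, ?_⟩
    · rw [hpg, Polynomial.IsRoot, Polynomial.eval_mul, hz.eq_zero, mul_zero]
    · rw [hg, Polynomial.IsRoot, Polynomial.eval_mul, hz.eq_zero, mul_zero]
  have hmax : maxDegree p q = max P.natDegree Q.natDegree + g.natDegree := by
    rw [maxDegree, hg, Polynomial.natDegree_mul hQ₁0 hg0, hQ₁, hdeg, hpg]
    by_cases hP0 : P₁ = 0
    · have hPd : P.natDegree = 0 := by rw [← hdeg, ← hP₁, hP0, Polynomial.natDegree_zero]
      rw [hP0, zero_mul, Polynomial.natDegree_zero, hPd]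
      simp
    · rw [Polynomial.natDegree_mul hP0 hg0, hP₁, hdeg]
      omega
  rw [hmax] at hodd
  by_contra hnot
  rw [Nat.not_odd_iff_even] at hnot
  exact Nat.not_odd_iff_even.mpr (hnot.add hgeven) hodd

/-- If the last face function for one generic choice of areas is coprime with odd max-degree, then
every generic choice of areas is realized by the signed areas of some vertex placement. -/
theorem IsTriangulation.exists_faceDet_eq (hT : T.IsTriangulation) [Finite V] {P : POrder G}
    {a : T.Face → ℝ} (ha : IsGenericZeroSum a) {e : G.Dart} (he : P.Unoriented e)
    {x₃ : ℝ} {x y : V → RatFunc ℝ}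
    (hx0 : x (P.v 0) = 0) (hy0 : y (P.v 0) = 0) (hx1 : x (P.v 1) = 1) (hy1 : y (P.v 1) = 0)
    (hx2 : x (P.v 2) = RatFunc.C x₃) (hx3 : x (P.v 3) = RatFunc.X)
    (harea : ∀ d, T.face d ≠ T.face e → T.face d ≠ T.face e.symm →
      T.faceDet x y d = RatFunc.C (a (T.face d)))
    {p q : ℝ[X]} (hq : q ≠ 0)
    (hpq : T.faceDet x y e = algebraMap ℝ[X] (RatFunc ℝ) p / algebraMap ℝ[X] (RatFunc ℝ) q)
    (hcrr : CRR p q) (hodd : Odd (maxDegree p q))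
    {a' : T.Face → ℝ} (ha' : IsGenericZeroSum a') :
    ∃ X Y : V → ℝ, ∀ d, T.faceDet X Y d = a' (T.face d) := by
  have hab : T.face e ≠ T.face e.symm := (hT.face_symm_ne e).symm
  -- normalization by a shear
  obtain ⟨κ, hκ, hyκ⟩ := hT.triDet_eq_C he ha harea P.orientedAdj_two_one
      (P.orientedAdj_three (Or.inl rfl) (Or.inr rfl)).symm
      (P.orientedAdj_three (Or.inl rfl) (Or.inl rfl))
  obtain ⟨κ', -, hyκ'⟩ := hT.triDet_eq_C he ha harea P.orientedAdj_two_one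
      (P.orientedAdj_three (Or.inr rfl) (Or.inr rfl)).symm
      (P.orientedAdj_three (Or.inr rfl) (Or.inl rfl))
  rw [triDet_eq, hx0, hy0, hx1, hy1] at hyκ hyκ'
  simp only [sub_zero, one_mul, mul_zero] at hyκ hyκ'
  -- The constant `x₃` need not lie in the field generated by the areas. The shear moves it to 2,
  -- the value on the parabola, keeps all determinants and shifts `x₄` by a constant.
  let r : ℝ := (2 - x₃) / κ
  let x' : V → RatFunc ℝ := fun v => x v + RatFunc.C r * y v
  have htri : ∀ u v w, triDet x' y u v w = triDet x y u v w := by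
    intro u v w
    simp only [triDet_eq, x']
    ring
  have hface : ∀ d, T.faceDet x' y d = T.faceDet x y d := fun d => htri _ _ _
  have hx0' : x' (P.v 0) = 0 := by simp [x', hx0, hy0]
  have hx1' : x' (P.v 1) = 1 := by simp [x', hx1, hy1]
  have hx2' : x' (P.v 2) = 2 := by
    simp only [x', hx2, hyκ, r]
    rw [← map_mul, ← map_add, div_mul_cancel₀ _ hκ, add_sub_cancel, map_ofNat]
  have hx3' : x' (P.v 3) = RatFunc.X + RatFunc.C (r * κ') := by
    simp only [x', hx3, hyκ', map_mul]
  set s := r * κ'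
  have harea' : ∀ d, T.face d ≠ T.face e → T.face d ≠ T.face e.symm →
      T.faceDet x' y d = RatFunc.C (a (T.face d)) := fun d h h' => (hface d).trans (harea d h h')
  -- the field generated by the areas
  obtain ⟨τ, hτ, -⟩ := exists_ringHom_of_algebraicIndependent_option (ha.option hab)
  obtain ⟨τ', hτ', htrans⟩ := exists_ringHom_of_algebraicIndependent_option (ha'.option hab)
  -- Here `ι` embeds `K(t)` into the rational functions by `t ↦ x₄ + s`, with `K` realized by the
  -- given areas.
  obtain ⟨ι, hι⟩ := RatFunc.exists_ringHom ((RatFunc.C : ℝ →+* RatFunc ℝ).comp τ)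
    (RatFunc.X + RatFunc.C s) (fun R hR => by
      rw [RatFunc.eval₂_C_comp, map_eq_zero_iff _ (RatFunc.algebraMap_injective ℝ),
        Polynomial.comp_X_add_C_eq_zero_iff, Polynomial.map_eq_zero] at hR
      exact hR)
  let gen : {f // f ≠ T.face e ∧ f ≠ T.face e.symm} →
      FractionRing (MvPolynomial {f // f ≠ T.face e ∧ f ≠ T.face e.symm} ℚ) :=
    fun j => algebraMap (MvPolynomial {f // f ≠ T.face e ∧ f ≠ T.face e.symm} ℚ) _
      (MvPolynomial.X j)
  have hιC : ∀ k, ι (algebraMap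
      (FractionRing (MvPolynomial {f // f ≠ T.face e ∧ f ≠ T.face e.symm} ℚ))[X] (RatFunc _)
      (Polynomial.C k)) = RatFunc.C (τ k) := by
    intro k
    rw [hι, Polynomial.eval₂_C]; rfl
  have hιX : ι (algebraMap
      (FractionRing (MvPolynomial {f // f ≠ T.face e ∧ f ≠ T.face e.symm} ℚ))[X] (RatFunc _)
      Polynomial.X) = RatFunc.X + RatFunc.C s := by
    rw [hι, Polynomial.eval₂_X]
  -- descent of the coordinates
  have hcoord := hT.coord_mem he (S := ι.fieldRange) (x := x') (y := y) (fun d h h' => by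
      rw [harea' d h h']
      exact ⟨_, (hιC (gen ⟨T.face d, h, h'⟩)).trans (congrArg RatFunc.C (hτ _))⟩)
    hx0' hy0 hx1' hy1 (hx2' ▸ ofNat_mem _ 2) (hx3' ▸ ⟨_, hιX⟩)
    (fun u v w huv huw hvw => hT.triDet_ne_zero P hab
      ((ha.option hab).comp some (Option.some_injective _)) hx0' hy0 hx1' hy1 hx2' hx3' harea'
      huv huw hvw)
  choose ξ hξ using fun v => (hcoord v).1
  choose η hη using fun v => (hcoord v).2
  have hιdet : ∀ d, ι (T.faceDet ξ η d) = T.faceDet x y d := by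
    intro d
    rw [map_faceDet, ← hface]
    congr 1
    · exact funext hξ
    · exact funext hη
  -- the last face function over the field generated by the areas
  set f₀ := T.faceDet ξ η e with hf₀
  have hf₀' : algebraMap ℝ[X] (RatFunc ℝ) p / algebraMap ℝ[X] (RatFunc ℝ) q =
      algebraMap ℝ[X] (RatFunc ℝ) ((f₀.num.map τ).comp (Polynomial.X + Polynomial.C s)) /
      algebraMap ℝ[X] (RatFunc ℝ) ((f₀.denom.map τ).comp (Polynomial.X + Polynomial.C s)) := by
    rw [← hpq, ← hιdet e, ← hf₀, ← RatFunc.eval₂_C_comp, ← RatFunc.eval₂_C_comp, ← hι, ← hι,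
      ← map_div₀, RatFunc.num_div_denom]
  have hodd₀ := odd_max_natDegree τ s (RatFunc.isCoprime_num_denom f₀) (RatFunc.denom_ne_zero f₀)
    hq hcrr hodd hf₀'
  obtain ⟨z, hz, hz0, hzeq⟩ := exists_transcendental_eval₂_eq τ'
    (RatFunc.isCoprime_num_denom f₀) hodd₀ htrans
  -- Evaluation at `z` over the new areas. It is defined on all of `K(t)` because `z` is
  -- transcendental.
  obtain ⟨θ, hθ⟩ := RatFunc.exists_ringHom τ' z hz
  have hθdet : ∀ d, T.faceDet (fun v => θ (ξ v)) (fun v => θ (η v)) d = θ (T.faceDet ξ η d) :=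
    fun d => (map_faceDet T θ ξ η d).symm
  have hinner : ∀ d, T.face d ≠ T.face e → T.face d ≠ T.face e.symm →
      T.faceDet (fun v => θ (ξ v)) (fun v => θ (η v)) d = a' (T.face d) := by
    intro d h h'
    have h1 : T.faceDet ξ η d = algebraMap
        (FractionRing (MvPolynomial {f // f ≠ T.face e ∧ f ≠ T.face e.symm} ℚ))[X] (RatFunc _)
        (Polynomial.C (gen ⟨T.face d, h, h'⟩)) := by
      apply ι.injective
      rw [hιdet, harea d h h', hιC]
      exact congrArg RatFunc.C (hτ ⟨T.face d, h, h'⟩).symm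
    rw [hθdet, h1, hθ, Polynomial.eval₂_C]
    exact hτ' ⟨T.face d, h, h'⟩
  have hlast : T.faceDet (fun v => θ (ξ v)) (fun v => θ (η v)) e = a' (T.face e) := by
    rw [hθdet, ← hf₀, ← RatFunc.num_div_denom f₀, map_div₀, hθ, hθ, hzeq]
    exact mul_div_cancel_right₀ _ hz0
  refine ⟨fun v => θ (ξ v), fun v => θ (η v), ?_⟩
  -- the remaining face
  have : Fintype G.Dart := Fintype.ofFinite _
  have : Fintype T.Face := Fintype.ofFinite _
  generalize (fun v => θ (ξ v)) = X at *
  generalize (fun v => θ (η v)) = Y at *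
  have hne : ∀ d, T.face d ≠ T.face e.symm → T.faceDet X Y d = a' (T.face d) := by
    intro d h'
    by_cases h : T.face d = T.face e
    · rw [hT.faceDet_eq_of_face_eq X Y h, hlast, h]
    · exact hinner d h h'
  have hsum := hT.sum_faceDet X Y
  have hsum' := hT.sum_face a'
  rw [← finsum_eq_sum_of_fintype a', ha'.sum_eq_zero, mul_zero] at hsum'
  have hdiff : ∑ d, (T.faceDet X Y d - a' (T.face d)) = 0 := by
    rw [Finset.sum_sub_distrib, hsum, hsum', sub_zero]
  let k : T.Face → ℝ := Quotient.lift (fun d => T.faceDet X Y d - a' (T.face d)) (fun d d' h => by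
    have h' : T.face d = T.face d' := (RotationSystem.face_eq_iff _).mpr h
    simp only [hT.faceDet_eq_of_face_eq X Y h', h'])
  have hk : ∀ d, k (T.face d) = T.faceDet X Y d - a' (T.face d) := fun d => rfl
  simp only [← hk] at hdiff
  rw [hT.sum_face k, Finset.sum_eq_single (T.face e.symm)] at hdiff
  · have hk0 : k (T.face e.symm) = 0 := by linarith
    intro d
    by_cases h : T.face d = T.face e.symm
    · have := hk d
      rw [h, hk0] at this
      rw [h]
      linarith
    · exact hne d h
  · intro f _ hf
    obtain ⟨d, rfl⟩ := T.face_surjective f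
    rw [hk, hne d hf, sub_self]
  · simp

end PlaneGraph

/-! ### Orientation, winding numbers and cones in the plane. -/

/-- The cross product of two vectors in the plane. -/
def crossProd (u w : ℂ) : ℝ := u.re * w.im - u.im * w.re

/-- Twice the signed area of the triangle `a b c`. -/
def orient (a b c : ℂ) : ℝ := crossProd (b - a) (c - a)

theorem crossProd_add (u w w' : ℂ) : crossProd u (w + w') = crossProd u w + crossProd u w' := by
  simp [crossProd]; ring

theorem crossProd_ofReal_mul (u w : ℂ) (t : ℝ) : crossProd u (t * w) = t * crossProd u w := by
  simp [crossProd]; ring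

theorem crossProd_swap (u w : ℂ) : crossProd u w = -crossProd w u := by
  simp only [crossProd]; ring

theorem crossProd_self (u : ℂ) : crossProd u u = 0 := by
  simp only [crossProd]; ring

theorem crossProd_neg_left (u w : ℂ) : crossProd (-u) w = -crossProd u w := by
  simp [crossProd]; ring

theorem orient_swap (a b c : ℂ) : orient b a c = -orient a b c := by
  simp [orient, crossProd]; ring

theorem orient_rotate (a b c : ℂ) : orient b c a = orient a b c := by
  simp [orient, crossProd]; ring

theorem orient_self_left (a b : ℂ) : orient a b a = 0 := by
  simp [orient, crossProd]

theorem orient_self_right (a b : ℂ) : orient a b b = 0 := by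
  simp [orient, crossProd]; ring

theorem orient_add (a b z w : ℂ) : orient a b (z + w) = orient a b z + crossProd (b - a) w := by
  simp [orient, crossProd]; ring

theorem orient_combo (a b z w : ℂ) {s t : ℝ} (h : s + t = 1) :
    orient a b (s • z + t • w) = s * orient a b z + t * orient a b w := by
  obtain rfl : t = 1 - s := by linarith
  simp [orient, crossProd]; ring

/-- The signed crossing of the segment from `a` to `b` with the upward ray from `z`. -/
noncomputable def rayCrossing (z a b : ℂ) : ℤ :=
  if 0 < a.re - z.re ∧ b.re - z.re ≤ 0 ∧ 0 < orient a b z then 1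
  else if a.re - z.re ≤ 0 ∧ 0 < b.re - z.re ∧ orient a b z < 0 then -1 else 0

theorem rayCrossing_swap (z a b : ℂ) : rayCrossing z b a = -rayCrossing z a b := by
  unfold rayCrossing
  rw [orient_swap]
  by_cases h1 : 0 < a.re - z.re <;> by_cases h2 : 0 < b.re - z.re <;>
    rcases lt_trichotomy (orient a b z) 0 with h3 | h3 | h3 <;>
    simp [h1, h2, h3, not_lt.mp, le_of_lt, not_le.mpr, not_lt.mpr, -sub_pos]

/-- The winding number of a triangle in terms of signs: `A`, `B`, `C` are the abscissae of the
corners relative to `z`, and `β`, `γ`, `α` are their unnormalized barycentric weights. The cases are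
the positions of the corners relative to the vertical line through `z`; a corner on the line counts
as left. -/
theorem sum_sign_mem {A B C α β γ : ℝ} (h : α * C + β * A + γ * B = 0) (hs : 0 < α + β + γ)
    (h0 : A = 0 → B = 0 → α = 0) {n : ℤ}
    (hn : n = (if 0 < A ∧ B ≤ 0 ∧ 0 < α then 1 else if A ≤ 0 ∧ 0 < B ∧ α < 0 then -1 else 0) +
      (if 0 < B ∧ C ≤ 0 ∧ 0 < β then 1 else if B ≤ 0 ∧ 0 < C ∧ β < 0 then -1 else 0) +
      (if 0 < C ∧ A ≤ 0 ∧ 0 < γ then 1 else if C ≤ 0 ∧ 0 < A ∧ γ < 0 then -1 else 0)) :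
    0 ≤ n ∧ n ≤ 1 ∧ (0 < α → 0 < β → 0 < γ → n = 1) ∧ (n ≠ 0 → 0 ≤ α ∧ 0 ≤ β ∧ 0 ≤ γ) := by
  -- Exactly one corner, or in `two` exactly two, to the right of the line.
  have one : ∀ {A B C α β γ : ℝ}, α * C + β * A + γ * B = 0 → 0 < α + β + γ → 0 < A → B ≤ 0 →
      C ≤ 0 → (γ < 0 → 0 < α) ∧ (0 < α → 0 ≤ γ → 0 ≤ β) := by
    intro A B C α β γ h hs hA hB hC
    refine ⟨fun hγ => ?_, fun hα hγ => ?_⟩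
    · by_contra! hα
      have hβ : 0 < β := by linarith
      nlinarith [mul_pos hβ hA, mul_nonneg_of_nonpos_of_nonpos hα hC,
        mul_nonneg_of_nonpos_of_nonpos hγ.le hB]
    · by_contra! hβ
      nlinarith [mul_pos (neg_pos.mpr hβ) hA, mul_nonneg hα.le (neg_nonneg.mpr hC),
        mul_nonneg hγ (neg_nonneg.mpr hB)]
  have two : ∀ {A B C α β γ : ℝ}, α * C + β * A + γ * B = 0 → 0 < α + β + γ → 0 < A → 0 < B →
      C ≤ 0 → (γ < 0 → 0 < β) ∧ (0 < β → 0 ≤ γ → 0 ≤ α) := by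
    intro A B C α β γ h hs hA hB hC
    refine ⟨fun hγ => ?_, fun hβ hγ => ?_⟩
    · by_contra! hβ
      have hα : 0 < α := by linarith
      nlinarith [mul_nonneg hα.le (neg_nonneg.mpr hC), mul_nonneg (neg_nonneg.mpr hβ) hA.le,
        mul_pos (neg_pos.mpr hγ) hB]
    · by_contra! hα
      nlinarith [mul_pos hβ hA, mul_nonneg hγ hB.le, mul_nonneg_of_nonpos_of_nonpos hα.le hC]
  by_cases hA : 0 < A <;> by_cases hB : 0 < B <;> by_cases hC : 0 < C
  · simp only [hA, hB, hC, not_le.mpr hA, not_le.mpr hB, not_le.mpr hC, true_and, false_and,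
      and_false, if_false, add_zero] at hn
    subst hn
    refine ⟨le_rfl, by norm_num, fun h1 h2 h3 => ?_, by simp⟩
    nlinarith [mul_pos h1 hC, mul_pos h2 hA, mul_pos h3 hB]
  · have hC' := not_lt.mp hC
    obtain ⟨k1, k2⟩ := two h hs hA hB hC'
    simp only [hA, hB, hC, not_le.mpr hA, not_le.mpr hB, hC', true_and, false_and,
      and_false, if_false, zero_add] at hn
    subst hn
    split_ifs with h1 h2 h2
    · exact ⟨by norm_num, by norm_num, fun _ _ h => absurd h2 (by linarith), by simp⟩
    · exact ⟨by norm_num, by norm_num, fun _ _ _ => rfl,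
        fun _ => ⟨k2 h1 (not_lt.mp h2), h1.le, not_lt.mp h2⟩⟩
    · exact absurd (k1 h2) h1
    · exact ⟨by norm_num, by norm_num, fun _ h _ => absurd h h1, by simp⟩
  · have hB' := not_lt.mp hB
    obtain ⟨k1, k2⟩ := two (A := C) (B := A) (C := B) (α := γ) (β := α) (γ := β)
      (by linarith) (by linarith) hC hA hB'
    simp only [hA, hB, hC, not_le.mpr hA, not_le.mpr hC, hB', true_and, false_and,
      and_false, if_false, add_zero] at hn
    subst hn
    split_ifs with h1 h2 h2
    · exact ⟨by norm_num, by norm_num, fun _ h _ => absurd h2 (by linarith), by simp⟩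
    · exact ⟨by norm_num, by norm_num, fun _ _ _ => rfl,
        fun _ => ⟨h1.le, not_lt.mp h2, k2 h1 (not_lt.mp h2)⟩⟩
    · exact absurd (k1 h2) h1
    · exact ⟨by norm_num, by norm_num, fun h _ _ => absurd h h1, by simp⟩
  · have hB' := not_lt.mp hB
    have hC' := not_lt.mp hC
    obtain ⟨k1, k2⟩ := one h hs hA hB' hC'
    simp only [hA, hB, hC, not_le.mpr hA, hB', hC', true_and, false_and,
      and_false, if_false, add_zero] at hn
    subst hn
    split_ifs with h1 h2 h2
    · exact ⟨by norm_num, by norm_num, fun _ _ h => absurd h2 (by linarith), by simp⟩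
    · exact ⟨by norm_num, by norm_num, fun _ _ _ => rfl,
        fun _ => ⟨h1.le, k2 h1 (not_lt.mp h2), not_lt.mp h2⟩⟩
    · exact absurd (k1 h2) h1
    · exact ⟨by norm_num, by norm_num, fun h _ _ => absurd h h1, by simp⟩
  · have hA' := not_lt.mp hA
    obtain ⟨k1, k2⟩ := two (A := B) (B := C) (C := A) (α := β) (β := γ) (γ := α)
      (by linarith) (by linarith) hB hC hA'
    simp only [hA, hB, hC, not_le.mpr hB, not_le.mpr hC, hA', true_and, false_and,
      and_false, if_false, add_zero] at hn
    subst hn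
    split_ifs with h1 h2 h2
    · exact ⟨by norm_num, by norm_num, fun h _ _ => absurd h1 (by linarith), by simp⟩
    · exact absurd (k1 h1) h2
    · exact ⟨by norm_num, by norm_num, fun _ _ _ => rfl,
        fun _ => ⟨not_lt.mp h1, k2 h2 (not_lt.mp h1), h2.le⟩⟩
    · exact ⟨by norm_num, by norm_num, fun _ _ h => absurd h h2, by simp⟩
  · have hA' := not_lt.mp hA
    have hC' := not_lt.mp hC
    obtain ⟨k1, k2⟩ := one (A := B) (B := C) (C := A) (α := β) (β := γ) (γ := α)
      (by linarith) (by linarith) hB hC' hA'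
    simp only [hA, hB, hC, not_le.mpr hB, hA', hC', true_and, false_and,
      and_false, if_false, add_zero] at hn
    subst hn
    split_ifs with h1 h2 h2
    · exact ⟨by norm_num, by norm_num, fun h _ _ => absurd h1 (by linarith), by simp⟩
    · exact absurd (k1 h1) h2
    · exact ⟨by norm_num, by norm_num, fun _ _ _ => rfl,
        fun _ => ⟨not_lt.mp h1, h2.le, k2 h2 (not_lt.mp h1)⟩⟩
    · exact ⟨by norm_num, by norm_num, fun _ h _ => absurd h h2, by simp⟩
  · have hA' := not_lt.mp hA
    have hB' := not_lt.mp hB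
    obtain ⟨k1, k2⟩ := one (A := C) (B := A) (C := B) (α := γ) (β := α) (γ := β)
      (by linarith) (by linarith) hC hA' hB'
    simp only [hA, hB, hC, not_le.mpr hC, hA', hB', true_and, false_and,
      and_false, if_false, zero_add] at hn
    subst hn
    split_ifs with h1 h2 h2
    · exact ⟨by norm_num, by norm_num, fun _ h _ => absurd h1 (by linarith), by simp⟩
    · exact absurd (k1 h1) h2
    · exact ⟨by norm_num, by norm_num, fun _ _ _ => rfl,
        fun _ => ⟨k2 h2 (not_lt.mp h1), not_lt.mp h1, h2.le⟩⟩
    · exact ⟨by norm_num, by norm_num, fun _ _ h => absurd h h2, by simp⟩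
  · simp only [hA, hB, hC, false_and, and_false, if_false, add_zero] at hn
    subst hn
    refine ⟨le_rfl, by norm_num, fun h1 h2 h3 => ?_, by simp⟩
    have hA' := not_lt.mp hA
    have hB' := not_lt.mp hB
    have hC' := not_lt.mp hC
    have e1 : A = 0 := by
      by_contra hne
      have : A < 0 := lt_of_le_of_ne hA' hne
      nlinarith [mul_pos h2 (neg_pos.mpr this), mul_nonneg h1.le (neg_nonneg.mpr hC'),
        mul_nonneg h3.le (neg_nonneg.mpr hB')]
    have e2 : B = 0 := by
      by_contra hne
      have : B < 0 := lt_of_le_of_ne hB' hne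
      nlinarith [mul_pos h3 (neg_pos.mpr this), mul_nonneg h1.le (neg_nonneg.mpr hC'),
        mul_nonneg h2.le (neg_nonneg.mpr hA')]
    exact absurd (h0 e1 e2) h1.ne'

/-- The winding number of a positively oriented triangle around a point. -/
theorem rayCrossing_triangle {a b c : ℂ} (habc : 0 < orient a b c) (z : ℂ) :
    0 ≤ rayCrossing z a b + rayCrossing z b c + rayCrossing z c a ∧
    rayCrossing z a b + rayCrossing z b c + rayCrossing z c a ≤ 1 ∧
    (0 < orient a b z → 0 < orient b c z → 0 < orient c a z →
      rayCrossing z a b + rayCrossing z b c + rayCrossing z c a = 1) ∧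
    (rayCrossing z a b + rayCrossing z b c + rayCrossing z c a ≠ 0 →
      0 ≤ orient a b z ∧ 0 ≤ orient b c z ∧ 0 ≤ orient c a z) := by
  refine sum_sign_mem (A := a.re - z.re) (B := b.re - z.re) (C := c.re - z.re) ?_ ?_ ?_ rfl
  · simp [orient, crossProd]; ring
  · have : orient a b z + orient b c z + orient c a z = orient a b c := by
      simp [orient, crossProd]; ring
    rw [this]; exact habc
  · intro h1 h2
    have e1 : z.re = a.re := by linarith
    have e2 : b.re = a.re := by linarith
    simp [orient, crossProd, e1, e2]

/-- The half-line from `z` in direction `ζ` starts on the left of the line from `a` to `b`. -/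
def EntersHalf (a b z ζ : ℂ) : Prop :=
  0 < orient a b z ∨ orient a b z = 0 ∧ 0 < crossProd (b - a) ζ

theorem eventually_pos_add_mul {α β : ℝ} (h : 0 < α ∨ α = 0 ∧ 0 < β) :
    ∀ᶠ t : ℝ in 𝓝[>] 0, 0 < α + t * β := by
  rcases h with h | ⟨rfl, h⟩
  · have : Filter.Tendsto (fun t : ℝ => α + t * β) (𝓝[>] 0) (𝓝 (α + 0 * β)) :=
      (Continuous.tendsto (by fun_prop) 0).mono_left nhdsWithin_le_nhds
    exact this.eventually (lt_mem_nhds (by linarith))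
  · filter_upwards [self_mem_nhdsWithin] with t ht
    have ht : (0 : ℝ) < t := ht
    positivity

theorem EntersHalf.eventually {a b z ζ : ℂ} (h : EntersHalf a b z ζ) :
    ∀ᶠ t : ℝ in 𝓝[>] 0, 0 < orient a b (z + t * ζ) := by
  simp only [orient_add, crossProd_ofReal_mul]
  exact eventually_pos_add_mul h

theorem EntersHalf.perturb {a b z ζ : ℂ} (h : EntersHalf a b z ζ) (η : ℂ) :
    ∀ᶠ t : ℝ in 𝓝[>] 0, EntersHalf a b z (ζ + t * η) := by
  rcases h with h | ⟨h, h'⟩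
  · exact Filter.Eventually.of_forall fun _ => Or.inl h
  · filter_upwards [eventually_pos_add_mul (β := crossProd (b - a) η) (Or.inl h')] with t ht
    refine Or.inr ⟨h, ?_⟩
    rwa [crossProd_add, crossProd_ofReal_mul]

theorem crossProd_eq_norm_mul_norm_mul_sin_arg_sub (a b : ℂ) :
    crossProd a b = ‖a‖ * ‖b‖ * Real.sin (Complex.arg b - Complex.arg a) := by
  have h1 := Complex.norm_mul_cos_arg a
  have h2 := Complex.norm_mul_sin_arg a
  have h3 := Complex.norm_mul_cos_arg b
  have h4 := Complex.norm_mul_sin_arg b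
  rw [crossProd, Real.sin_sub, ← h1, ← h2, ← h3, ← h4]
  ring

theorem crossProd_div {ζ : ℂ} (hζ : ζ ≠ 0) (a b : ℂ) :
    crossProd a b = Complex.normSq ζ * crossProd (a / ζ) (b / ζ) := by
  obtain ⟨a', rfl⟩ : ∃ a', a = a' * ζ := ⟨a / ζ, by field_simp⟩
  obtain ⟨b', rfl⟩ : ∃ b', b = b' * ζ := ⟨b / ζ, by field_simp⟩
  rw [mul_div_cancel_right₀ _ hζ, mul_div_cancel_right₀ _ hζ]
  simp only [crossProd, Complex.mul_re, Complex.mul_im, Complex.normSq_apply]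
  ring

theorem crossProd_eq_im {ζ : ℂ} (hζ : ζ ≠ 0) (b : ℂ) :
    crossProd ζ b = Complex.normSq ζ * (b / ζ).im := by
  rw [crossProd_div hζ, div_self hζ]
  simp [crossProd]

theorem crossProd_nonpos_of_arg_le {a b : ℂ} (h : Complex.arg b ≤ Complex.arg a)
    (h' : Complex.arg a ≤ Complex.arg b + Real.pi) : crossProd a b ≤ 0 := by
  rw [crossProd_eq_norm_mul_norm_mul_sin_arg_sub]
  exact mul_nonpos_of_nonneg_of_nonpos (by positivity)
    (Real.sin_nonpos_of_nonpos_of_neg_pi_le (by linarith) (by linarith))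

/-- Vectors that turn counterclockwise in each step of a cyclic permutation reach all
directions. -/
theorem exists_mem_cone {D : Type*} [Finite D] [Nonempty D] (f : D → D) {r : D → ℂ}
    (hr : ∀ d, 0 < crossProd (r d) (r (f d))) {ζ : ℂ} (hζ : ζ ≠ 0) :
    ∃ d, 0 ≤ crossProd (r d) ζ ∧ 0 < crossProd ζ (r (f d)) := by
  have hns : 0 < Complex.normSq ζ := Complex.normSq_pos.mpr hζ
  -- The branch cut of `arg (· / -ζ)` is the direction `ζ`. The vector of maximal argument turns
  -- counterclockwise without increasing it, so this turn passes `ζ`.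
  obtain ⟨d, hd⟩ := Finite.exists_max fun d => Complex.arg (r d / -ζ)
  have hζ' : -ζ ≠ 0 := neg_ne_zero.mpr hζ
  have hc := hr d
  rw [crossProd_div hζ', Complex.normSq_neg] at hc
  have hc' := pos_of_mul_pos_right hc hns.le
  have hle := hd (f d)
  set a := r d / -ζ with ha
  set b := r (f d) / -ζ with hb
  have key : 0 ≤ a.im ∧ b.im < 0 := by
    by_cases h1 : 0 ≤ a.im
    · refine ⟨h1, ?_⟩
      by_contra! h2
      have := Complex.arg_nonneg_iff.mpr h2
      exact absurd hc' (not_lt.mpr (crossProd_nonpos_of_arg_le hle (by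
        linarith [Complex.arg_le_pi a])))
    · have h3 := Complex.arg_neg_iff.mpr (not_le.mp h1)
      exact absurd hc' (not_lt.mpr (crossProd_nonpos_of_arg_le hle (by
        linarith [Complex.neg_pi_lt_arg b])))
  refine ⟨d, ?_, ?_⟩
  · have := crossProd_eq_im hζ' (r d)
    rw [← ha, crossProd_neg_left, Complex.normSq_neg] at this
    rw [crossProd_swap]
    rw [this]
    exact mul_nonneg hns.le key.1
  · have := crossProd_eq_im hζ' (r (f d))
    rw [← hb, crossProd_neg_left, Complex.normSq_neg] at this
    have := mul_neg_of_pos_of_neg hns key.2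
    linarith

/-! ### Positively oriented inner faces do not overlap. -/

namespace PlaneGraph

variable {V : Type*} {G : SimpleGraph V} {T : PlaneGraph G}

/-- All inner faces are positively oriented triangles. -/
def PositiveInner (T : PlaneGraph G) (p : V → ℂ) : Prop :=
  ∀ d, T.face d ≠ T.outer → 0 < orient (p d.fst) (p d.snd) (p (T.apex d))

/-- The half-line from `z` in direction `ζ` starts in the triangle to the left of `d`. -/
def Enters (T : PlaneGraph G) (p : V → ℂ) (d : G.Dart) (z ζ : ℂ) : Prop :=
  EntersHalf (p d.fst) (p d.snd) z ζ ∧ EntersHalf (p d.snd) (p (T.apex d)) z ζ ∧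
    EntersHalf (p (T.apex d)) (p d.fst) z ζ

theorem faceDet_eq_orient (p : V → ℂ) (d : G.Dart) :
    T.faceDet (fun v => (p v).re) (fun v => (p v).im) d =
      orient (p d.fst) (p d.snd) (p (T.apex d)) := by
  rw [faceDet, triDet_eq, apex]
  simp [orient, crossProd]
  ring

theorem Enters.perturb {p : V → ℂ} {d : G.Dart} {z ζ : ℂ} (h : T.Enters p d z ζ) (η : ℂ) :
    ∀ᶠ t : ℝ in 𝓝[>] 0, T.Enters p d z (ζ + t * η) := by
  filter_upwards [h.1.perturb η, h.2.1.perturb η, h.2.2.perturb η] with t h1 h2 h3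
  exact ⟨h1, h2, h3⟩

section

variable {p : V → ℂ}

/-- The winding number of the face to the left of `d` around `z`. -/
noncomputable def winding (T : PlaneGraph G) (p : V → ℂ) (z : ℂ) (d : G.Dart) : ℤ :=
  rayCrossing z (p d.fst) (p d.snd) + rayCrossing z (p d.snd) (p (T.apex d)) +
    rayCrossing z (p (T.apex d)) (p d.fst)

/-- Each edge occurs in both directions, so its ray crossings cancel in the sum over all faces. -/
theorem IsTriangulation.exists_sum_winding (hT : T.IsTriangulation) [Finite V] [Fintype T.Face]
    (z : ℂ) : ∃ N : T.Face → ℤ, (∀ d, N (T.face d) = T.winding p z d) ∧ ∑ f, N f = 0 := by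
  have : Fintype G.Dart := Fintype.ofFinite _
  have hinv : ∀ d, T.winding p z (T.facePerm d) = T.winding p z d := by
    intro d
    simp only [winding, T.facePerm_fst, hT.apex_facePerm]
    change rayCrossing z (p d.snd) (p (T.apex d)) + rayCrossing z (p (T.apex d)) (p d.fst) +
      rayCrossing z (p d.fst) (p d.snd) = _
    ring
  let N : T.Face → ℤ := Quotient.lift (T.winding p z) fun _ _ h =>
    Equiv.Perm.SameCycle.apply_eq hinv h
  refine ⟨N, fun _ => rfl, ?_⟩
  have h := hT.sum_face N
  have hφ : ∀ F : G.Dart → ℤ, ∑ d, F (T.facePerm d) = ∑ d, F d := Equiv.sum_comp T.facePerm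
  let g : G.Dart → ℤ := fun d => rayCrossing z (p d.fst) (p d.snd)
  have hg : ∀ d, N (T.face d) = g d + g (T.facePerm d) + g (T.facePerm (T.facePerm d)) := by
    intro d
    simp only [g, T.facePerm_fst, hT.facePerm_facePerm_snd]
    rfl
  have hg0 : ∑ d, g d = 0 := by
    have h1 := sum_dart_symm g
    have h2 : ∀ d : G.Dart, g d.symm = -g d := fun d => rayCrossing_swap _ _ _
    simp only [h2, Finset.sum_neg_distrib] at h1
    exact self_eq_neg.mp h1.symm
  simp only [hg, Finset.sum_add_distrib] at h
  rw [hφ (fun d => g (T.facePerm d)), hφ g, hg0] at h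
  linarith

namespace PositiveInner

theorem ne (hp : T.PositiveInner p) {d : G.Dart} (hd : T.face d ≠ T.outer) :
    p d.fst ≠ p d.snd := by
  intro h
  have := hp d hd
  rw [h] at this
  simp [orient, crossProd] at this

theorem orient_facePerm (hT : T.IsTriangulation) (p : V → ℂ) (d : G.Dart) :
    orient (p (T.facePerm d).fst) (p (T.facePerm d).snd) (p (T.apex (T.facePerm d))) =
      orient (p d.fst) (p d.snd) (p (T.apex d)) := by
  rw [T.facePerm_fst, hT.apex_facePerm]
  exact orient_rotate _ _ _

theorem exists_inner (hT : T.IsTriangulation) (v : V) [Nontrivial V] :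
    ∃ d : G.Dart, d.fst = v ∧ T.face d ≠ T.outer := by
  obtain ⟨d, rfl⟩ := T.exists_dart_fst v
  by_cases h : T.face d = T.outer
  · refine ⟨T.facePerm d.symm, T.facePerm_fst _, ?_⟩
    rw [T.face_facePerm, ← h]
    exact hT.face_symm_ne d
  · exact ⟨d, rfl, h⟩

theorem outer_neg (hp : T.PositiveInner p) (hT : T.IsTriangulation) [Finite V] {d₀ : G.Dart}
    (h₀ : T.face d₀ = T.outer) : orient (p d₀.fst) (p d₀.snd) (p (T.apex d₀)) < 0 := by
  classical
  have : Fintype G.Dart := Fintype.ofFinite _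
  have : Fintype T.Face := Fintype.ofFinite _
  have hinv := orient_facePerm hT p
  let k : T.Face → ℝ := Quotient.lift
    (fun d => orient (p d.fst) (p d.snd) (p (T.apex d))) fun _ _ h =>
      Equiv.Perm.SameCycle.apply_eq
        (g := fun d => orient (p d.fst) (p d.snd) (p (T.apex d))) hinv h
  have hk : ∀ d, k (T.face d) = orient (p d.fst) (p d.snd) (p (T.apex d)) := fun _ => rfl
  have h1 := hT.sum_faceDet (fun v => (p v).re) (fun v => (p v).im)
  simp only [faceDet_eq_orient, ← hk] at h1
  rw [hT.sum_face k, ← Finset.add_sum_erase _ _ (Finset.mem_univ T.outer)] at h1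
  have h2 : 0 < ∑ f ∈ Finset.univ.erase T.outer, k f := by
    refine Finset.sum_pos (fun f hf => ?_) ⟨T.face d₀.symm, ?_⟩
    · obtain ⟨d, rfl⟩ := T.face_surjective f
      exact hp d (Finset.ne_of_mem_erase hf)
    · rw [Finset.mem_erase, ← h₀]
      exact ⟨hT.face_symm_ne d₀, Finset.mem_univ _⟩
  rw [← hk, h₀]
  linarith

/-- The inner triangles do not overlap, and they lie in the outer triangle. -/
theorem inside_unique (hp : T.PositiveInner p) (hT : T.IsTriangulation) [Finite V]
    {d : G.Dart} (hd : T.face d ≠ T.outer) {z : ℂ}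
    (h1 : 0 < orient (p d.fst) (p d.snd) z) (h2 : 0 < orient (p d.snd) (p (T.apex d)) z)
    (h3 : 0 < orient (p (T.apex d)) (p d.fst) z) :
    (∀ d', T.face d' ≠ T.outer → 0 < orient (p d'.fst) (p d'.snd) z →
      0 < orient (p d'.snd) (p (T.apex d')) z → 0 < orient (p (T.apex d')) (p d'.fst) z →
      T.face d' = T.face d) ∧
    ∀ d₀, T.face d₀ = T.outer → orient (p d₀.fst) (p d₀.snd) z ≤ 0 := by
  classical
  have : Fintype T.Face := Fintype.ofFinite _
  obtain ⟨N, hN, hsum⟩ := hT.exists_sum_winding (p := p) z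
  rw [← Finset.add_sum_erase _ _ (Finset.mem_univ T.outer)] at hsum
  have hnonneg : ∀ f ∈ Finset.univ.erase T.outer, 0 ≤ N f := by
    intro f hf
    obtain ⟨d, rfl⟩ := T.face_surjective f
    rw [hN]
    exact (rayCrossing_triangle (hp d (Finset.ne_of_mem_erase hf)) z).1
  have hone : ∀ d', T.face d' ≠ T.outer → 0 < orient (p d'.fst) (p d'.snd) z →
      0 < orient (p d'.snd) (p (T.apex d')) z → 0 < orient (p (T.apex d')) (p d'.fst) z →
      N (T.face d') = 1 := by
    intro d' hd' h1 h2 h3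
    rw [hN]
    exact (rayCrossing_triangle (hp d' hd') z).2.2.1 h1 h2 h3
  have hd1 := hone d hd h1 h2 h3
  have hmem : ∀ {d'}, T.face d' ≠ T.outer → T.face d' ∈ Finset.univ.erase T.outer := fun h =>
    Finset.mem_erase.mpr ⟨h, Finset.mem_univ _⟩
  have hout : ∀ d₀, T.face d₀ = T.outer → N T.outer =
      -(rayCrossing z (p d₀.snd) (p d₀.fst) + rayCrossing z (p d₀.fst) (p (T.apex d₀)) +
        rayCrossing z (p (T.apex d₀)) (p d₀.snd)) := by
    intro d₀ h₀
    rw [← h₀, hN, winding, rayCrossing_swap z (p d₀.fst) (p d₀.snd),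
      rayCrossing_swap z (p (T.apex d₀)) (p d₀.fst),
      rayCrossing_swap z (p d₀.snd) (p (T.apex d₀))]
    ring
  have hrev : ∀ d₀, T.face d₀ = T.outer →
      0 < orient (p d₀.snd) (p d₀.fst) (p (T.apex d₀)) := by
    intro d₀ h₀
    rw [orient_swap]
    exact neg_pos.mpr (hp.outer_neg hT h₀)
  obtain ⟨d₁, hd₁⟩ := T.face_surjective T.outer
  -- The reversed outer triangle is positive and winds at most once; its winding number equals the
  -- sum of the nonnegative ones of the inner faces.
  have hle : ∑ f ∈ Finset.univ.erase T.outer, N f ≤ 1 := by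
    have := (rayCrossing_triangle (hrev d₁ hd₁) z).2.1
    rw [hout d₁ hd₁] at hsum
    linarith
  constructor
  · intro d' hd' h1' h2' h3'
    by_contra hne
    have hd1' := hone d' hd' h1' h2' h3'
    have hsub : ∑ f ∈ {T.face d', T.face d}, N f ≤ ∑ f ∈ Finset.univ.erase T.outer, N f := by
      refine Finset.sum_le_sum_of_subset_of_nonneg ?_ fun f hf _ => hnonneg f hf
      intro f hf
      rcases Finset.mem_insert.mp hf with rfl | hf
      · exact hmem hd'
      · rw [Finset.mem_singleton.mp hf]; exact hmem hd
    rw [Finset.sum_pair hne] at hsub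
    omega
  · intro d₀ h₀
    have hge : 1 ≤ ∑ f ∈ Finset.univ.erase T.outer, N f := by
      rw [← hd1]
      exact Finset.single_le_sum hnonneg (hmem hd)
    have := (rayCrossing_triangle (hrev d₀ h₀) z).2.2.2 (by
      rw [hout d₀ h₀] at hsum
      omega)
    have h := this.1
    rw [orient_swap] at h
    linarith

/-- A point slightly along the half-line is inside both triangles. In this form uniqueness applies
to points on edges and at vertices. -/
theorem face_eq_of_enters (hp : T.PositiveInner p) (hT : T.IsTriangulation) [Finite V]
    {d d' : G.Dart} (hd : T.face d ≠ T.outer) (hd' : T.face d' ≠ T.outer) {z ζ : ℂ}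
    (h : T.Enters p d z ζ) (h' : T.Enters p d' z ζ) : T.face d' = T.face d := by
  obtain ⟨t, h1, h2, h3, h1', h2', h3'⟩ := (h.1.eventually.and (h.2.1.eventually.and
    (h.2.2.eventually.and (h'.1.eventually.and (h'.2.1.eventually.and
    h'.2.2.eventually))))).exists
  exact (hp.inside_unique hT hd h1 h2 h3).1 d' hd' h1' h2' h3'

theorem not_enters_outward (hp : T.PositiveInner p) (hT : T.IsTriangulation) [Finite V]
    {d d₀ : G.Dart} (hd : T.face d ≠ T.outer) (h₀ : T.face d₀ = T.outer) {z ζ : ℂ}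
    (h : T.Enters p d z ζ) : ¬EntersHalf (p d₀.fst) (p d₀.snd) z ζ := by
  intro h'
  obtain ⟨t, h1, h2, h3, h1'⟩ := (h.1.eventually.and (h.2.1.eventually.and
    (h.2.2.eventually.and h'.eventually))).exists
  exact absurd h1' (not_lt.mpr ((hp.inside_unique hT hd h1 h2 h3).2 d₀ h₀))

theorem enters_of_cone (hp : T.PositiveInner p) {d : G.Dart} (hd : T.face d ≠ T.outer) {ζ : ℂ}
    (h1 : 0 < crossProd (p d.snd - p d.fst) ζ)
    (h2 : 0 < crossProd ζ (p (T.apex d) - p d.fst)) : T.Enters p d (p d.fst) ζ := by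
  refine ⟨Or.inr ⟨orient_self_left _ _, h1⟩, Or.inl ?_, Or.inr ⟨orient_self_right _ _, ?_⟩⟩
  · rw [orient_rotate]; exact hp d hd
  · rw [← neg_sub, crossProd_neg_left, ← crossProd_swap]; exact h2

/-- Otherwise points of an inner triangle close to `v` would lie beyond an outer edge. -/
theorem orient_le_zero (hp : T.PositiveInner p) (hT : T.IsTriangulation) [Finite V]
    {d₀ : G.Dart} (h₀ : T.face d₀ = T.outer) (v : V) :
    orient (p d₀.fst) (p d₀.snd) (p v) ≤ 0 := by
  have : Nontrivial V := ⟨d₀.fst, d₀.snd, d₀.fst_ne_snd⟩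
  obtain ⟨d, rfl, hd⟩ := exists_inner hT v
  by_contra! hcon
  have hpos := hp d hd
  rw [orient] at hpos
  refine hp.not_enters_outward hT hd h₀ (hp.enters_of_cone hd
    (ζ := (p d.snd - p d.fst) + (p (T.apex d) - p d.fst)) ?_ ?_) (Or.inl hcon)
  · rw [crossProd_add, crossProd_self, zero_add]; exact hpos
  · rw [crossProd_swap, crossProd_add, crossProd_self, add_zero, ← crossProd_swap]; exact hpos

theorem apex_eq_rot_snd (hT : T.IsTriangulation) (d : G.Dart) : (T.rot d).snd = T.apex d := by
  have h : (T.rot d).symm = T.facePerm (T.facePerm d) := by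
    apply T.facePerm.injective
    rw [T.facePerm_rot_symm, hT]
  have := congrArg (fun d : G.Dart => d.fst) h
  rw [T.facePerm_facePerm_fst] at this
  exact this

/-- The triangles at an interior vertex cover all directions. -/
theorem exists_enters (hp : T.PositiveInner p) (hT : T.IsTriangulation) [Finite V] [Nontrivial V]
    {v : V} (hv : ∀ d : G.Dart, d.fst = v → T.face d ≠ T.outer) {ζ : ℂ} (hζ : ζ ≠ 0) :
    ∃ d : G.Dart, d.fst = v ∧ ∃ η : ℂ, ∀ t : ℝ, 0 < t → T.Enters p d (p v) (ζ + t * η) := by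
  obtain ⟨d₀, hd₀⟩ := T.exists_dart_fst v
  have : Nonempty {d : G.Dart // d.fst = v} := ⟨⟨d₀, hd₀⟩⟩
  have hpos : ∀ d : {d : G.Dart // d.fst = v},
      0 < crossProd (p d.1.snd - p v) (p (T.rot d.1).snd - p v) := by
    rintro ⟨d, rfl⟩
    rw [apex_eq_rot_snd hT]
    exact hp d (hv d rfl)
  obtain ⟨⟨d, rfl⟩, h1, h2⟩ := exists_mem_cone
    (D := {d : G.Dart // d.fst = v}) (fun d => ⟨T.rot d.1, (T.rot_fst _).trans d.2⟩)
    (r := fun d => p d.1.snd - p v) hpos hζ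
  simp only [apex_eq_rot_snd hT] at h1 h2
  have h3 := hp d (hv d rfl)
  rw [orient] at h3
  refine ⟨d, rfl, p (T.apex d) - p d.fst, fun t ht => hp.enters_of_cone (hv d rfl) ?_ ?_⟩
  · rw [crossProd_add, crossProd_ofReal_mul]
    positivity
  · rw [crossProd_swap, crossProd_add, crossProd_ofReal_mul, crossProd_self, mul_zero, add_zero,
      ← crossProd_swap]
    exact h2

/-- A triangle that contains an interior vertex in its closure is incident to this vertex. -/
theorem exists_face_eq_of_enters (hp : T.PositiveInner p) (hT : T.IsTriangulation) [Finite V]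
    {v : V} (hv : ∀ d : G.Dart, d.fst = v → T.face d ≠ T.outer) {d' : G.Dart}
    (hd' : T.face d' ≠ T.outer) {ζ : ℂ} (hζ : ζ ≠ 0) (h : T.Enters p d' (p v) ζ) :
    ∃ d : G.Dart, d.fst = v ∧ T.face d = T.face d' := by
  have : Nontrivial V := ⟨d'.fst, d'.snd, d'.fst_ne_snd⟩
  obtain ⟨d, hd, η, hη⟩ := hp.exists_enters hT hv hζ
  obtain ⟨t, ht, ht0⟩ := ((h.perturb η).and self_mem_nhdsWithin).exists
  exact ⟨d, hd, hp.face_eq_of_enters hT hd' (hv d hd) ht (hη t ht0)⟩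

theorem eq_of_face_eq (hT : T.IsTriangulation) {d d' : G.Dart} (h : T.face d = T.face d') :
    d.fst = d'.fst ∨ d.fst = d'.snd ∨ d.fst = T.apex d' := by
  rcases hT.face_eq_iff.mp h with rfl | rfl | rfl
  · exact Or.inl rfl
  · exact Or.inr (Or.inl (T.facePerm_fst _))
  · exact Or.inr (Or.inr (T.facePerm_facePerm_fst _))

/-- The triangles around an interior vertex cover every direction, including the outward one if the
vertex were on an outer line. -/
theorem orient_neg_of_interior (hp : T.PositiveInner p) (hT : T.IsTriangulation) [Finite V]
    {v : V} (hv : ∀ d : G.Dart, d.fst = v → T.face d ≠ T.outer) {d₀ : G.Dart}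
    (h₀ : T.face d₀ = T.outer) : orient (p d₀.fst) (p d₀.snd) (p v) < 0 := by
  have : Nontrivial V := ⟨d₀.fst, d₀.snd, d₀.fst_ne_snd⟩
  refine lt_of_le_of_ne (hp.orient_le_zero hT h₀ v) fun h => ?_
  have hne : p d₀.snd - p d₀.fst ≠ 0 := by
    intro h
    have := hp.outer_neg hT h₀
    rw [orient, h] at this
    simp [crossProd] at this
  have hpos : 0 < crossProd (p d₀.snd - p d₀.fst) (Complex.I * (p d₀.snd - p d₀.fst)) := by
    have := Complex.normSq_pos.mpr hne
    rw [Complex.normSq_apply] at this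
    simp only [crossProd, Complex.mul_re, Complex.mul_im, Complex.I_re, Complex.I_im]
    linarith
  obtain ⟨d, hd, η, hη⟩ := hp.exists_enters hT hv (ζ := Complex.I * (p d₀.snd - p d₀.fst))
    (mul_ne_zero Complex.I_ne_zero hne)
  have hE : EntersHalf (p d₀.fst) (p d₀.snd) (p v) (Complex.I * (p d₀.snd - p d₀.fst)) :=
    Or.inr ⟨h, hpos⟩
  obtain ⟨t, ht, ht0⟩ := ((hE.perturb η).and self_mem_nhdsWithin).exists
  exact hp.not_enters_outward hT (hv d hd) h₀ (hη t ht0) ht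

/-- A triangle at a vertex that coincides with an interior vertex must be incident to that one as
well, and would be degenerate. Two outer vertices differ because the outer triangle is not
degenerate. -/
theorem injective (hp : T.PositiveInner p) (hT : T.IsTriangulation) [Finite V] :
    Function.Injective p := by
  intro v v' h
  by_contra hne
  have : Nontrivial V := ⟨v, v', hne⟩
  -- an interior vertex does not coincide with any other vertex
  have key : ∀ v v', p v = p v' → v ≠ v' → ∃ d : G.Dart, d.fst = v ∧ T.face d = T.outer := by
    intro v v' h hne
    by_contra! hv
    by_cases hv' : ∃ d : G.Dart, d.fst = v' ∧ T.face d = T.outer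
    · obtain ⟨d₀, rfl, h₀⟩ := hv'
      have := hp.orient_neg_of_interior hT hv h₀
      rw [h, orient_self_left] at this
      exact lt_irrefl _ this
    · push Not at hv'
      obtain ⟨d', rfl⟩ := T.exists_dart_fst v'
      have hd' := hv' d' rfl
      have hpos := hp d' hd'
      rw [orient] at hpos
      have hE : T.Enters p d' (p d'.fst)
          ((p d'.snd - p d'.fst) + (p (T.apex d') - p d'.fst)) := by
        refine hp.enters_of_cone hd' ?_ ?_
        · rw [crossProd_add, crossProd_self, zero_add]; exact hpos
        · rw [crossProd_swap, crossProd_add, crossProd_self, add_zero, ← crossProd_swap]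
          exact hpos
      have hζ : (p d'.snd - p d'.fst) + (p (T.apex d') - p d'.fst) ≠ 0 := by
        intro h0
        have := crossProd_add (p d'.snd - p d'.fst) (p d'.snd - p d'.fst)
          (p (T.apex d') - p d'.fst)
        rw [h0, crossProd_self, zero_add] at this
        simp only [crossProd, Complex.zero_re, Complex.zero_im, mul_zero, sub_zero] at this
        simp only [crossProd] at hpos
        linarith
      rw [← h] at hE
      obtain ⟨d, hd, hface⟩ := hp.exists_face_eq_of_enters hT hv hd' (by rw [h]; exact hζ) hE
      rcases eq_of_face_eq hT hface with h1 | h1 | h1 <;> rw [hd] at h1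
      · exact hne h1
      · rw [← h1, h, sub_self] at hpos
        simp [crossProd] at hpos
      · rw [← h1, h, sub_self] at hpos
        simp [crossProd] at hpos
  obtain ⟨d, rfl, hd⟩ := key v v' h hne
  obtain ⟨d', rfl, hd'⟩ := key v' _ h.symm (Ne.symm hne)
  have hneg := hp.outer_neg hT hd
  rcases eq_of_face_eq hT (hd'.trans hd.symm) with h1 | h1 | h1
  · exact hne h1.symm
  · rw [h, h1] at hneg
    simp [orient, crossProd] at hneg
  · rw [h, h1, orient_self_left] at hneg
    exact lt_irrefl _ hneg

end PositiveInner

end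

end PlaneGraph

/-! ### Transversal directions and counterclockwise angles. -/

theorem crossProd_zero_right (u : ℂ) : crossProd u 0 = 0 := by simp [crossProd]

theorem crossProd_zero_left (u : ℂ) : crossProd 0 u = 0 := by simp [crossProd]

theorem crossProd_I_mul_self (u : ℂ) : crossProd u (Complex.I * u) = Complex.normSq u := by
  simp only [crossProd, Complex.mul_re, Complex.mul_im, Complex.I_re, Complex.I_im,
    Complex.normSq_apply]
  ring

theorem eq_of_orient_eq_zero {a b c z : ℂ} (h : orient a b c ≠ 0) (h1 : orient a b z = 0)
    (h2 : orient c a z = 0) : z = a := by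
  have e1 : orient a b c * (z.re - a.re) = 0 := by
    have : orient a b c * (z.re - a.re) =
        (c.re - a.re) * orient a b z + (b.re - a.re) * orient c a z := by
      simp [orient, crossProd]; ring
    rw [this, h1, h2]; ring
  have e2 : orient a b c * (z.im - a.im) = 0 := by
    have : orient a b c * (z.im - a.im) =
        (c.im - a.im) * orient a b z + (b.im - a.im) * orient c a z := by
      simp [orient, crossProd]; ring
    rw [this, h1, h2]; ring
  apply Complex.ext
  · linarith [(mul_eq_zero.mp e1).resolve_left h]
  · linarith [(mul_eq_zero.mp e2).resolve_left h]

theorem exists_crossProd_pos_of_ne_zero {a b : ℂ} (ha : a ≠ 0) (hb : b ≠ 0) :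
    ∃ ζ, 0 < crossProd a ζ ∧ crossProd b ζ ≠ 0 := by
  have hpos : 0 < crossProd a (Complex.I * a) := by
    rw [crossProd_I_mul_self]; exact Complex.normSq_pos.mpr ha
  by_cases h : crossProd b (Complex.I * a) = 0
  · refine ⟨Complex.I * a + a, by rwa [crossProd_add, crossProd_self, add_zero], ?_⟩
    rw [crossProd_add, h, zero_add]
    intro h'
    have key : Complex.normSq b * Complex.normSq a =
        crossProd b a ^ 2 + crossProd b (Complex.I * a) ^ 2 := by
      simp only [crossProd, Complex.mul_re, Complex.mul_im, Complex.I_re, Complex.I_im,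
        Complex.normSq_apply]
      ring
    rw [h, h'] at key
    have := mul_pos (Complex.normSq_pos.mpr hb) (Complex.normSq_pos.mpr ha)
    rw [key] at this
    norm_num at this
  · exact ⟨_, hpos, h⟩

theorem ccwAngle_of_pos {z w : ℂ} (h : 0 < Complex.arg (w / z)) :
    ccwAngle z w = Complex.arg (w / z) := by
  rw [ccwAngle, toIocMod_eq_self, zero_add]
  exact ⟨h, by linarith [Complex.arg_le_pi (w / z), Real.pi_pos]⟩

theorem ccwAngle_of_nonpos {z w : ℂ} (h : Complex.arg (w / z) ≤ 0) :
    ccwAngle z w = Complex.arg (w / z) + 2 * Real.pi := by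
  rw [ccwAngle, ← toIocMod_add_right, toIocMod_eq_self, zero_add]
  exact ⟨by linarith [Complex.neg_pi_lt_arg (w / z), Real.pi_pos], by linarith⟩

theorem crossProd_eq_norm_mul_sin {a : ℂ} (ha : a ≠ 0) (b : ℂ) :
    crossProd a b = Complex.normSq a * (‖b / a‖ * Real.sin (Complex.arg (b / a))) := by
  rw [crossProd_eq_im ha, Complex.norm_mul_sin_arg]

theorem crossProd_eq_norm_mul_norm_mul_sin {a : ℂ} (ha : a ≠ 0) (b c : ℂ) :
    crossProd c b = Complex.normSq a *
      (‖c / a‖ * ‖b / a‖ * Real.sin (Complex.arg (b / a) - Complex.arg (c / a))) := by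
  rw [crossProd_div ha, crossProd_eq_norm_mul_norm_mul_sin_arg_sub]

theorem crossProd_pos_of_ccwAngle_lt {a b c : ℂ} (hab : 0 < crossProd a b) (hc : c ≠ 0)
    (h : ccwAngle a c < ccwAngle a b) : 0 < crossProd a c ∧ 0 < crossProd c b := by
  have ha : a ≠ 0 := by rintro rfl; rw [crossProd_zero_left] at hab; exact lt_irrefl _ hab
  have hb : b ≠ 0 := by rintro rfl; rw [crossProd_zero_right] at hab; exact lt_irrefl _ hab
  have hns := Complex.normSq_pos.mpr ha
  have hc' : 0 < ‖c / a‖ := norm_pos_iff.mpr (div_ne_zero hc ha)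
  have hb' : 0 < ‖b / a‖ := norm_pos_iff.mpr (div_ne_zero hb ha)
  have hbim : 0 < (b / a).im := by
    rw [crossProd_eq_im ha] at hab
    exact pos_of_mul_pos_right hab hns.le
  have hβ : 0 < Complex.arg (b / a) := by
    refine lt_of_le_of_ne (Complex.arg_nonneg_iff.mpr hbim.le) fun h => ?_
    rw [← Complex.norm_mul_sin_arg, ← h, Real.sin_zero, mul_zero] at hbim
    exact lt_irrefl _ hbim
  rw [ccwAngle_of_pos hβ] at h
  have hβ' := Complex.arg_le_pi (b / a)
  have hγ : 0 < Complex.arg (c / a) := by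
    by_contra! hγ
    rw [ccwAngle_of_nonpos hγ] at h
    linarith [Complex.neg_pi_lt_arg (c / a)]
  rw [ccwAngle_of_pos hγ] at h
  rw [crossProd_eq_norm_mul_sin ha, crossProd_eq_norm_mul_norm_mul_sin ha]
  exact ⟨mul_pos hns (mul_pos hc' (Real.sin_pos_of_pos_of_lt_pi hγ (by linarith))),
    mul_pos hns (mul_pos (mul_pos hc' hb') (Real.sin_pos_of_pos_of_lt_pi (by linarith)
      (by linarith)))⟩

/-- The reflex case, for outer darts: `c` lies in the convex cone that runs counterclockwise from
`b` to `a`. -/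
theorem ccwAngle_le_of_crossProd {a b c : ℂ} (hab : crossProd a b < 0) (hac : crossProd a c ≤ 0)
    (hbc : 0 ≤ crossProd b c) (hc : c ≠ 0) : ccwAngle a b ≤ ccwAngle a c := by
  have ha : a ≠ 0 := by rintro rfl; rw [crossProd_zero_left] at hab; exact lt_irrefl _ hab
  have hb : b ≠ 0 := by rintro rfl; rw [crossProd_zero_right] at hab; exact lt_irrefl _ hab
  have hns := Complex.normSq_pos.mpr ha
  have hc' : 0 < ‖c / a‖ := norm_pos_iff.mpr (div_ne_zero hc ha)
  have hb' : 0 < ‖b / a‖ := norm_pos_iff.mpr (div_ne_zero hb ha)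
  have hbim : (b / a).im < 0 := by
    rw [crossProd_eq_im ha] at hab
    by_contra! h
    exact absurd hab (not_lt.mpr (mul_nonneg hns.le h))
  have hβ := Complex.arg_neg_iff.mpr hbim
  have hβ' := Complex.neg_pi_lt_arg (b / a)
  rw [crossProd_eq_norm_mul_norm_mul_sin ha] at hbc
  have hsin := nonneg_of_mul_nonneg_right (nonneg_of_mul_nonneg_right hbc hns)
    (mul_pos hb' hc')
  rw [crossProd_eq_norm_mul_sin ha] at hac
  rw [ccwAngle_of_nonpos hβ.le]
  rcases lt_or_ge 0 (Complex.arg (c / a)) with hγ | hγ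
  · exfalso
    rcases (Complex.arg_le_pi (c / a)).lt_or_eq with h | h
    · exact absurd hac (not_le.mpr (mul_pos hns (mul_pos hc'
        (Real.sin_pos_of_pos_of_lt_pi hγ h))))
    · rw [h, Real.sin_pi_sub] at hsin
      exact absurd hsin (not_le.mpr (Real.sin_neg_of_neg_of_neg_pi_lt hβ hβ'))
  · rw [ccwAngle_of_nonpos hγ]
    by_contra! h
    exact absurd hsin (not_le.mpr (Real.sin_neg_of_neg_of_neg_pi_lt (by linarith)
      (by linarith [Complex.neg_pi_lt_arg (c / a)])))

/-! ### Positive inner faces give a planar drawing. -/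

namespace PlaneGraph

variable {V : Type*} {G : SimpleGraph V} {T : PlaneGraph G} {p : V → ℂ}

namespace PositiveInner

theorem orient_of_mem_openSegment {a b c z : ℂ} (hz : z ∈ openSegment ℝ a b) :
    orient a b z = 0 ∧ ∃ s t : ℝ, 0 < s ∧ 0 < t ∧ orient b c z = s * orient a b c ∧
      orient c a z = t * orient a b c := by
  obtain ⟨s, t, hs, ht, hst, rfl⟩ := hz
  refine ⟨?_, s, t, hs, ht, ?_, ?_⟩
  · rw [orient_combo _ _ _ _ hst, orient_self_left, orient_self_right]; ring
  · rw [orient_combo _ _ _ _ hst, orient_self_left, orient_rotate]; ring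
  · rw [orient_combo _ _ _ _ hst, orient_self_right, orient_rotate b, orient_rotate]; ring

theorem enters_of_mem_openSegment (hp : T.PositiveInner p) {d : G.Dart}
    (hd : T.face d ≠ T.outer) {z ζ : ℂ} (hz : z ∈ openSegment ℝ (p d.fst) (p d.snd))
    (hζ : 0 < crossProd (p d.snd - p d.fst) ζ) : T.Enters p d z ζ := by
  obtain ⟨h1, s, t, hs, ht, h2, h3⟩ := orient_of_mem_openSegment (c := p (T.apex d)) hz
  have := hp d hd
  exact ⟨Or.inr ⟨h1, hζ⟩, Or.inl (h2 ▸ mul_pos hs this), Or.inl (h3 ▸ mul_pos ht this)⟩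

/-- An outer vertex is extreme in the outer triangle, which contains everything. If an interior
vertex were on the edge, the triangle at the edge would have it as a corner. -/
theorem notMem_openSegment_of_inner (hp : T.PositiveInner p) (hT : T.IsTriangulation) [Finite V]
    {d : G.Dart} (hd : T.face d ≠ T.outer) (w : V) :
    p w ∉ openSegment ℝ (p d.fst) (p d.snd) := by
  intro hz
  have hD := hp d hd
  by_cases hw : ∃ d₀ : G.Dart, d₀.fst = w ∧ T.face d₀ = T.outer
  · obtain ⟨d₀, rfl, h₀⟩ := hw
    have hneg := hp.outer_neg hT h₀
    have h₀' : T.face (T.facePerm (T.facePerm d₀)) = T.outer := by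
      rw [T.face_facePerm, T.face_facePerm, h₀]
    have l1 := hp.orient_le_zero hT h₀ d.fst
    have l2 := hp.orient_le_zero hT h₀ d.snd
    have l3 := hp.orient_le_zero hT h₀' d.fst
    have l4 := hp.orient_le_zero hT h₀' d.snd
    rw [T.facePerm_facePerm_fst, hT.facePerm_facePerm_snd] at l3 l4
    obtain ⟨s, t, hs, ht, hst, hz⟩ := hz
    have c1 := orient_combo (p d₀.fst) (p d₀.snd) (p d.fst) (p d.snd) hst
    have c2 := orient_combo (p (T.apex d₀)) (p d₀.fst) (p d.fst) (p d.snd) hst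
    rw [hz, orient_self_left] at c1
    rw [hz, orient_self_right] at c2
    have e1 : orient (p d₀.fst) (p d₀.snd) (p d.fst) = 0 := by nlinarith
    have e2 : orient (p d₀.fst) (p d₀.snd) (p d.snd) = 0 := by nlinarith
    have e3 : orient (p (T.apex d₀)) (p d₀.fst) (p d.fst) = 0 := by nlinarith
    have e4 : orient (p (T.apex d₀)) (p d₀.fst) (p d.snd) = 0 := by nlinarith
    exact hp.ne hd ((eq_of_orient_eq_zero hneg.ne e1 e3).trans
      (eq_of_orient_eq_zero hneg.ne e2 e4).symm)
  · push Not at hw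
    obtain ⟨h1, s, t, hs, ht, h2, h3⟩ := orient_of_mem_openSegment (c := p (T.apex d)) hz
    have hE := hp.enters_of_mem_openSegment hd (ζ := p (T.apex d) - p d.fst) hz hD
    have hζ : p (T.apex d) - p d.fst ≠ 0 := by
      intro h
      rw [orient, h, crossProd_zero_right] at hD
      exact lt_irrefl _ hD
    obtain ⟨d', rfl, hface⟩ := hp.exists_face_eq_of_enters hT hw hd hζ hE
    rcases eq_of_face_eq hT hface with h | h | h <;> rw [h] at h1 h2 h3
    · rw [orient_self_right] at h3
      exact (mul_pos ht hD).ne h3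
    · rw [orient_self_left] at h2
      exact (mul_pos hs hD).ne h2
    · exact hD.ne' h1

theorem eq_of_mem_openSegment (hT : T.IsTriangulation) {d d' : G.Dart}
    (hD : orient (p d.fst) (p d.snd) (p (T.apex d)) ≠ 0) (hface : T.face d' = T.face d) {z : ℂ}
    (hz : z ∈ openSegment ℝ (p d.fst) (p d.snd)) (hz' : z ∈ openSegment ℝ (p d'.fst) (p d'.snd)) :
    d' = d := by
  obtain ⟨-, s, t, hs, ht, h2, h3⟩ := orient_of_mem_openSegment (c := p (T.apex d)) hz
  obtain ⟨h, -⟩ := orient_of_mem_openSegment (c := p (T.apex d')) hz'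
  rcases hT.face_eq_iff.mp hface with rfl | rfl | rfl
  · rfl
  · rw [T.facePerm_fst] at h
    exact absurd (h2.symm.trans h) (mul_ne_zero hs.ne' hD)
  · rw [T.facePerm_facePerm_fst, hT.facePerm_facePerm_snd] at h
    exact absurd (h3.symm.trans h) (mul_ne_zero ht.ne' hD)

/-- From a common point move into the face of `d'` transversally to `d`. This enters one of the two
faces at `d`, which must then be the same face. -/
theorem edge_eq_of_inner (hp : T.PositiveInner p) (hT : T.IsTriangulation) [Finite V]
    {d d' : G.Dart} (hd : T.face d ≠ T.outer) (hds : T.face d.symm ≠ T.outer)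
    (hd' : T.face d' ≠ T.outer) {z : ℂ} (hz : z ∈ openSegment ℝ (p d.fst) (p d.snd))
    (hz' : z ∈ openSegment ℝ (p d'.fst) (p d'.snd)) : d'.edge = d.edge := by
  obtain ⟨ζ, h1, h2⟩ := exists_crossProd_pos_of_ne_zero
    (sub_ne_zero.mpr (hp.ne hd').symm) (sub_ne_zero.mpr (hp.ne hd).symm)
  have hE' := hp.enters_of_mem_openSegment hd' hz' h1
  rcases h2.lt_or_gt with h2 | h2
  · have hzs : z ∈ openSegment ℝ (p d.symm.fst) (p d.symm.snd) := by
      rw [openSegment_symm]; exact hz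
    have hE := hp.enters_of_mem_openSegment hds (ζ := ζ) hzs (by
      rw [← neg_sub, crossProd_neg_left]; exact neg_pos.mpr h2)
    rw [eq_of_mem_openSegment hT (hp _ hds).ne' (hp.face_eq_of_enters hT hds hd' hE hE') hzs hz',
      SimpleGraph.Dart.edge_symm]
  · have hE := hp.enters_of_mem_openSegment hd hz h2
    rw [eq_of_mem_openSegment hT (hp _ hd).ne' (hp.face_eq_of_enters hT hd hd' hE hE') hz hz']

theorem edge_eq_of_mem_openSegment (hp : T.PositiveInner p) (hT : T.IsTriangulation) [Finite V]
    {d d' : G.Dart} {z : ℂ} (hz : z ∈ openSegment ℝ (p d.fst) (p d.snd))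
    (hz' : z ∈ openSegment ℝ (p d'.fst) (p d'.snd)) : d'.edge = d.edge := by
  have symm : ∀ {d : G.Dart}, z ∈ openSegment ℝ (p d.fst) (p d.snd) →
      z ∈ openSegment ℝ (p d.symm.fst) (p d.symm.snd) := by
    intro d hz
    rw [openSegment_symm]; exact hz
  have inner : ∀ {d d' : G.Dart}, T.face d ≠ T.outer → T.face d.symm ≠ T.outer →
      z ∈ openSegment ℝ (p d.fst) (p d.snd) → z ∈ openSegment ℝ (p d'.fst) (p d'.snd) →
      d'.edge = d.edge := by
    intro d d' hd hds hz hz'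
    by_cases hd' : T.face d' = T.outer
    · rw [← hp.edge_eq_of_inner hT hd hds (d' := d'.symm) (hd' ▸ hT.face_symm_ne d') hz
        (symm hz'), SimpleGraph.Dart.edge_symm]
    · exact hp.edge_eq_of_inner hT hd hds hd' hz hz'
  have outer : ∀ {d d' : G.Dart}, T.face d = T.outer → T.face d' = T.outer →
      z ∈ openSegment ℝ (p d.fst) (p d.snd) → z ∈ openSegment ℝ (p d'.fst) (p d'.snd) →
      d'.edge = d.edge := by
    intro d d' hd hd' hz hz'
    rw [eq_of_mem_openSegment hT (hp.outer_neg hT hd).ne (hd'.trans hd.symm) hz hz']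
  have flip : ∀ d : G.Dart, z ∈ openSegment ℝ (p d.fst) (p d.snd) →
      (T.face d ≠ T.outer ∧ T.face d.symm ≠ T.outer) ∨ ∃ d₁ : G.Dart, d₁.edge = d.edge ∧
        T.face d₁ = T.outer ∧ z ∈ openSegment ℝ (p d₁.fst) (p d₁.snd) := by
    intro d hz
    by_cases h : T.face d = T.outer
    · exact Or.inr ⟨d, rfl, h, hz⟩
    by_cases h' : T.face d.symm = T.outer
    · exact Or.inr ⟨d.symm, SimpleGraph.Dart.edge_symm d, h', symm hz⟩
    · exact Or.inl ⟨h, h'⟩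
  rcases flip d hz with ⟨h, hs⟩ | ⟨d₁, h₁, hd₁, hz₁⟩
  · exact inner h hs hz hz'
  rcases flip d' hz' with ⟨h, hs⟩ | ⟨d₂, h₂, hd₂, hz₂⟩
  · exact (inner h hs hz' hz).symm
  · rw [← h₁, ← h₂]
    exact outer hd₁ hd₂ hz₁ hz₂

theorem isPlanarStraightLine (hp : T.PositiveInner p) (hT : T.IsTriangulation) [Finite V] :
    IsPlanarStraightLine G p := by
  refine ⟨hp.injective hT, fun u v w huv hz => ?_, fun u v u' v' h h' hne => ?_⟩
  · let d : G.Dart := ⟨(u, v), huv⟩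
    by_cases hd : T.face d = T.outer
    · refine hp.notMem_openSegment_of_inner hT (d := d.symm) (hd ▸ hT.face_symm_ne d) w ?_
      rw [openSegment_symm]
      exact hz
    · exact hp.notMem_openSegment_of_inner hT hd w hz
  · rw [Set.disjoint_left]
    intro z hz hz'
    exact hne (hp.edge_eq_of_mem_openSegment hT (d := ⟨(u', v'), h'⟩) (d' := ⟨(u, v), h⟩) hz' hz)

theorem eq_of_face_eq_of_fst_eq (hT : T.IsTriangulation) {d d' : G.Dart}
    (hface : T.face d' = T.face d) (hfst : d'.fst = d.fst) : d' = d := by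
  rcases hT.face_eq_iff.mp hface with rfl | rfl | rfl
  · rfl
  · rw [T.facePerm_fst] at hfst
    exact absurd hfst.symm d.fst_ne_snd
  · rw [T.facePerm_facePerm_fst] at hfst
    exact absurd hfst (hT.apex_adj d).ne

/-- If `d` is outer, all edges lie in the angle of the outer triangle. Otherwise an edge inside the
angle between `d` and its successor would have its own inner triangle overlapping the one at `d`. -/
theorem ccwAngle_rot_le (hp : T.PositiveInner p) (hT : T.IsTriangulation) [Finite V]
    {d d' : G.Dart} (h : d'.fst = d.fst) :
    ccwAngle (p d.snd - p d.fst) (p (T.rot d).snd - p d.fst) ≤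
      ccwAngle (p d.snd - p d.fst) (p d'.snd - p d.fst) := by
  rw [apex_eq_rot_snd hT]
  have hc : p d'.snd - p d.fst ≠ 0 := by
    rw [← h]
    exact sub_ne_zero.mpr fun h => d'.fst_ne_snd (hp.injective hT h).symm
  by_cases hd : T.face d = T.outer
  · have h' : T.face (T.facePerm (T.facePerm d)) = T.outer := by
      rw [T.face_facePerm, T.face_facePerm, hd]
    have h2 := hp.orient_le_zero hT h' d'.snd
    rw [T.facePerm_facePerm_fst, hT.facePerm_facePerm_snd] at h2
    refine ccwAngle_le_of_crossProd (hp.outer_neg hT hd) (hp.orient_le_zero hT hd d'.snd) ?_ hc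
    have : orient (p (T.apex d)) (p d.fst) (p d'.snd) =
        -crossProd (p (T.apex d) - p d.fst) (p d'.snd - p d.fst) := by
      simp only [orient, crossProd, Complex.sub_re, Complex.sub_im]; ring
    linarith
  · by_contra! hlt
    obtain ⟨h1, h2⟩ := crossProd_pos_of_ccwAngle_lt (hp d hd) hc hlt
    have hE := hp.enters_of_cone hd h1 h2
    by_cases hd' : T.face d' = T.outer
    -- The face to the left of `d'` is outer, so the triangle to its right is used.
    · have hd'' : T.face (T.facePerm d'.symm) ≠ T.outer := by
        rw [T.face_facePerm]; exact hd' ▸ hT.face_symm_ne d'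
      set e := T.facePerm d'.symm with he
      have hfst : e.fst = d.fst := (T.facePerm_fst _).trans h
      have hapex : T.apex e = d'.snd := hT.apex_facePerm _
      have hD := hp e hd''
      rw [hfst, hapex, orient] at hD
      obtain ⟨t, ht, ht0⟩ := ((hE.perturb (p e.snd - p d.fst)).and self_mem_nhdsWithin).exists
      have ht0 : 0 < t := ht0
      have hE' := hp.enters_of_cone hd''
        (ζ := (p d'.snd - p d.fst) + t * (p e.snd - p d.fst)) (by
          rw [hfst, crossProd_add, crossProd_ofReal_mul, crossProd_self, mul_zero, add_zero]
          exact hD) (by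
          rw [hfst, hapex, crossProd_swap, crossProd_add, crossProd_ofReal_mul, crossProd_self,
            zero_add, crossProd_swap]
          rw [mul_neg, neg_neg]
          exact mul_pos ht0 hD)
      rw [hfst] at hE'
      have := eq_of_face_eq_of_fst_eq hT (hp.face_eq_of_enters hT hd hd'' ht hE') hfst
      rw [← hapex, this, crossProd_self] at h2
      exact lt_irrefl _ h2
    · have hD := hp d' hd'
      rw [h, orient] at hD
      obtain ⟨t, ht, ht0⟩ := ((hE.perturb (p (T.apex d') - p d.fst)).and
        self_mem_nhdsWithin).exists
      have ht0 : 0 < t := ht0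
      have hE' := hp.enters_of_cone hd'
        (ζ := (p d'.snd - p d.fst) + t * (p (T.apex d') - p d.fst)) (by
          rw [h, crossProd_add, crossProd_ofReal_mul, crossProd_self, zero_add]
          exact mul_pos ht0 hD) (by
          rw [h, crossProd_swap, crossProd_add, crossProd_ofReal_mul, crossProd_self, mul_zero,
            add_zero, ← crossProd_swap]
          exact hD)
      rw [h] at hE'
      have := eq_of_face_eq_of_fst_eq hT (hp.face_eq_of_enters hT hd hd' ht hE') h
      rw [this, crossProd_self] at h1
      exact lt_irrefl _ h1

/-- The open half-plane to the left of an outer dart is convex, unbounded and disjoint from the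
drawing. -/
theorem leftUnbounded (hp : T.PositiveInner p) (hT : T.IsTriangulation) [Finite V]
    {d : G.Dart} (hd : T.face d = T.outer) : LeftUnbounded G p d := by
  have hle := hp.orient_le_zero hT hd
  have hne : p d.snd - p d.fst ≠ 0 :=
    sub_ne_zero.mpr fun h => d.fst_ne_snd (hp.injective hT h).symm
  set u := p d.fst
  set v := p d.snd
  have hpt : ∀ ε : ℝ, 0 < ε → 0 < orient u v ((u + v) / 2 + ε * Complex.I * (v - u)) := by
    intro ε hε
    have h1 : orient u v ((u + v) / 2 + ε * Complex.I * (v - u)) =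
        ε * Complex.normSq (v - u) := by
      rw [orient_add, mul_assoc, crossProd_ofReal_mul, crossProd_I_mul_self]
      have : orient u v ((u + v) / 2) = 0 := by
        simp [orient, crossProd]; ring
      rw [this, zero_add]
    rw [h1]
    exact mul_pos hε (Complex.normSq_pos.mpr hne)
  have hconv : Convex ℝ {z | 0 < orient u v z} := by
    intro a ha b hb s t hs ht hst
    have ha : 0 < orient u v a := ha
    have hb : 0 < orient u v b := hb
    change 0 < orient u v (s • a + t • b)
    rw [orient_combo _ _ _ _ hst]
    rcases hs.eq_or_lt with rfl | hs
    · rw [zero_add] at hst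
      rw [hst]; linarith
    · have := mul_pos hs ha
      have := mul_nonneg ht hb.le
      linarith
  have hsub : {z | 0 < orient u v z} ⊆ (drawnSet G p)ᶜ := by
    rintro z hz (⟨w, rfl⟩ | hz')
    · exact absurd hz (not_lt.mpr (hle w))
    · obtain ⟨e, s, t, hs, ht, hst, rfl⟩ := Set.mem_iUnion.mp hz'
      have hz : 0 < orient u v (s • p e.fst + t • p e.snd) := hz
      rw [orient_combo _ _ _ _ hst] at hz
      have := mul_nonpos_of_nonneg_of_nonpos hs (hle e.fst)
      have := mul_nonpos_of_nonneg_of_nonpos ht (hle e.snd)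
      linarith
  have hunb : ¬Bornology.IsBounded {z | 0 < orient u v z} := by
    intro hb
    obtain ⟨R, hR⟩ := hb.exists_norm_le
    have hn : 0 < ‖v - u‖ := norm_pos_iff.mpr hne
    have hR0 : 0 ≤ R := (norm_nonneg _).trans (hR _ (hpt 1 one_pos))
    let t : ℝ := (R + ‖(u + v) / 2‖ + 1) / ‖v - u‖
    have ht : 0 < t := by positivity
    have h1 := hR _ (hpt t ht)
    have h2 := norm_sub_le ((u + v) / 2 + t * Complex.I * (v - u)) ((u + v) / 2)
    rw [add_sub_cancel_left, norm_mul, norm_mul, Complex.norm_I, mul_one, Complex.norm_real,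
      Real.norm_of_nonneg ht.le, div_mul_cancel₀ _ hn.ne'] at h2
    linarith
  filter_upwards [self_mem_nhdsWithin] with ε hε hb
  exact hunb (hb.subset (hconv.isPreconnected.subset_connectedComponentIn (hpt ε hε) hsub))

theorem isPlanarDrawing (hp : T.PositiveInner p) (hT : T.IsTriangulation) [Finite V] :
    T.IsPlanarDrawing p :=
  ⟨hp.isPlanarStraightLine hT, fun _ _ h => hp.ccwAngle_rot_le hT h,
    fun _ hd => hp.leftUnbounded hT hd⟩

end PositiveInner

end PlaneGraph

/-! ### Other embeddings and the limit to arbitrary areas. -/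

theorem IsGenericZeroSum.comp_equiv {F F' : Type*} {a : F → ℝ} (h : IsGenericZeroSum a)
    (ψ : F' ≃ F) : IsGenericZeroSum (a ∘ ψ) := by
  refine ⟨(finsum_comp_equiv ψ).trans h.sum_eq_zero, fun f₀ => ?_⟩
  exact (h.algebraicIndependent (ψ f₀)).comp
    (fun f : {f // f ≠ f₀} => ⟨ψ f.1, fun hf => f.2 (ψ.injective hf)⟩) fun f g hfg =>
      Subtype.ext (ψ.injective (congrArg Subtype.val hfg))

theorem IsGenericZeroSum.neg {F : Type*} [Finite F] {a : F → ℝ} (h : IsGenericZeroSum a) :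
    IsGenericZeroSum (-a) := by
  refine ⟨?_, fun f₀ => (h.algebraicIndependent f₀).of_mem_adjoin (fun j => ?_) le_rfl⟩
  · simp only [Pi.neg_apply, finsum_neg_distrib, h.sum_eq_zero, neg_zero]
  · have := neg_mem (Algebra.subset_adjoin (R := ℚ)
      (Set.mem_range_self (f := fun f : {f // f ≠ f₀} => (-a) f.1) j))
    simpa using this

namespace PlaneGraph

variable {V : Type*} {G : SimpleGraph V} {T : PlaneGraph G}

/-- There are vertex placements that realize all generic signed face areas. -/
def RealizesGeneric (T : PlaneGraph G) : Prop :=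
  ∀ a : T.Face → ℝ, IsGenericZeroSum a → ∃ x y : V → ℝ, ∀ d, T.faceDet x y d = a (T.face d)

theorem exists_faceEquiv (hT : T.IsTriangulation) [Finite V] {T' : PlaneGraph G}
    (hT' : T'.IsTriangulation) (σ : Equiv.Perm G.Dart)
    (hσ : ∀ d, T'.face (σ (T.facePerm d)) = T'.face (σ d)) :
    ∃ ψ : T.Face ≃ T'.Face, ∀ d, ψ (T.face d) = T'.face (σ d) := by
  let ψ : T.Face → T'.Face := Quotient.lift (fun d => T'.face (σ d)) fun _ _ h =>
    Equiv.Perm.SameCycle.apply_eq (g := fun d => T'.face (σ d)) hσ h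
  have hψ : Function.Surjective ψ := fun f => by
    obtain ⟨d, rfl⟩ := T'.face_surjective f
    exact ⟨T.face (σ.symm d), congrArg T'.face (σ.apply_symm_apply d)⟩
  have hcard : Nat.card T.Face ≤ Nat.card T'.Face := by
    have := hT.card_face
    have := hT'.card_face
    omega
  exact ⟨Equiv.ofBijective ψ (hψ.bijective_of_nat_card_le hcard), fun d => rfl⟩

/-- The outer face does not enter `RealizesGeneric`. For the reflected triangulation all face
determinants change sign, so the negated areas are realized instead. -/
theorem RealizesGeneric.of_isTriangulation (h : T.RealizesGeneric) (hT : T.IsTriangulation)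
    [Finite V] (hV : 4 ≤ Nat.card V) {T' : PlaneGraph G} (hT' : T'.IsTriangulation) :
    T'.RealizesGeneric := by
  intro a' ha'
  rcases hT.apex_eq_or_apex_eq hV hT' with happ | happ
  · have hφ : ∀ d, T'.facePerm d = T.facePerm d := fun d =>
      SimpleGraph.Dart.ext_fst_snd ((T'.facePerm_fst d).trans (T.facePerm_fst d).symm) (happ d)
    obtain ⟨ψ, hψ⟩ := exists_faceEquiv hT hT' (Equiv.refl _) (fun d => by
      rw [Equiv.refl_apply, Equiv.refl_apply, ← hφ, T'.face_facePerm])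
    obtain ⟨x, y, hxy⟩ := h _ (ha'.comp_equiv ψ)
    refine ⟨x, y, fun d => ?_⟩
    rw [faceDet, hφ]
    refine (hxy d).trans ?_
    rw [Function.comp_apply, hψ, Equiv.refl_apply]
  · have hφ : ∀ d : G.Dart, (T.facePerm d).symm = T'.facePerm (T'.facePerm d.symm) := by
      intro d
      refine SimpleGraph.Dart.ext_fst_snd ?_ ?_
      · rw [T'.facePerm_facePerm_fst, happ, SimpleGraph.Dart.symm_symm]
        rfl
      · rw [hT'.facePerm_facePerm_snd]
        exact T.facePerm_fst d
    obtain ⟨ψ, hψ⟩ := exists_faceEquiv hT hT'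
      (SimpleGraph.Dart.symm_involutive (G := G)).toPerm (fun d => by
        change T'.face (T.facePerm d).symm = T'.face d.symm
        rw [hφ, T'.face_facePerm, T'.face_facePerm])
    obtain ⟨x, y, hxy⟩ := h _ (ha'.comp_equiv ψ).neg
    refine ⟨x, y, fun d => ?_⟩
    have h1 : T'.faceDet x y d = -T.faceDet x y d.symm := by
      have h2 : T'.faceDet x y d = triDet x y d.fst d.snd (T'.apex d) := rfl
      rw [h2, happ]
      change _ = -triDet x y d.snd d.fst (T.apex d.symm)
      simp only [triDet_eq]
      ring
    rw [h1, hxy, Pi.neg_apply, neg_neg, Function.comp_apply, hψ]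
    exact congrArg (fun d => a' (T'.face d)) (SimpleGraph.Dart.symm_symm d)

theorem isGenericZeroSum_extendedArea [Finite V] {A : T.AreaAssignment} (hA : T.AlgIndep A) :
    IsGenericZeroSum (T.extendedArea A) := by
  classical
  have : Fintype T.Face := Fintype.ofFinite _
  have hin : ∀ g : {f // f ≠ T.outer}, T.extendedArea A g.1 = A g := fun g => dif_neg g.2
  refine IsGenericZeroSum.of_algebraicIndependent (f₁ := T.outer) ?_ ?_
  · rw [finsum_eq_sum_of_fintype, Fintype.sum_eq_add_sum_subtype_ne _ T.outer]
    simp only [hin]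
    rw [extendedArea, dif_pos rfl]
    have : (∑ᶠ g : T.InnerFace, (A g : ℝ)) = ∑ g : {f // f ≠ T.outer}, (A g : ℝ) :=
      finsum_eq_sum_of_fintype (α := {f // f ≠ T.outer}) _
    rw [this, neg_add_cancel]
  · simp only [hin]
    exact hA

theorem IsTriangulation.faceArea_face (hT : T.IsTriangulation) (p : V → ℂ) (d : G.Dart) :
    T.faceArea p (T.face d) = orient (p d.fst) (p d.snd) (p (T.apex d)) / 2 := by
  classical
  have h : {d' | T.face d' = T.face d} =
      (({d, T.facePerm d, T.facePerm (T.facePerm d)} : Finset G.Dart) : Set G.Dart) := by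
    ext d'
    simp [hT.face_eq_iff]
  have hne1 : ∀ d, d ≠ T.facePerm d := fun d h => by
    have := T.facePerm_fst d
    rw [← h] at this
    exact d.fst_ne_snd this
  have hne2 : d ≠ T.facePerm (T.facePerm d) := fun h => by
    have := T.facePerm_facePerm_fst d
    rw [← h] at this
    exact (hT.apex_adj d).ne' this
  rw [faceArea, h, finsum_mem_coe_finset, Finset.sum_insert (by simp [hne1 d, hne2]),
    Finset.sum_pair (hne1 _), T.facePerm_fst, T.facePerm_facePerm_fst, hT.facePerm_facePerm_snd]
  change (_ + ((p d.snd).re * (p (T.apex d)).im - (p (T.apex d)).re * (p d.snd).im + _)) / 2 = _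
  congr 1
  simp only [orient, crossProd, Complex.sub_re, Complex.sub_im]
  ring

/-- Up to area-preserving affine maps the vertices are in a disk whose radius depends on the area
of the outer triangle. -/
theorem PositiveInner.exists_norm_le {p : V → ℂ} (hp : T.PositiveInner p)
    (hT : T.IsTriangulation) [Finite V] {d : G.Dart} (hd : T.face d = T.outer) :
    ∃ p' : V → ℂ, (∀ u v w, orient (p' u) (p' v) (p' w) = orient (p u) (p v) (p w)) ∧
      ∀ v, ‖p' v‖ ≤ √(-orient (p d.fst) (p d.snd) (p (T.apex d))) := by
  have hneg := hp.outer_neg hT hd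
  set a := p d.fst
  set b := p d.snd
  set c := p (T.apex d)
  set D := orient a b c with hD
  set r := √(-D)
  have hr : r * r = -D := Real.mul_self_sqrt (by linarith)
  have hr0 : 0 ≤ r := Real.sqrt_nonneg _
  have hd1 : T.face (T.facePerm d) = T.outer := by rw [T.face_facePerm, hd]
  have hd2 : T.face (T.facePerm (T.facePerm d)) = T.outer := by rw [T.face_facePerm, hd1]
  -- Barycentric coordinates scaled by `r`: the outer triangle becomes `(0, 0)`, `(r, 0)`, `(0, -r)`
  -- with the same signed area.
  refine ⟨fun v => ⟨r * (orient c a (p v) / D), -(r * (orient a b (p v) / D))⟩,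
    fun u v w => ?_, fun v => ?_⟩
  · have h1 : orient (⟨r * (orient c a (p u) / D), -(r * (orient a b (p u) / D))⟩ : ℂ)
        ⟨r * (orient c a (p v) / D), -(r * (orient a b (p v) / D))⟩
        ⟨r * (orient c a (p w) / D), -(r * (orient a b (p w) / D))⟩ =
        -(r * r) / (D * D) * ((orient c a (p v) - orient c a (p u)) *
          (orient a b (p w) - orient a b (p u)) - (orient c a (p w) - orient c a (p u)) *
          (orient a b (p v) - orient a b (p u))) := by
      simp only [orient, crossProd, Complex.sub_re, Complex.sub_im]
      ring
    have h2 : ((orient c a (p v) - orient c a (p u)) *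
          (orient a b (p w) - orient a b (p u)) - (orient c a (p w) - orient c a (p u)) *
          (orient a b (p v) - orient a b (p u))) = D * orient (p u) (p v) (p w) := by
      rw [hD]
      simp only [orient, crossProd, Complex.sub_re, Complex.sub_im]
      ring
    have hD0 := hneg.ne
    rw [h1, h2, hr]
    field_simp
  · have l1 : orient a b (p v) ≤ 0 := hp.orient_le_zero hT hd v
    have l2 : orient b c (p v) ≤ 0 := by
      have := hp.orient_le_zero hT hd1 v
      rwa [T.facePerm_fst] at this
    have l3 : orient c a (p v) ≤ 0 := by
      have := hp.orient_le_zero hT hd2 v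
      rwa [T.facePerm_facePerm_fst, hT.facePerm_facePerm_snd] at this
    have hsum : orient a b (p v) + orient b c (p v) + orient c a (p v) = D := by
      rw [hD]
      simp only [orient, crossProd, Complex.sub_re, Complex.sub_im]
      ring
    have e1 : 0 ≤ orient a b (p v) / D := div_nonneg_of_nonpos l1 hneg.le
    have e3 : 0 ≤ orient c a (p v) / D := div_nonneg_of_nonpos l3 hneg.le
    have e2 : orient c a (p v) / D + orient a b (p v) / D ≤ 1 := by
      rw [← add_div, div_le_one_of_neg hneg]
      linarith
    refine (Complex.norm_le_abs_re_add_abs_im _).trans ?_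
    rw [abs_neg, abs_of_nonneg (mul_nonneg hr0 e3), abs_of_nonneg (mul_nonneg hr0 e1), ← mul_add]
    exact mul_le_of_le_one_right hr0 e2

theorem RealizesGeneric.exists_positiveInner (h : T.RealizesGeneric) (hT : T.IsTriangulation)
    [Finite V] {A : T.AreaAssignment} (hA : T.AlgIndep A) :
    ∃ p : V → ℂ, T.PositiveInner p ∧ (∀ f : T.InnerFace, T.faceArea p f.1 = A f / 2) ∧
      ∀ v, ‖p v‖ ≤ √(∑ᶠ f : T.InnerFace, (A f : ℝ)) := by
  obtain ⟨x, y, hxy⟩ := h _ (isGenericZeroSum_extendedArea hA)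
  let p : V → ℂ := fun v => ⟨x v, y v⟩
  have horient : ∀ d, orient (p d.fst) (p d.snd) (p (T.apex d)) = T.extendedArea A (T.face d) :=
    fun d => (faceDet_eq_orient p d).symm.trans (hxy d)
  have hin : ∀ d (hd : T.face d ≠ T.outer), T.extendedArea A (T.face d) = A ⟨T.face d, hd⟩ :=
    fun d hd => dif_neg hd
  have hp : T.PositiveInner p := fun d hd => by
    rw [horient, hin d hd]
    refine lt_of_le_of_ne (NNReal.coe_nonneg _) (Ne.symm ?_)
    exact hA.ne_zero (⟨T.face d, hd⟩ : T.InnerFace)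
  obtain ⟨d₀, hd₀⟩ := T.face_surjective T.outer
  obtain ⟨p', h1, h2⟩ := hp.exists_norm_le hT hd₀
  refine ⟨p', fun d hd => by rw [h1]; exact hp d hd, ?_, ?_⟩
  · rintro ⟨f, hf⟩
    obtain ⟨d, rfl⟩ := T.face_surjective f
    rw [hT.faceArea_face, h1, horient, hin d hf]
  · rw [horient, hd₀] at h2
    simpa [extendedArea] using h2

/-- Rational approximations of `A`, shifted by a vanishing rational multiple of the fixed
independent family `b`. -/
theorem exists_tendsto_algIndep [Finite V] {b : T.AreaAssignment} (hb : T.AlgIndep b)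
    (A : T.AreaAssignment) : ∃ B : ℕ → T.AreaAssignment, (∀ k, T.AlgIndep (B k)) ∧
      ∀ f, Filter.Tendsto (fun k => (B k f : ℝ)) Filter.atTop (𝓝 (A f)) := by
  have : Finite T.InnerFace := Subtype.finite
  refine ⟨fun k f => ⌊(A f : ℝ) * ((k + 1 : ℕ) : ℝ)⌋₊ / ((k + 1 : ℕ) : ℝ≥0) +
    b f / ((k + 1 : ℕ) : ℝ≥0), fun k => ?_, fun f => ?_⟩
  · refine AlgebraicIndependent.of_mem_adjoin hb (fun f => ?_) le_rfl
    set t : T.InnerFace → ℝ := fun f => ((⌊(A f : ℝ) * ((k + 1 : ℕ) : ℝ)⌋₊ / ((k + 1 : ℕ) : ℝ≥0) +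
      b f / ((k + 1 : ℕ) : ℝ≥0) : ℝ≥0) : ℝ) with ht
    have h1 : (b f : ℝ) = ((k + 1 : ℕ) : ℝ) * t f - (⌊(A f : ℝ) * ((k + 1 : ℕ) : ℝ)⌋₊ : ℝ) := by
      have : ((k + 1 : ℕ) : ℝ) ≠ 0 := Nat.cast_ne_zero.mpr k.succ_ne_zero
      simp only [ht, NNReal.coe_add, NNReal.coe_div, NNReal.coe_natCast]
      field_simp
      ring
    rw [h1]
    exact sub_mem (mul_mem (natCast_mem _ _) (Algebra.subset_adjoin ⟨f, rfl⟩)) (natCast_mem _ _)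
  · have hk : Filter.Tendsto (fun k : ℕ => ((k + 1 : ℕ) : ℝ)) Filter.atTop Filter.atTop :=
      tendsto_natCast_atTop_atTop.comp (Filter.tendsto_add_atTop_nat 1)
    have h1 := (tendsto_nat_floor_mul_div_atTop (NNReal.coe_nonneg (A f))).comp hk
    have h2 := hk.const_div_atTop (b f : ℝ)
    have h3 := h1.add h2
    rw [add_zero] at h3
    refine h3.congr fun k => ?_
    simp

theorem RealizesGeneric.areaUniversal (h : T.RealizesGeneric) (hT : T.IsTriangulation)
    [Finite V] {b : T.AreaAssignment} (hb : T.AlgIndep b) : T.AreaUniversal := by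
  have : Fintype V := Fintype.ofFinite V
  have : Finite T.InnerFace := Subtype.finite
  have : Fintype T.InnerFace := Fintype.ofFinite _
  intro A
  -- The determinants are twice the areas, hence the factor 2.
  obtain ⟨B, hB, hlim⟩ := exists_tendsto_algIndep hb fun f => 2 * A f
  choose p hp harea hnorm using fun k => h.exists_positiveInner hT (hB k)
  simp only [finsum_eq_sum_of_fintype] at hnorm
  have hsum : Filter.Tendsto (fun k => √(∑ f, (B k f : ℝ))) Filter.atTop
      (𝓝 √(∑ f, ((2 * A f : ℝ≥0) : ℝ))) :=
    (tendsto_finsetSum _ fun f _ => hlim f).sqrt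
  obtain ⟨R, hR⟩ := hsum.bddAbove_range
  have hR0 : 0 ≤ R := (Real.sqrt_nonneg _).trans (hR ⟨0, rfl⟩)
  have hball : ∀ k, p k ∈ Metric.closedBall (0 : V → ℂ) R := fun k => by
    rw [mem_closedBall_zero_iff, pi_norm_le_iff_of_nonneg hR0]
    exact fun v => (hnorm k v).trans (hR ⟨k, rfl⟩)
  obtain ⟨q, -, φ, hφ, hq⟩ := tendsto_subseq_of_bounded Metric.isBounded_closedBall hball
  refine ⟨q, mem_closure_of_tendsto hq (Filter.Eventually.of_forall fun k =>
    (hp (φ k)).isPlanarDrawing hT), ?_⟩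
  rintro ⟨f, hf⟩
  obtain ⟨d, rfl⟩ := T.face_surjective f
  have hcont : Continuous fun q : V → ℂ => T.faceArea q (T.face d) := by
    simp only [hT.faceArea_face, orient, crossProd]
    fun_prop
  have h1 : Filter.Tendsto (fun k => T.faceArea (p (φ k)) (T.face d)) Filter.atTop
      (𝓝 (T.faceArea q (T.face d))) := (hcont.tendsto q).comp hq
  have h2 : Filter.Tendsto (fun k => T.faceArea (p (φ k)) (T.face d)) Filter.atTop
      (𝓝 (((2 * A ⟨T.face d, hf⟩ : ℝ≥0) : ℝ) / 2)) := by
    refine (((hlim ⟨T.face d, hf⟩).comp hφ.tendsto_atTop).div_const 2).congr fun k => ?_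
    exact (harea (φ k) ⟨T.face d, hf⟩).symm
  rw [tendsto_nhds_unique h1 h2]
  push_cast
  ring

theorem exists_algIndep (hT : T.IsTriangulation) [Finite V] {T' : PlaneGraph G}
    (hT' : T'.IsTriangulation) {A : T.AreaAssignment} (hA : T.AlgIndep A) :
    ∃ b : T'.AreaAssignment, T'.AlgIndep b := by
  have : Finite T.InnerFace := Subtype.finite
  have : Finite T'.InnerFace := Subtype.finite
  have hcard : Nat.card T'.InnerFace = Nat.card T.InnerFace := by
    have h1 := Nat.card_subtype_ne_add_one T.outer
    have h2 := Nat.card_subtype_ne_add_one T'.outer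
    have h3 := hT.card_face
    have h4 := hT'.card_face
    change Nat.card {f // f ≠ T'.outer} = Nat.card {f // f ≠ T.outer}
    omega
  obtain ⟨ψ⟩ := Finite.card_eq.mp hcard
  exact ⟨A ∘ ψ, hA.comp _ ψ.injective⟩

end PlaneGraph

theorem corollary1 {V : Type*} [Finite V] {G : SimpleGraph V}
    (T : PlaneGraph G) (hT : T.IsTriangulation) (P : POrder G)
    (A : T.AreaAssignment) (hA : T.AlgIndep A)
    (f : RatFunc ℝ) (hf : T.IsLastFaceFunction P A f)
    (p q : ℝ[X]) (hq : q ≠ 0)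
    (hpq : f = algebraMap ℝ[X] (RatFunc ℝ) p / algebraMap ℝ[X] (RatFunc ℝ) q)
    (hcrr : CRR p q) (hodd : Odd (maxDegree p q)) :
    ∀ T' : PlaneGraph G, T'.AreaUniversal := by
  intro T'
  obtain ⟨e, x₃, x, y, he, hxy, rfl⟩ := hf
  have hV : 4 ≤ Nat.card V := by rw [P.card_eq]; omega
  have hT' : T'.IsTriangulation := hT.of_isTriangulation hV
  have hreal : T.RealizesGeneric := fun _ ha => hT.exists_faceDet_eq
    (PlaneGraph.isGenericZeroSum_extendedArea hA) he hxy.x_one hxy.y_one hxy.x_two hxy.y_two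
    hxy.x_three hxy.x_four hxy.area_eq hq hpq hcrr hodd ha
  obtain ⟨b, hb⟩ := PlaneGraph.exists_algIndep hT hT' hA
  exact (hreal.of_isTriangulation hT hV hT').areaUniversal hT' hb
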